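/- A *plane bipartite map* is a connected map in the plane whose vertices are coloured white and black so that every edge joins a white vertex to a black one; maps are considered up to orientation-preserving isomorphisms that preserve the colours (and the infinite face). A *plane bipartite tree* is such a map with exactly one face; the two one-vertex trees (white or black) are included. A *$2^1$-map* is a plane bipartite map with exactly two faces, the infinite one and one of perimeter $2$. To a map $D$ with $V$ vertices and $E$ edges, having $k_i$ white and $l_i$ black vertices of degree $i$ ($i\ge 0$), assign the monomial $$w(D)=\prod_{i\ge0}a_i^{k_i}\prod_{i\ge0}b_i^{l_i}\;t^{V}x^{E}.$$ For a finitely supported sequence $k=(k_1,k_2,\dots)$ of nonnegative integers put $|k|=\sum_i k_i$, $\|k\|=\sum_i i\,k_i$, $k!=\prod_i k_i!$, $a^k=\prod_i a_i^{k_i}$, and let $$A(a,t,x)=\sum_{k\ne0}\frac{(|k|-1)!}{k!}\,a^k t^{|k|}x^{\|k\|},\qquad B(b,t,y)=\sum_{l\ne0}\frac{(|l|-1)!}{l!}\,b^l t^{|l|}y^{\|l\|}.$$ Let $T(a,b,t,x)$ be the formal power series over $\mathbb Q$ obtained from $A(a,t,x)\cdot B(b,t,y)$ by keeping only the terms with $\deg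 x=\deg y=\deg t-1$, setting $y=1$ in them, and adding the terms $a_0t+b_0t$. Let $$D_a=a_2x\,\frac{\partial}{\partial a_0}+\sum_{k\ge1}k\,a_{k+2}\,x\,\frac{\partial}{\partial a_k},\qquad D_b=b_2x\,\frac{\partial}{\partial b_0}+\sum_{k\ge1}k\,b_{k+2}\,x\,\frac{\partial}{\partial b_k}.$$ **Theorem 2.1.** The series $T$ is the generating function of plane bipartite trees, $$T(a,b,t,x)=\sum_{\tau}\frac{1}{\#\mathrm{Aut}(\tau)}\,w(\tau),$$ the sum being over isomorphism classes of plane bipartite trees, and the generating function $M(a,b,t,x)=\sum_{D}w(D)$ of $2^1$-maps (the sum being over isomorphism classes of $2^1$-maps) is $$M(a,b,t,x)=D_a(T)\cdot D_b(T).$$ -/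

import Mathlib

/-! ### Plane bipartite maps -/

/-- A bipartite map with white vertices `W`, black vertices `B` and edges `E`, given by its
rotation system: every edge `e` joins the white vertex `atW e` to the black vertex `atB e`, and
`rotW e` (`rotB e`) is the edge that follows `e` counterclockwise around its white (black) end.
Vertices without edges are allowed, so that the two maps with one vertex are included. -/
structure BMap (W B E : Type) where
  atW : E → W
  atB : E → B
  rotW : Equiv.Perm E
  rotB : Equiv.Perm E
  atW_eq_iff : ∀ e e', atW e = atW e' ↔ rotW.SameCycle e e'
  atB_eq_iff : ∀ e e', atB e = atB e' ↔ rotB.SameCycle e e'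

namespace BMap

variable {W B E W' B' E' W'' B'' E'' : Type}

/-- Degree of a white vertex. -/
noncomputable def degW (m : BMap W B E) (w : W) : ℕ := Nat.card {e : E // m.atW e = w}

/-- Degree of a black vertex. -/
noncomputable def degB (m : BMap W B E) (b : B) : ℕ := Nat.card {e : E // m.atB e = b}

/-- The underlying simple graph on the set of all vertices (only used for connectedness). -/
def graph (m : BMap W B E) : SimpleGraph (W ⊕ B) :=
  SimpleGraph.fromRel fun u v => ∃ e, u = Sum.inl (m.atW e) ∧ v = Sum.inr (m.atB e)

/-- Walking along the boundary of a face: go along `e` from its white end to its black end, turn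
into `rotB e`, go along it to its white end, and turn into `rotW (rotB e)`. Every face boundary is
thus described by one cycle of this permutation, which lists the edges that are passed from white
to black. -/
def facePerm (m : BMap W B E) : Equiv.Perm E := m.rotW * m.rotB

/-- The faces of a map with at least one edge. -/
def Face (m : BMap W B E) : Type := Quotient (Equiv.Perm.SameCycle.setoid m.facePerm)

/-- The face on the boundary of which `e` is passed from its white end to its black end. -/
def faceOf (m : BMap W B E) (e : E) : m.Face :=
  Quotient.mk (Equiv.Perm.SameCycle.setoid m.facePerm) e

/-- The perimeter of a face, i.e. the number of edge sides on its boundary: half of them are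
passed from white to black, the other half from black to white. -/
noncomputable def perimeter (m : BMap W B E) (f : m.Face) : ℕ :=
  2 * Nat.card {e : E // m.faceOf e = f}

open Classical in
/-- The number of faces; a one-vertex map without edges has one face. -/
noncomputable def numFaces (m : BMap W B E) : ℕ := if IsEmpty E then 1 else Nat.card m.Face

/-- `m` is a connected map on the sphere (equivalently, in the plane): it is connected, and Euler's
formula `V - E + F = 2` holds. -/
def IsPlane (m : BMap W B E) : Prop :=
  m.graph.Connected ∧ Nat.card W + Nat.card B + m.numFaces = Nat.card E + 2

/-- Isomorphisms of bipartite maps: they preserve colours, incidence and orientation. -/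
structure Iso (m : BMap W B E) (m' : BMap W' B' E') where
  onW : W ≃ W'
  onB : B ≃ B'
  onE : E ≃ E'
  map_atW : ∀ e, onW (m.atW e) = m'.atW (onE e)
  map_atB : ∀ e, onB (m.atB e) = m'.atB (onE e)
  map_rotW : ∀ e, onE (m.rotW e) = m'.rotW (onE e)
  map_rotB : ∀ e, onE (m.rotB e) = m'.rotB (onE e)

/-- The identity. -/
def Iso.refl (m : BMap W B E) : Iso m m :=
  ⟨Equiv.refl _, Equiv.refl _, Equiv.refl _, fun _ => rfl, fun _ => rfl, fun _ => rfl,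
    fun _ => rfl⟩

/-- The inverse isomorphism. -/
def Iso.symm {m : BMap W B E} {m' : BMap W' B' E'} (φ : Iso m m') : Iso m' m where
  onW := φ.onW.symm
  onB := φ.onB.symm
  onE := φ.onE.symm
  map_atW e := by rw [Equiv.symm_apply_eq, φ.map_atW, Equiv.apply_symm_apply]
  map_atB e := by rw [Equiv.symm_apply_eq, φ.map_atB, Equiv.apply_symm_apply]
  map_rotW e := by rw [Equiv.symm_apply_eq, φ.map_rotW, Equiv.apply_symm_apply]
  map_rotB e := by rw [Equiv.symm_apply_eq, φ.map_rotB, Equiv.apply_symm_apply]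

/-- Composition of isomorphisms. -/
def Iso.trans {m : BMap W B E} {m' : BMap W' B' E'} {m'' : BMap W'' B'' E''}
    (φ : Iso m m') (ψ : Iso m' m'') : Iso m m'' where
  onW := φ.onW.trans ψ.onW
  onB := φ.onB.trans ψ.onB
  onE := φ.onE.trans ψ.onE
  map_atW e := by simp [φ.map_atW, ψ.map_atW]
  map_atB e := by simp [φ.map_atB, ψ.map_atB]
  map_rotW e := by simp [φ.map_rotW, ψ.map_rotW]
  map_rotB e := by simp [φ.map_rotB, ψ.map_rotB]

instance [Finite W] [Finite B] [Finite E] : Finite (BMap W B E) :=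
  Finite.of_injective
    (fun m : BMap W B E => ((m.atW, m.atB), ((m.rotW : E → E), (m.rotB : E → E)))) (by
      rintro ⟨a, b, c, d, _, _⟩ ⟨a', b', c', d', _, _⟩ h
      simp only [Prod.mk.injEq, DFunLike.coe_fn_eq] at h
      obtain ⟨⟨rfl, rfl⟩, rfl, rfl⟩ := h
      rfl)

instance (m : BMap W B E) [Finite E] : Finite m.Face :=
  inferInstanceAs (Finite (Quotient _))

end BMap

/-- A plane bipartite tree (with labelled vertices and edges): a plane bipartite map with exactly
one face. -/
structure PlaneTree where
  nW : ℕ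
  nB : ℕ
  nE : ℕ
  map : BMap (Fin nW) (Fin nB) (Fin nE)
  isPlane : map.IsPlane
  oneFace : map.numFaces = 1

/-- Plane trees are considered up to isomorphism. -/
instance PlaneTree.isoSetoid : Setoid PlaneTree where
  r S T := Nonempty (S.map.Iso T.map)
  iseqv := ⟨fun T => ⟨BMap.Iso.refl T.map⟩, fun ⟨φ⟩ => ⟨φ.symm⟩, fun ⟨φ⟩ ⟨ψ⟩ => ⟨φ.trans ψ⟩⟩

/-- A `2^1`-map (with labelled vertices and edges): a plane bipartite map with exactly two faces,
one of which is chosen to be the infinite face and the other of which has perimeter 2. -/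
structure TwoOneMap where
  nW : ℕ
  nB : ℕ
  nE : ℕ
  map : BMap (Fin nW) (Fin nB) (Fin nE)
  outer : map.Face
  isPlane : map.IsPlane
  twoFaces : map.numFaces = 2
  perimeter_eq : ∀ f, f ≠ outer → map.perimeter f = 2

/-- `2^1`-maps are considered up to isomorphisms that preserve the infinite face. -/
instance TwoOneMap.isoSetoid : Setoid TwoOneMap where
  r S T := ∃ φ : S.map.Iso T.map,
    ∀ e, S.map.faceOf e = S.outer ↔ T.map.faceOf (φ.onE e) = T.outer
  iseqv := by
    refine ⟨fun T => ⟨BMap.Iso.refl T.map, fun _ => Iff.rfl⟩, ?_, ?_⟩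
    · rintro S T ⟨φ, h⟩
      refine ⟨φ.symm, fun e => ?_⟩
      rw [h]
      simp [BMap.Iso.symm]
    · rintro S T U ⟨φ, h⟩ ⟨ψ, h'⟩
      exact ⟨φ.trans ψ, fun e => (h e).trans (h' _)⟩

/-! ### Formal variables, passports, generating functions -/

/-- The formal variables `a_0, a_1, …`, `b_0, b_1, …`, `t`, `x`, `y`. -/
inductive Var : Type
  | a (i : ℕ)
  | b (i : ℕ)
  | t
  | x
  | y

/-- The passport of a map together with the number of vertices (exponent of `t`) and the number of
edges (exponent of `x`), as a monomial: `∏ a_{deg w} * ∏ b_{deg b} * t ^ V * x ^ E`. -/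
noncomputable def BMap.weight {p q n : ℕ} (m : BMap (Fin p) (Fin q) (Fin n)) : Var →₀ ℕ :=
  ∑ w, Finsupp.single (Var.a (m.degW w)) 1 + ∑ b, Finsupp.single (Var.b (m.degB b)) 1 +
    Finsupp.single Var.t (p + q) + Finsupp.single Var.x n

/-- The power series whose coefficient at the monomial with exponents `d` is `f d`. -/
def ofCoeff (f : (Var →₀ ℕ) → ℚ) : MvPowerSeries Var ℚ := f

/-- The formal sum `∑_{i ∈ ι} c i * (monomial with exponents wt i)`, for a family in which every
monomial occurs only finitely often. -/
noncomputable def genSeries {ι : Type} (wt : ι → Var →₀ ℕ) (c : ι → ℚ) : MvPowerSeries Var ℚ :=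
  ofCoeff fun d => ∑ᶠ i : {i : ι // wt i = d}, c i

theorem BMap.weight_t {p q n : ℕ} (m : BMap (Fin p) (Fin q) (Fin n)) :
    m.weight Var.t = p + q := by
  simp [BMap.weight]

theorem BMap.weight_x {p q n : ℕ} (m : BMap (Fin p) (Fin q) (Fin n)) : m.weight Var.x = n := by
  simp [BMap.weight]

/-- Finitely many labelled plane trees have a given weight. -/
theorem PlaneTree.finite_weight (d : Var →₀ ℕ) : Finite {T : PlaneTree // T.map.weight = d} := by
  let κ := Σ p : Fin (d Var.t + 1), Σ q : Fin (d Var.t + 1), BMap (Fin p) (Fin q) (Fin (d Var.x))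
  let g : κ → Option PlaneTree := fun s => by
    classical
    exact if h : s.2.2.IsPlane ∧ s.2.2.numFaces = 1 then some ⟨_, _, _, s.2.2, h.1, h.2⟩ else none
  have key : {T : PlaneTree | T.map.weight = d} ⊆ some ⁻¹' Set.range g := by
    rintro ⟨p, q, n, m, h1, h2⟩ (h : m.weight = d)
    have ht := m.weight_t
    have hx := m.weight_x
    rw [h] at ht hx
    subst hx
    exact ⟨⟨⟨p, by omega⟩, ⟨q, by omega⟩, m⟩, dif_pos ⟨h1, h2⟩⟩
  exact (((Set.finite_range g).preimage (Option.some_injective _).injOn).subset key).to_subtype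

/-- Finitely many labelled `2^1`-maps have a given weight. -/
theorem TwoOneMap.finite_weight (d : Var →₀ ℕ) : Finite {T : TwoOneMap // T.map.weight = d} := by
  let κ := Σ p : Fin (d Var.t + 1), Σ q : Fin (d Var.t + 1),
    Σ m : BMap (Fin p) (Fin q) (Fin (d Var.x)), m.Face
  let g : κ → Option TwoOneMap := fun s => by
    classical
    exact if h : s.2.2.1.IsPlane ∧ s.2.2.1.numFaces = 2 ∧
      ∀ f, f ≠ s.2.2.2 → s.2.2.1.perimeter f = 2 then
        some ⟨_, _, _, s.2.2.1, s.2.2.2, h.1, h.2.1, h.2.2⟩ else none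
  have key : {T : TwoOneMap | T.map.weight = d} ⊆ some ⁻¹' Set.range g := by
    rintro ⟨p, q, n, m, f, h1, h2, h3⟩ (h : m.weight = d)
    have ht := m.weight_t
    have hx := m.weight_x
    rw [h] at ht hx
    subst hx
    exact ⟨⟨⟨p, by omega⟩, ⟨q, by omega⟩, m, f⟩, dif_pos ⟨h1, h2, h3⟩⟩
  exact (((Set.finite_range g).preimage (Option.some_injective _).injOn).subset key).to_subtype

/-- The generating function of plane bipartite trees: isomorphism classes are counted by passport,
each with weight `1 / #Aut`. -/
noncomputable def planeTreeSeries : MvPowerSeries Var ℚ :=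
  genSeries (fun τ : Quotient PlaneTree.isoSetoid => τ.out.map.weight)
    fun τ => 1 / (Nat.card (τ.out.map.Iso τ.out.map) : ℚ)

/-- The generating function `M` of `2^1`-maps: isomorphism classes are counted by passport. -/
noncomputable def twoOneSeries : MvPowerSeries Var ℚ :=
  genSeries (fun μ : Quotient TwoOneMap.isoSetoid => μ.out.map.weight) fun _ => 1

/-- The exponents of `∏_i (v_i * t * z ^ i) ^ k_i`, i.e. of `v^k * t^|k| * z^||k||`. -/
noncomputable def seqWeight (v : ℕ → Var) (z : Var) (k : ℕ+ →₀ ℕ) : Var →₀ ℕ :=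
  k.sum fun i m => m • (Finsupp.single (v i) 1 + Finsupp.single Var.t 1 + Finsupp.single z (i : ℕ))

/-- The series `∑_{k ≠ 0} (|k| - 1)! / k! * v^k * t^|k| * z^||k||`, over the finitely supported
sequences `k = (k_1, k_2, …)`. -/
noncomputable def degreeSeries (v : ℕ → Var) (z : Var) : MvPowerSeries Var ℚ :=
  genSeries (fun k : {k : ℕ+ →₀ ℕ // k ≠ 0} => seqWeight v z k)
    fun k => ((k.1.degree - 1).factorial : ℚ) / (k.1.prod fun _ m => (m.factorial : ℚ))

/-- `A(a, t, x)`. -/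
noncomputable def seriesA : MvPowerSeries Var ℚ := degreeSeries Var.a Var.x

/-- `B(b, t, y)`. -/
noncomputable def seriesB : MvPowerSeries Var ℚ := degreeSeries Var.b Var.y

open Classical in
/-- `T(a, b, t, x)`: in `A(a, t, x) * B(b, t, y)` only the terms with
`deg x = deg y = deg t - 1` are kept (with `y ^ n` erased from `x ^ n * y ^ n`), and the terms
`a_0 * t` and `b_0 * t` of the two one-vertex trees are added. -/
noncomputable def seriesT : MvPowerSeries Var ℚ :=
  ofCoeff (fun d => if d Var.y = 0 ∧ d Var.t = d Var.x + 1 then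
      MvPowerSeries.coeff (d + Finsupp.single Var.y (d Var.x)) (seriesA * seriesB) else 0) +
    MvPowerSeries.X (Var.a 0) * MvPowerSeries.X Var.t +
    MvPowerSeries.X (Var.b 0) * MvPowerSeries.X Var.t

/-- The operator `v_2 x ∂/∂v_0 + ∑_{k ≥ 1} k v_{k+2} x ∂/∂v_k`. For every monomial only finitely
many summands contribute to its coefficient (those with `v_{k+2}` in the monomial). -/
noncomputable def diffOp (v : ℕ → Var) (F : MvPowerSeries Var ℚ) : MvPowerSeries Var ℚ :=
  MvPowerSeries.X (v 2) * MvPowerSeries.X Var.x * MvPowerSeries.pderiv ℚ (v 0) F +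
    ofCoeff (fun d => ∑ᶠ k : ℕ+, MvPowerSeries.coeff d
      (((k : ℕ) : MvPowerSeries Var ℚ) * MvPowerSeries.X (v (k + 2)) * MvPowerSeries.X Var.x *
        MvPowerSeries.pderiv ℚ (v k) F))

/-- `D_a`. -/
noncomputable def opDa : MvPowerSeries Var ℚ → MvPowerSeries Var ℚ := diffOp Var.a

/-- `D_b`. -/
noncomputable def opDb : MvPowerSeries Var ℚ → MvPowerSeries Var ℚ := diffOp Var.b

/-!
Both sides of the first identity count plane bipartite trees with numbered vertices and edges. The
number of such trees in which the vertices have prescribed positive degrees depends only on the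
numbers of vertices and edges: removing a leaf gives a recursion for it, and the solution is the
product of factorials in the coefficients of `A * B`. Dividing by the number of numberings turns
numbered trees into isomorphism classes weighted by `1 / #Aut`.

The operator `D_a` marks a corner at a white vertex and adds two to the degree of that vertex. A
tree with a marked corner has no automorphism other than the identity, so `D_a T` counts such trees
without weights; exchanging the colours does the same for `D_b`.

In a `2^1`-map, collapse the face of perimeter two to a single edge. This leaves a tree, by Euler's
formula, and cutting that edge leaves a tree with a marked white corner and a tree with a marked
black corner, from which the map is recovered.
-/

/-! ### Cycles of permutations -/

section Cycles

variable {α β : Type*}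

theorem sameCycle_iff_forall {σ : Equiv.Perm α} {x y : α} :
    σ.SameCycle x y ↔ ∀ P : α → Prop, (∀ z, P (σ z) ↔ P z) → P x → P y := by
  constructor
  · rintro ⟨i, rfl⟩ P hP hx
    induction i using Int.induction_on with
    | zero => simpa using hx
    | succ n ih => rwa [add_comm, zpow_add, zpow_one, Equiv.Perm.mul_apply, hP]
    | pred n ih =>
      rw [← hP, ← Equiv.Perm.mul_apply, ← zpow_one_add]
      simpa using ih
  · exact fun h => h (σ.SameCycle x) (fun _ => Equiv.Perm.sameCycle_apply_right) (.refl _ _)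

theorem sameCycle_permCongr (h : α ≃ β) (σ : Equiv.Perm α) (x y : β) :
    (h.permCongr σ).SameCycle x y ↔ σ.SameCycle (h.symm x) (h.symm y) := by
  simp only [sameCycle_iff_forall, Equiv.permCongr_apply]
  constructor
  · exact fun H P hP => H (fun z => P (h.symm z)) (by simp [hP])
  · intro H P hP hx
    simpa using H (fun z => P (h z)) (fun z => by simpa using hP (h z)) (by simpa using hx)

theorem sameCycle_sumCongr_inl_inl (σ : Equiv.Perm α) (τ : Equiv.Perm β) (x y : α) :
    Equiv.Perm.SameCycle (Equiv.sumCongr σ τ : Equiv.Perm (α ⊕ β)) (.inl x) (.inl y) ↔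
      σ.SameCycle x y := by
  simp only [sameCycle_iff_forall]
  exact ⟨fun H P hP => H (Sum.elim P fun _ => False) (by rintro (z | z) <;> simp [hP]),
    fun H P hP => H (fun z => P (.inl z)) fun z => by simpa using hP (.inl z)⟩

theorem sameCycle_sumCongr_inr_inr (σ : Equiv.Perm α) (τ : Equiv.Perm β) (x y : β) :
    Equiv.Perm.SameCycle (Equiv.sumCongr σ τ : Equiv.Perm (α ⊕ β)) (.inr x) (.inr y) ↔
      τ.SameCycle x y := by
  simp only [sameCycle_iff_forall]
  exact ⟨fun H P hP => H (Sum.elim (fun _ => False) P) (by rintro (z | z) <;> simp [hP]),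
    fun H P hP => H (fun z => P (.inr z)) fun z => by simpa using hP (.inr z)⟩

theorem not_sameCycle_sumCongr_inl_inr (σ : Equiv.Perm α) (τ : Equiv.Perm β) (x : α) (y : β) :
    ¬ Equiv.Perm.SameCycle (Equiv.sumCongr σ τ : Equiv.Perm (α ⊕ β)) (.inl x) (.inr y) := by
  rw [sameCycle_iff_forall]
  intro H
  simpa using H (fun z => z.isLeft) (by rintro (z | z) <;> simp) (by simp)

open Classical in
/-- Insertion of `none` into the cycles of a permutation: just before `i` if `c = some i`, and as
a fixed point if `c = none`. -/
noncomputable def insertNone (c : Option α) (σ : Equiv.Perm α) : Equiv.Perm (Option α) :=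
  Equiv.Perm.decomposeOption.symm (c, σ)

variable {c c' : Option α} {σ σ' : Equiv.Perm α}

@[simp]
theorem insertNone_apply_none : insertNone c σ none = c := by
  simp [insertNone]

open Classical in
theorem insertNone_apply_some (a : α) :
    insertNone c σ (some a) = if some (σ a) = c then none else some (σ a) := by
  simp only [insertNone, Equiv.Perm.decomposeOption_symm_apply, Equiv.Perm.mul_apply,
    Equiv.optionCongr_apply, Option.map_some]
  split_ifs with h
  · rw [h, Equiv.swap_apply_right]
  · rw [Equiv.swap_apply_of_ne_of_ne (by simp) h]

theorem exists_eq_insertNone (ρ : Equiv.Perm (Option α)) :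
    ∃ (c : Option α) (σ : Equiv.Perm α), ρ = insertNone c σ := by
  classical
  obtain ⟨⟨c, σ⟩, rfl⟩ := Equiv.Perm.decomposeOption.symm.surjective ρ
  exact ⟨c, σ, by unfold insertNone; congr!⟩

theorem insertNone_inj : insertNone c σ = insertNone c' σ' ↔ c = c' ∧ σ = σ' := by
  simp only [insertNone, EmbeddingLike.apply_eq_iff_eq, Prod.mk.injEq]

theorem insertNone_invariant_iff {P : Option α → Prop} :
    (∀ z, P (insertNone c σ z) ↔ P z) ↔ (∀ a, P (some (σ a)) ↔ P (some a)) ∧ (P c ↔ P none) := by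
  rw [Option.forall, and_comm, insertNone_apply_none]
  refine and_congr_left fun h₀ => forall_congr' fun a => ?_
  rw [insertNone_apply_some]
  split_ifs with h
  · rw [← h₀, h]
  · rfl

theorem sameCycle_insertNone_some_some (x y : α) :
    (insertNone c σ).SameCycle (some x) (some y) ↔ σ.SameCycle x y := by
  simp only [sameCycle_iff_forall, insertNone_invariant_iff]
  exact ⟨fun H P hP => H (fun o => o.elim (c.elim False P) P) ⟨hP, by cases c <;> simp⟩,
    fun H P hP => H (fun z => P (some z)) hP.1⟩

theorem sameCycle_insertNone_none_some (y : α) :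
    (insertNone c σ).SameCycle none (some y) ↔ ∃ i, c = some i ∧ σ.SameCycle i y := by
  rw [← Equiv.Perm.sameCycle_apply_left, insertNone_apply_none]
  cases c with
  | none =>
    have h : ∀ z, insertNone none σ z = none ↔ z = none :=
      (insertNone_invariant_iff (P := (· = none))).2 (by simp)
    simpa using fun H => Option.some_ne_none y (sameCycle_iff_forall.1 H (· = none) h rfl)
  | some i => simp [sameCycle_insertNone_some_some]

theorem insertNone_semiconj_iff {h : α → β} (hh : Function.Injective h) {d : Option β}
    {τ : Equiv.Perm β} :
    (∀ x, (insertNone c σ x).map h = insertNone d τ (x.map h)) ↔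
      c.map h = d ∧ ∀ a, h (σ a) = τ (h a) := by
  classical
  rw [Option.forall, Option.map_none, insertNone_apply_none, insertNone_apply_none]
  refine and_congr_right fun hd => forall_congr' fun a => ?_
  simp only [Option.map_some, insertNone_apply_some, apply_ite (Option.map h),
    Option.map_none, ← hd]
  have hc : some (h (σ a)) = c.map h ↔ some (σ a) = c := by
    rw [← Option.map_some, (Option.map_injective hh).eq_iff]
  split_ifs with h₁ h₂ h₂
  · simpa using (hc.2 h₁).trans h₂.symm
  · exact iff_of_false (by simp) fun H => h₂ (H ▸ hc.2 h₁)
  · exact iff_of_false (by simp) fun H => h₁ (hc.1 (H ▸ h₂))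
  · simp

end Cycles

/-! ### Bipartite maps -/

attribute [ext] BMap BMap.Iso

namespace BMap

variable {W B E W' B' E' : Type} {m : BMap W B E} {m' : BMap W' B' E'}

/-- Connectedness of a map, as the triviality of the vertex properties that the ends of each edge
share. -/
def Conn (m : BMap W B E) : Prop :=
  Nonempty (W ⊕ B) ∧ ∀ P : W ⊕ B → Prop,
    (∀ e, P (.inl (m.atW e)) ↔ P (.inr (m.atB e))) → ∀ x y, P x → P y

theorem connected_graph_iff (m : BMap W B E) : m.graph.Connected ↔ m.Conn := by
  have hadj : ∀ e, m.graph.Adj (.inl (m.atW e)) (.inr (m.atB e)) := fun e => by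
    simp only [graph, SimpleGraph.fromRel_adj]
    exact ⟨by simp, Or.inl ⟨e, rfl, rfl⟩⟩
  constructor
  · intro h
    refine ⟨h.nonempty, fun P hP x y => ?_⟩
    obtain ⟨p⟩ := h.preconnected x y
    induction p with
    | nil => exact id
    | cons hab _ ih =>
      refine fun hx => ih ?_
      simp only [graph, SimpleGraph.fromRel_adj] at hab
      rcases hab with ⟨_, ⟨e, rfl, rfl⟩ | ⟨e, rfl, rfl⟩⟩
      · exact (hP e).1 hx
      · exact (hP e).2 hx
  · rintro ⟨_, h⟩
    refine .mk fun x y => h (m.graph.Reachable x) (fun e => ?_) x y (.refl _)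
    exact ⟨fun h => h.trans (hadj e).reachable, fun h => h.trans (hadj e).symm.reachable⟩

/-- A plane bipartite tree, described as a connected map with one vertex more than edges. -/
def IsTree (m : BMap W B E) : Prop := m.Conn ∧ Nat.card W + Nat.card B = Nat.card E + 1

/-- The map with the two colours interchanged, which transfers results from white to black
vertices. -/
def swap (m : BMap W B E) : BMap B W E where
  atW := m.atB
  atB := m.atW
  rotW := m.rotB
  rotB := m.rotW
  atW_eq_iff := m.atB_eq_iff
  atB_eq_iff := m.atW_eq_iff

theorem Conn.swap (h : m.Conn) : m.swap.Conn := by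
  refine ⟨(Equiv.sumComm W B).nonempty_congr.1 h.1, fun P hP x y => ?_⟩
  simpa using h.2 (fun z => P z.swap) (fun e => (hP e).symm) x.swap y.swap

theorem IsTree.swap (h : m.IsTree) : m.swap.IsTree :=
  ⟨h.1.swap, by rw [add_comm]; exact h.2⟩

/-- An isomorphism, regarded as an isomorphism of the maps with interchanged colours. -/
def Iso.swap (φ : Iso m m') : Iso m.swap m'.swap :=
  ⟨φ.onB, φ.onW, φ.onE, φ.map_atB, φ.map_atW, φ.map_rotB, φ.map_rotW⟩

/-- Transport of a map along bijections of vertices and edges. -/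
def relabel (m : BMap W B E) (f : W ≃ W') (g : B ≃ B') (h : E ≃ E') : BMap W' B' E' where
  atW e := f (m.atW (h.symm e))
  atB e := g (m.atB (h.symm e))
  rotW := h.permCongr m.rotW
  rotB := h.permCongr m.rotB
  atW_eq_iff e e' := by rw [f.apply_eq_iff_eq, m.atW_eq_iff, sameCycle_permCongr]
  atB_eq_iff e e' := by rw [g.apply_eq_iff_eq, m.atB_eq_iff, sameCycle_permCongr]

/-- The isomorphism from a map to its relabelling. -/
def relabelIso (m : BMap W B E) (f : W ≃ W') (g : B ≃ B') (h : E ≃ E') :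
    Iso m (m.relabel f g h) where
  onW := f
  onB := g
  onE := h
  map_atW e := by simp [relabel]
  map_atB e := by simp [relabel]
  map_rotW e := by simp [relabel, Equiv.permCongr_apply]
  map_rotB e := by simp [relabel, Equiv.permCongr_apply]

theorem Iso.eq_relabel (φ : Iso m m') : m' = m.relabel φ.onW φ.onB φ.onE := by
  ext e
  · simp [relabel, φ.map_atW]
  · simp [relabel, φ.map_atB]
  · simp [relabel, Equiv.permCongr_apply, φ.map_rotW]
  · simp [relabel, Equiv.permCongr_apply, φ.map_rotB]

/-- Relabelling as a bijection between the maps on given vertices and edges. -/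
def relabelEquiv (f : W ≃ W') (g : B ≃ B') (h : E ≃ E') : BMap W B E ≃ BMap W' B' E' where
  toFun m := m.relabel f g h
  invFun m := m.relabel f.symm g.symm h.symm
  left_inv m := by ext e <;> simp [relabel, Equiv.permCongr_apply]
  right_inv m := by ext e <;> simp [relabel, Equiv.permCongr_apply]

theorem Iso.conn (φ : Iso m m') (h : m.Conn) : m'.Conn := by
  let s := Equiv.sumCongr φ.onW φ.onB
  refine ⟨s.nonempty_congr.1 h.1, fun P hP x y => ?_⟩
  simpa using h.2 (fun z => P (s z))
    (fun e => by simpa [s, φ.map_atW, φ.map_atB] using hP (φ.onE e)) (s.symm x) (s.symm y)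

theorem Iso.isTree (φ : Iso m m') (h : m.IsTree) : m'.IsTree :=
  ⟨φ.conn h.1, by
    rw [← Nat.card_congr φ.onW, ← Nat.card_congr φ.onB, ← Nat.card_congr φ.onE, h.2]⟩

theorem Iso.degW_eq (φ : Iso m m') (w : W) : m'.degW (φ.onW w) = m.degW w :=
  (Nat.card_congr (φ.onE.subtypeEquiv fun e => by
    rw [← φ.map_atW, φ.onW.apply_eq_iff_eq])).symm

theorem Iso.degB_eq (φ : Iso m m') (b : B) : m'.degB (φ.onB b) = m.degB b :=
  φ.swap.degW_eq b

theorem Iso.map_facePerm (φ : Iso m m') (e : E) :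
    φ.onE (m.facePerm e) = m'.facePerm (φ.onE e) := by
  simp [facePerm, φ.map_rotW, φ.map_rotB]

theorem Iso.sameCycle_facePerm (φ : Iso m m') (e e' : E) :
    m'.facePerm.SameCycle (φ.onE e) (φ.onE e') ↔ m.facePerm.SameCycle e e' := by
  have h : m'.facePerm = φ.onE.permCongr m.facePerm := by
    ext e
    rw [Equiv.permCongr_apply, φ.map_facePerm, Equiv.apply_symm_apply]
  rw [h, sameCycle_permCongr, Equiv.symm_apply_apply, Equiv.symm_apply_apply]

theorem faceOf_eq_iff (m : BMap W B E) (e e' : E) :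
    m.faceOf e = m.faceOf e' ↔ m.facePerm.SameCycle e e' :=
  Quotient.eq

theorem faceOf_surjective (m : BMap W B E) : Function.Surjective m.faceOf :=
  Quotient.mk_surjective

theorem Conn.atW_surjective [Nonempty E] (h : m.Conn) : Function.Surjective m.atW := by
  obtain ⟨e₀⟩ := ‹Nonempty E›
  exact fun w => h.2 (Sum.elim (fun w => ∃ e, m.atW e = w) (fun b => ∃ e, m.atB e = b))
    (fun e => by simp) (.inl (m.atW e₀)) (.inl w) ⟨e₀, rfl⟩

theorem atW_rotW (m : BMap W B E) (e : E) : m.atW (m.rotW e) = m.atW e := by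
  rw [m.atW_eq_iff, Equiv.Perm.sameCycle_apply_left]

theorem atB_rotB (m : BMap W B E) (e : E) : m.atB (m.rotB e) = m.atB e :=
  m.swap.atW_rotW e

theorem Conn.edge_induction (h : m.Conn) {P : E → Prop} (hW : ∀ e, P (m.rotW e) ↔ P e)
    (hB : ∀ e, P (m.rotB e) ↔ P e) {e e' : E} (he : P e) : P e' := by
  have hPW : ∀ a b, m.atW a = m.atW b → P a → P b := fun a b hab =>
    sameCycle_iff_forall.1 ((m.atW_eq_iff a b).1 hab) P hW
  have hPB : ∀ a b, m.atB a = m.atB b → P a → P b := fun a b hab =>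
    sameCycle_iff_forall.1 ((m.atB_eq_iff a b).1 hab) P hB
  refine h.2 (Sum.elim (fun w => ∀ e, m.atW e = w → P e) (fun b => ∀ e, m.atB e = b → P e))
    (fun e => ?_) (.inl (m.atW e)) (.inl (m.atW e')) (fun a ha => hPW _ _ ha.symm he) _ rfl
  exact ⟨fun H a ha => hPB _ _ ha.symm (H e rfl), fun H a ha => hPW _ _ ha.symm (H e rfl)⟩

theorem sum_degW [Fintype W] [Finite E] (m : BMap W B E) : ∑ w, m.degW w = Nat.card E := by
  simp only [degW, ← Nat.card_sigma]
  exact Nat.card_congr (Equiv.sigmaFiberEquiv m.atW)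

/-! ### Trees have one face -/

/-- The coboundary map `ℚ^V → ℚ^E` of the underlying graph. -/
def coboundary (m : BMap W B E) : (W ⊕ B → ℚ) →ₗ[ℚ] (E → ℚ) where
  toFun g e := g (.inl (m.atW e)) - g (.inr (m.atB e))
  map_add' f g := by ext e; simp; ring
  map_smul' c g := by ext e; simp; ring

theorem Conn.finrank_ker_coboundary (h : m.Conn) :
    Module.finrank ℚ (LinearMap.ker m.coboundary) ≤ 1 := by
  refine finrank_le_one (⟨fun _ => 1, ?_⟩ : LinearMap.ker m.coboundary) ?_
  · rw [LinearMap.mem_ker]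
    ext e
    simp [coboundary]
  · rintro ⟨g, hg⟩
    obtain ⟨x⟩ := h.1
    refine ⟨g x, ?_⟩
    ext y
    simp only [SetLike.mk_smul_mk, Pi.smul_apply, smul_eq_mul, mul_one]
    refine (h.2 (fun z => g z = g x) (fun e => ?_) x y rfl).symm
    have hge : g (.inl (m.atW e)) = g (.inr (m.atB e)) := sub_eq_zero.1 (congrFun hg e)
    rw [hge]

theorem Conn.card_le_finrank_range_coboundary [Finite W] [Finite B] (h : m.Conn) :
    Nat.card W + Nat.card B ≤ Module.finrank ℚ (LinearMap.range m.coboundary) + 1 := by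
  have := Fintype.ofFinite W
  have := Fintype.ofFinite B
  have hrank := LinearMap.finrank_range_add_finrank_ker m.coboundary
  have hker := h.finrank_ker_coboundary
  rw [Module.finrank_fintype_fun_eq_card, ← Nat.card_eq_fintype_card, Nat.card_sum] at hrank
  omega

theorem Conn.card_le [Finite W] [Finite B] [Finite E] (h : m.Conn) :
    Nat.card W + Nat.card B ≤ Nat.card E + 1 := by
  have := Fintype.ofFinite E
  have hrange := Submodule.finrank_le (LinearMap.range m.coboundary)
  rw [Module.finrank_fintype_fun_eq_card, ← Nat.card_eq_fintype_card] at hrange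
  exact h.card_le_finrank_range_coboundary.trans (by omega)

theorem IsTree.coboundary_surjective [Finite W] [Finite B] [Finite E] (h : m.IsTree) :
    Function.Surjective m.coboundary := by
  have := Fintype.ofFinite E
  rw [← LinearMap.range_eq_top]
  refine Submodule.eq_top_of_finrank_eq (le_antisymm (Submodule.finrank_le _) ?_)
  have hle := h.1.card_le_finrank_range_coboundary
  rw [h.2] at hle
  rw [Module.finrank_fintype_fun_eq_card, ← Nat.card_eq_fintype_card]
  omega

theorem IsTree.eq_zero_of_sum_mul_eq_zero [Finite W] [Finite B] [Fintype E] (h : m.IsTree)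
    {D : E → ℚ} (hW : ∀ f : W → ℚ, ∑ e, f (m.atW e) * D e = 0)
    (hB : ∀ f : B → ℚ, ∑ e, f (m.atB e) * D e = 0) : D = 0 := by
  obtain ⟨g, hg⟩ := h.coboundary_surjective D
  have hsq : ∑ e, D e * D e = 0 := by
    have hD : ∀ e, D e * D e = g (.inl (m.atW e)) * D e - g (.inr (m.atB e)) * D e := fun e => by
      nth_rw 1 [← hg]
      exact sub_mul _ _ _
    simp only [hD, Finset.sum_sub_distrib]
    rw [hW fun w => g (.inl w), hB fun b => g (.inr b), sub_zero]
  rw [Finset.sum_eq_zero_iff_of_nonneg fun _ _ => mul_self_nonneg _] at hsq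
  exact funext fun e => mul_self_eq_zero.1 (hsq e (Finset.mem_univ e))

theorem IsTree.sameCycle_facePerm [Finite W] [Finite B] [Finite E] (h : m.IsTree) (e e' : E) :
    m.facePerm.SameCycle e e' := by
  classical
  have := Fintype.ofFinite E
  rw [sameCycle_iff_forall]
  intro P hP he
  let f : E → ℚ := fun e => if P e then 1 else 0
  have hPf : ∀ a b, f a = f b → (P a ↔ P b) := fun a b hab => by
    by_cases ha : P a <;> by_cases hb : P b <;> simp_all [f]
  have hf : ∀ e, f (m.rotW (m.rotB e)) = f e := fun e => if_congr (hP e) rfl rfl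
  have hf' : ∀ e, f (m.rotW e) = f (m.rotB.symm e) := fun e => by
    rw [← hf (m.rotB.symm e), Equiv.apply_symm_apply]
  have hsum : ∀ (g : E → ℚ) (σ : Equiv.Perm E), (∀ e, g (σ e) = g e) →
      ∑ e, g e * (f (σ e) - f e) = 0 := fun g σ hg => by
    simp only [mul_sub, Finset.sum_sub_distrib]
    rw [sub_eq_zero, ← Equiv.sum_comp σ fun e => g e * f e]
    simp only [hg]
  -- The change of `f` along a white rotation is also its change along an inverse black rotation,
  -- so it sums to zero around every vertex, of either colour.
  have hD : (fun e => f (m.rotW e) - f e) = 0 := by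
    refine h.eq_zero_of_sum_mul_eq_zero
      (fun g => hsum (fun e => g (m.atW e)) m.rotW fun e => by rw [m.atW_rotW]) fun g => ?_
    simp only [hf']
    refine hsum (fun e => g (m.atB e)) m.rotB.symm fun e => ?_
    rw [← m.atB_rotB, Equiv.apply_symm_apply]
  have hrotW : ∀ e, f (m.rotW e) = f e := fun e => sub_eq_zero.1 (congrFun hD e)
  exact h.1.edge_induction (fun e => hPf _ _ (hrotW e))
    (fun e => hPf _ _ (by rw [← hf e, hrotW])) he

theorem IsTree.numFaces_eq_one [Finite W] [Finite B] [Finite E] (h : m.IsTree) :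
    m.numFaces = 1 := by
  unfold numFaces
  split_ifs with hE
  · rfl
  · obtain ⟨e₀⟩ := not_isEmpty_iff.1 hE
    refine Nat.card_eq_one_iff_unique.2 ⟨⟨fun f f' => ?_⟩, ⟨m.faceOf e₀⟩⟩
    obtain ⟨e, rfl⟩ := m.faceOf_surjective f
    obtain ⟨e', rfl⟩ := m.faceOf_surjective f'
    exact (m.faceOf_eq_iff _ _).2 (h.sameCycle_facePerm e e')

theorem isPlane_and_numFaces_eq_one_iff [Finite W] [Finite B] [Finite E] :
    m.IsPlane ∧ m.numFaces = 1 ↔ m.IsTree := by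
  rw [IsPlane, connected_graph_iff, IsTree, and_assoc]
  refine and_congr_right fun hconn => ⟨fun h => by omega, fun hV => ?_⟩
  have hF := IsTree.numFaces_eq_one ⟨hconn, hV⟩
  omega

end BMap

/-! ### Inserting an edge -/

theorem card_sigma_of_card_eq {α : Type*} {β : α → Type*} [Finite α] [∀ a, Finite (β a)] {k : ℕ}
    (h : ∀ a, Nat.card (β a) = k) : Nat.card (Σ a, β a) = Nat.card α * k := by
  have := Fintype.ofFinite α
  rw [Nat.card_sigma, Finset.sum_const_nat fun a _ => h a, Finset.card_univ,
    Nat.card_eq_fintype_card]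

section IsCornerAt

variable {V E : Type*} {f : E → V} {u : V} {c : Option E}

/-- `c` is a corner at the vertex `u` of a map, described by the edge that follows it; `f` sends
each edge to its end, and an isolated vertex has the single corner `none`. -/
def IsCornerAt (f : E → V) (u : V) (c : Option E) : Prop :=
  (∀ i, c = some i → f i = u) ∧ (c = none → ∀ e, f e ≠ u)

theorem isCornerAt_some {i : E} : IsCornerAt f u (some i) ↔ f i = u := by
  simp [IsCornerAt]

theorem isCornerAt_none : IsCornerAt f u none ↔ ∀ e, f e ≠ u := by
  simp [IsCornerAt]

theorem IsCornerAt.elim_eq_elim_iff {σ : Equiv.Perm E} (hc : IsCornerAt f u c)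
    (hf : ∀ e e', f e = f e' ↔ σ.SameCycle e e') (x y : Option E) :
    x.elim u f = y.elim u f ↔ (insertNone c σ).SameCycle x y := by
  have key : ∀ e, u = f e ↔ (insertNone c σ).SameCycle none (some e) := fun e => by
    rw [sameCycle_insertNone_none_some]
    cases c with
    | none => simpa using (isCornerAt_none.1 hc e).symm
    | some i => simp [← hf, isCornerAt_some.1 hc]
  cases x <;> cases y
  · simp [Equiv.Perm.SameCycle.refl]
  · exact key _
  · rw [Equiv.Perm.sameCycle_comm, ← key, eq_comm]; rfl
  · simp [sameCycle_insertNone_some_some, hf]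

theorem isCornerAt_of_sameCycle_insertNone {f : Option E → V} {σ : Equiv.Perm E}
    (hf : ∀ e e', f e = f e' ↔ (insertNone c σ).SameCycle e e') :
    IsCornerAt (fun e => f (some e)) (f none) c := by
  have key : ∀ e, f (some e) = f none ↔ ∃ i, c = some i ∧ σ.SameCycle i e := fun e => by
    rw [eq_comm, hf, sameCycle_insertNone_none_some]
  exact ⟨fun i hi => (key i).2 ⟨i, hi, .refl _ _⟩, fun hc e he => by simpa [hc] using (key e).1 he⟩

theorem card_option_fiber [Finite E] (f : E → V) (u v : V) [Decidable (u = v)] :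
    Nat.card {o : Option E // o.elim u f = v} =
      Nat.card {e : E // f e = v} + if u = v then 1 else 0 := by
  classical
  have := Fintype.ofFinite E
  simp only [Nat.card_eq_fintype_card, Fintype.card_subtype, Finset.card_filter, Fintype.sum_option,
    Option.elim_none, Option.elim_some]
  rw [add_comm]
  congr

end IsCornerAt

namespace BMap

variable {W B E W' B' E' : Type}

section InsertEdge

variable {m m' : BMap W B E} {u u' : W} {v v' : B} {c c' d d' : Option E}

/-- Insert an edge between a white corner and a black corner. -/
noncomputable def insertEdge (m : BMap W B E) (hu : IsCornerAt m.atW u c)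
    (hv : IsCornerAt m.atB v d) : BMap W B (Option E) where
  atW o := o.elim u m.atW
  atB o := o.elim v m.atB
  rotW := insertNone c m.rotW
  rotB := insertNone d m.rotB
  atW_eq_iff := hu.elim_eq_elim_iff m.atW_eq_iff
  atB_eq_iff := hv.elim_eq_elim_iff m.atB_eq_iff

theorem exists_eq_insertEdge (m : BMap W B (Option E)) :
    ∃ (m₀ : BMap W B E) (u : W) (c : Option E) (v : B) (d : Option E)
      (hu : IsCornerAt m₀.atW u c) (hv : IsCornerAt m₀.atB v d), m = m₀.insertEdge hu hv := by
  obtain ⟨atW, atB, rotW, rotB, hW, hB⟩ := m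
  obtain ⟨c, σ, rfl⟩ := exists_eq_insertNone rotW
  obtain ⟨d, τ, rfl⟩ := exists_eq_insertNone rotB
  refine ⟨⟨fun e => atW (some e), fun e => atB (some e), σ, τ, fun e e' => ?_, fun e e' => ?_⟩,
    atW none, c, atB none, d, isCornerAt_of_sameCycle_insertNone hW,
    isCornerAt_of_sameCycle_insertNone hB, ?_⟩
  · rw [hW, sameCycle_insertNone_some_some]
  · rw [hB, sameCycle_insertNone_some_some]
  · ext e
    · cases e <;> rfl
    · cases e <;> rfl
    · rfl
    · rfl

theorem insertEdge_inj {hu : IsCornerAt m.atW u c} {hv : IsCornerAt m.atB v d}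
    {hu' : IsCornerAt m'.atW u' c'} {hv' : IsCornerAt m'.atB v' d'}
    (h : m.insertEdge hu hv = m'.insertEdge hu' hv') :
    m = m' ∧ u = u' ∧ v = v' ∧ c = c' ∧ d = d' := by
  have hatW : ∀ o : Option E, o.elim u m.atW = o.elim u' m'.atW := fun o =>
    congrArg (fun n => n.atW o) h
  have hatB : ∀ o : Option E, o.elim v m.atB = o.elim v' m'.atB := fun o =>
    congrArg (fun n => n.atB o) h
  obtain ⟨hc, hrotW⟩ := insertNone_inj.1 (congrArg BMap.rotW h)
  obtain ⟨hd, hrotB⟩ := insertNone_inj.1 (congrArg BMap.rotB h)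
  refine ⟨?_, hatW none, hatB none, hc, hd⟩
  ext e
  · exact hatW (some e)
  · exact hatB (some e)
  · rw [hrotW]
  · rw [hrotB]

theorem degW_insertEdge [Finite E] (hu : IsCornerAt m.atW u c) (hv : IsCornerAt m.atB v d) (w : W)
    [Decidable (u = w)] : (m.insertEdge hu hv).degW w = m.degW w + if u = w then 1 else 0 :=
  card_option_fiber _ _ _

theorem degB_insertEdge [Finite E] (hu : IsCornerAt m.atW u c) (hv : IsCornerAt m.atB v d) (b : B)
    [Decidable (v = b)] : (m.insertEdge hu hv).degB b = m.degB b + if v = b then 1 else 0 :=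
  card_option_fiber _ _ _

theorem conn_insertEdge_iff (hu : IsCornerAt m.atW u c) (hv : IsCornerAt m.atB v d) :
    (m.insertEdge hu hv).Conn ↔ ∀ P : W ⊕ B → Prop,
      (∀ e, P (.inl (m.atW e)) ↔ P (.inr (m.atB e))) → (P (.inl u) ↔ P (.inr v)) →
        ∀ x y, P x → P y := by
  constructor
  · exact fun h P hP huv => h.2 P (by rintro (_ | e); exacts [huv, hP e])
  · exact fun h => ⟨⟨.inl u⟩, fun P hP => h P (fun e => hP (some e)) (hP none)⟩

end InsertEdge

/-! ### Attaching a leaf -/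

/-- Add an isolated white vertex. -/
def addIsolated (m : BMap W B E) : BMap (Option W) B E where
  atW e := some (m.atW e)
  atB := m.atB
  rotW := m.rotW
  rotB := m.rotB
  atW_eq_iff e e' := by rw [Option.some_inj, m.atW_eq_iff]
  atB_eq_iff := m.atB_eq_iff

theorem addIsolated_injective : Function.Injective (addIsolated : BMap W B E → _) := by
  intro m m' h
  ext e
  · exact Option.some_injective _ (congrArg (fun n => n.atW e) h)
  · exact congrArg (fun n => n.atB e) h
  · exact congrArg (fun n => n.rotW e) h
  · exact congrArg (fun n => n.rotB e) h

theorem exists_eq_addIsolated {m : BMap (Option W) B E} (h : ∀ e, m.atW e ≠ none) :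
    ∃ m', m = addIsolated m' := by
  choose f hf using fun e => Option.ne_none_iff_exists'.1 (h e)
  refine ⟨⟨f, m.atB, m.rotW, m.rotB, fun e e' => ?_, m.atB_eq_iff⟩, ?_⟩
  · rw [← m.atW_eq_iff, hf, hf, Option.some_inj]
  · exact BMap.ext (funext hf) rfl rfl rfl

theorem degW_addIsolated_none (m : BMap W B E) : m.addIsolated.degW none = 0 := by
  simp [degW, addIsolated]

theorem degW_addIsolated_some (m : BMap W B E) (w : W) :
    m.addIsolated.degW (some w) = m.degW w := by
  simp [degW, addIsolated]

/-- Attach a white leaf before the edge `i` around its black end. -/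
noncomputable def attachLeaf (m : BMap W B E) (i : E) : BMap (Option W) B (Option E) :=
  m.addIsolated.insertEdge (u := none) (c := none) (v := m.atB i) (d := some i)
    (isCornerAt_none.2 fun _ => by simp [addIsolated]) (isCornerAt_some.2 rfl)

theorem conn_attachLeaf_iff {m : BMap W B E} {i : E} : (m.attachLeaf i).Conn ↔ m.Conn := by
  rw [attachLeaf, conn_insertEdge_iff]
  constructor
  · intro h
    refine ⟨⟨.inl (m.atW i)⟩, fun P hP x y => ?_⟩
    have hxy := h (Sum.elim (fun o => o.elim (P (.inr (m.atB i))) fun w => P (.inl w))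
      fun b => P (.inr b)) hP (by simp) (x.map some id) (y.map some id)
    rcases x with x | x <;> rcases y with y | y <;> simpa using hxy
  · rintro ⟨_, h⟩ P hP hleaf
    have hm := h (fun z => P (z.map some id)) hP
    have hx : ∀ x, P x → P (.inr (m.atB i)) := by
      rintro ((_ | x) | x) hx
      exacts [hleaf.1 hx, hm (.inl x) (.inr (m.atB i)) hx, hm (.inr x) (.inr (m.atB i)) hx]
    rintro x ((_ | y) | y) hPx
    exacts [hleaf.2 (hx x hPx), hm (.inr (m.atB i)) (.inl y) (hx x hPx),
      hm (.inr (m.atB i)) (.inr y) (hx x hPx)]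

theorem attachLeaf_inj {m m' : BMap W B E} {i i' : E} (h : m.attachLeaf i = m'.attachLeaf i') :
    m = m' ∧ i = i' := by
  obtain ⟨hm, _, _, _, hi⟩ := insertEdge_inj h
  exact ⟨addIsolated_injective hm, Option.some_injective _ hi⟩

theorem Conn.exists_eq_attachLeaf [Finite E] [Nonempty W] {m : BMap (Option W) B (Option E)}
    (hm : m.Conn) (hnone : m.atW none = none) (hdeg : m.degW none = 1) :
    ∃ (m' : BMap W B E) (i : E), m = m'.attachLeaf i := by
  classical
  obtain ⟨m₀, u, c, v, d, hu, hv, rfl⟩ := m.exists_eq_insertEdge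
  obtain rfl : u = none := hnone
  have hisolated : ∀ e, m₀.atW e ≠ none := fun e he => by
    have : Nonempty {e : E // m₀.atW e = none} := ⟨⟨e, he⟩⟩
    rw [degW_insertEdge, if_pos rfl, Nat.add_eq_right] at hdeg
    exact Nat.card_pos.ne' hdeg
  obtain ⟨m', rfl⟩ := exists_eq_addIsolated hisolated
  obtain rfl : c = none := Option.eq_none_iff_forall_ne_some.2 fun j hj =>
    hisolated j (hu.1 j hj)
  cases d with
  | none =>
    obtain ⟨w⟩ := ‹Nonempty W›
    have hw := (conn_insertEdge_iff _ _).1 hm (fun x => x = .inl none ∨ x = .inr v)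
      (fun e => by simp [addIsolated, show m'.atB e ≠ v from isCornerAt_none.1 hv e])
      (by simp) (.inl none) (.inl (some w)) (by simp)
    simp at hw
  | some i =>
    obtain rfl := isCornerAt_some.1 hv
    exact ⟨m', i, rfl⟩

/-! ### Counting trees with labelled vertices and edges by their degrees -/

/-- `m` is connected with the given degrees. -/
def HasDegrees (m : BMap W B E) (d : W → ℕ) (e : B → ℕ) : Prop :=
  m.Conn ∧ m.degW = d ∧ m.degB = e

theorem hasDegrees_relabel_iff (m : BMap W B E) (f : W ≃ W') (g : B ≃ B') (h : E ≃ E')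
    (d : W' → ℕ) (e : B' → ℕ) :
    (m.relabel f g h).HasDegrees d e ↔ m.HasDegrees (d ∘ f) (e ∘ g) := by
  refine and_congr ⟨(m.relabelIso f g h).symm.conn, (m.relabelIso f g h).conn⟩ (and_congr ?_ ?_)
  · rw [← f.surjective.injective_comp_right.eq_iff]
    exact Eq.congr_left (funext (m.relabelIso f g h).degW_eq)
  · rw [← g.surjective.injective_comp_right.eq_iff]
    exact Eq.congr_left (funext (m.relabelIso f g h).degB_eq)

theorem card_hasDegrees_comp (f : W ≃ W') (g : B ≃ B') (h : E ≃ E') (d : W' → ℕ) (e : B' → ℕ) :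
    Nat.card {m : BMap W B E // m.HasDegrees (d ∘ f) (e ∘ g)} =
      Nat.card {m : BMap W' B' E' // m.HasDegrees d e} :=
  Nat.card_congr ((relabelEquiv f g h).subtypeEquiv fun m =>
    (hasDegrees_relabel_iff m f g h d e).symm)

theorem card_hasDegrees_swap (d : W → ℕ) (e : B → ℕ) :
    Nat.card {m : BMap W B E // m.HasDegrees d e} =
      Nat.card {m : BMap B W E // m.HasDegrees e d} :=
  Nat.card_congr ⟨fun m => ⟨m.1.swap, m.2.1.swap, m.2.2.2, m.2.2.1⟩,
    fun m => ⟨m.1.swap, m.2.1.swap, m.2.2.2, m.2.2.1⟩, fun _ => rfl, fun _ => rfl⟩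

theorem hasDegrees_attachLeaf_iff [Finite E] [DecidableEq B] {m : BMap W B E} {i : E}
    {d : Option W → ℕ} {e : B → ℕ} (hd : d none = 1) (he : 0 < e (m.atB i)) :
    (m.attachLeaf i).HasDegrees d e ↔
      m.HasDegrees (d ∘ some) (Function.update e (m.atB i) (e (m.atB i) - 1)) := by
  classical
  refine and_congr conn_attachLeaf_iff (and_congr ?_ ?_)
  · simp only [funext_iff, Option.forall, attachLeaf, degW_insertEdge, degW_addIsolated_none,
      degW_addIsolated_some, hd, Function.comp_apply]
    simp
  · rw [Function.eq_update_iff, funext_iff, ← and_forall_ne (m.atB i)]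
    refine and_congr ?_ (forall₂_congr fun b hb => ?_)
    · rw [attachLeaf, degB_insertEdge, if_pos rfl]
      exact eq_comm.trans ((Nat.sub_eq_iff_eq_add he).symm.trans eq_comm)
    · rw [attachLeaf, degB_insertEdge, if_neg hb.symm]
      rfl

theorem card_hasDegrees_of_atW_none [Finite W] [Fintype B] [Finite E] [DecidableEq B] [Nonempty W]
    {d : Option W → ℕ} {e : B → ℕ} (hd : d none = 1) (he : ∀ b, 0 < e b) :
    Nat.card {m : BMap (Option W) B (Option E) // m.HasDegrees d e ∧ m.atW none = none} =
      ∑ b, Nat.card {m : BMap W B E //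
        m.HasDegrees (d ∘ some) (Function.update e b (e b - 1))} * (e b - 1) := by
  have hfiber : ∀ b (m : {m : BMap W B E //
      m.HasDegrees (d ∘ some) (Function.update e b (e b - 1))}),
      Nat.card {i // m.1.atB i = b} = e b - 1 := fun b m => by
    exact (congrFun m.2.2.2 b).trans (Function.update_self ..)
  have hattach : ∀ s : Σ b, Σ m : {m : BMap W B E //
      m.HasDegrees (d ∘ some) (Function.update e b (e b - 1))}, {i // m.1.atB i = b},
      (s.2.1.1.attachLeaf s.2.2.1).HasDegrees d e := by
    rintro ⟨b, ⟨m, hm⟩, i, hi⟩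
    obtain rfl : m.atB i = b := hi
    exact (hasDegrees_attachLeaf_iff hd (he _)).2 hm
  simp only [← card_sigma_of_card_eq (hfiber _)]
  rw [← Nat.card_sigma]
  refine (Nat.card_congr (Equiv.ofBijective
    (fun s => ⟨s.2.1.1.attachLeaf s.2.2.1, hattach s, rfl⟩) ⟨?_, ?_⟩)).symm
  · rintro ⟨b, ⟨m, hm⟩, i, hi⟩ ⟨b', ⟨m', hm'⟩, i', hi'⟩ h
    obtain ⟨rfl, rfl⟩ := attachLeaf_inj (congrArg Subtype.val h)
    obtain rfl : b = b' := hi.symm.trans hi'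
    rfl
  · rintro ⟨m, hm, hnone⟩
    obtain ⟨m', i, rfl⟩ := hm.1.exists_eq_attachLeaf hnone (by rw [hm.2.1, hd])
    exact ⟨⟨m'.atB i, ⟨m', (hasDegrees_attachLeaf_iff hd (he _)).1 hm⟩, i, rfl⟩, rfl⟩

theorem card_hasDegrees_eq_mul [Finite W] [Finite B] [Finite E]
    {d : Option W → ℕ} (e : B → ℕ) (hd : d none = 1) :
    Nat.card {m : BMap (Option W) B (Option E) // m.HasDegrees d e} = (Nat.card E + 1) *
      Nat.card {m : BMap (Option W) B (Option E) // m.HasDegrees d e ∧ m.atW none = none} := by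
  classical
  have hleaf : ∀ m : {m : BMap (Option W) B (Option E) // m.HasDegrees d e},
      Nat.card {i // m.1.atW i = none} = 1 := fun m => (congrFun m.2.2.1 none).trans hd
  have hrelabel : ∀ i : Option E,
      Nat.card {m : BMap (Option W) B (Option E) // m.HasDegrees d e ∧ m.atW i = none} =
        Nat.card {m : BMap (Option W) B (Option E) // m.HasDegrees d e ∧ m.atW none = none} := by
    refine fun i => Nat.card_congr ((relabelEquiv (.refl _) (.refl _)
      (Equiv.swap none i)).subtypeEquiv fun m => ?_)
    change _ ↔ (m.relabel _ _ _).HasDegrees d e ∧ _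
    rw [hasDegrees_relabel_iff]
    simp [relabelEquiv, relabel]
  rw [← Finite.card_option, ← card_sigma_of_card_eq hrelabel, ← mul_one (Nat.card _),
    ← card_sigma_of_card_eq hleaf]
  exact Nat.card_congr ⟨fun s => ⟨s.2.1, s.1.1, s.1.2, s.2.2⟩,
    fun s => ⟨⟨s.2.1, s.2.2.1⟩, s.1, s.2.2.2⟩, fun _ => rfl, fun _ => rfl⟩

theorem card_hasDegrees_unique [Unique W] [Unique B] [Unique E] :
    Nat.card {m : BMap W B E // m.HasDegrees (fun _ => 1) fun _ => 1} = 1 := by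
  rw [Nat.card_eq_one_iff_unique]
  refine ⟨⟨fun m m' => Subtype.ext (BMap.ext ?_ ?_ ?_ ?_)⟩, ⟨⟨⟨default, default, 1, 1,
    fun e e' => ?_, fun e e' => ?_⟩, ⟨inferInstance, fun P hP => ?_⟩, ?_, ?_⟩⟩⟩
  iterate 4 exact Subsingleton.elim _ _
  · simp [Subsingleton.elim e e', Equiv.Perm.SameCycle.refl]
  · simp [Subsingleton.elim e e', Equiv.Perm.SameCycle.refl]
  · have hedge := hP default
    simp only [Pi.default_apply] at hedge
    simp [Sum.forall, Unique.forall_iff, hedge]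
  · funext w
    simp [degW, Subsingleton.elim w default]
  · funext b
    simp [degB, Subsingleton.elim b default]

end BMap

/-- `d` and `e` are possible degrees of the white and the black vertices of a plane tree with
`n ≠ 0` edges. -/
structure IsTreeDegrees {W B : Type*} [Fintype W] [Fintype B] (n : ℕ) (d : W → ℕ) (e : B → ℕ) :
    Prop where
  pos_left : ∀ w, 0 < d w
  pos_right : ∀ b, 0 < e b
  sum_left : ∑ w, d w = n
  sum_right : ∑ b, e b = n
  card_add_card : Nat.card W + Nat.card B = n + 1

namespace IsTreeDegrees

variable {W B W' : Type*} [Fintype W] [Fintype B] [Fintype W'] {n : ℕ}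

theorem swap {d : W → ℕ} {e : B → ℕ} (h : IsTreeDegrees n d e) : IsTreeDegrees n e d :=
  ⟨h.pos_right, h.pos_left, h.sum_right, h.sum_left, by rw [add_comm, h.card_add_card]⟩

theorem comp_equiv {d : W → ℕ} {e : B → ℕ} (h : IsTreeDegrees n d e) (f : W' ≃ W) :
    IsTreeDegrees n (d ∘ f) e where
  pos_left w := h.pos_left (f w)
  pos_right := h.pos_right
  sum_left := (Equiv.sum_comp f d).trans h.sum_left
  sum_right := h.sum_right
  card_add_card := by rw [Nat.card_congr f, h.card_add_card]

theorem exists_eq_one {d : W → ℕ} {e : B → ℕ} (h : IsTreeDegrees n d e) :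
    (∃ w, d w = 1) ∨ ∃ b, e b = 1 := by
  by_contra! hne
  have hW : ∑ _w : W, 2 ≤ ∑ w, d w :=
    Finset.sum_le_sum fun w _ => Nat.lt_of_le_of_ne (h.pos_left w) (hne.1 w).symm
  have hB : ∑ _b : B, 2 ≤ ∑ b, e b :=
    Finset.sum_le_sum fun b _ => Nat.lt_of_le_of_ne (h.pos_right b) (hne.2 b).symm
  have hcard := h.card_add_card
  simp only [Finset.sum_const, Finset.card_univ, smul_eq_mul, ← Nat.card_eq_fintype_card] at hW hB
  rw [h.sum_left] at hW
  rw [h.sum_right] at hB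
  omega

theorem ne_zero {d : W → ℕ} {e : B → ℕ} (h : IsTreeDegrees n d e) : n ≠ 0 := by
  rintro rfl
  rcases h.exists_eq_one with ⟨w, _⟩ | ⟨b, _⟩
  · exact (h.pos_left w).ne' (Finset.sum_eq_zero_iff.1 h.sum_left w (Finset.mem_univ w))
  · exact (h.pos_right b).ne' (Finset.sum_eq_zero_iff.1 h.sum_right b (Finset.mem_univ b))

theorem sum_right_sub_one {d : W → ℕ} {e : B → ℕ} (h : IsTreeDegrees n d e) :
    ∑ b, (e b - 1) + 1 = Nat.card W := by
  have hsum : ∑ b, (e b - 1) + ∑ _b : B, 1 = ∑ b, e b := by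
    rw [← Finset.sum_add_distrib]
    exact Finset.sum_congr rfl fun b _ => Nat.sub_add_cancel (h.pos_right b)
  have hcard := h.card_add_card
  rw [h.sum_right, Finset.sum_const, Finset.card_univ, smul_eq_mul, mul_one,
    ← Nat.card_eq_fintype_card] at hsum
  omega

theorem removeLeaf [DecidableEq B] {d : Option W → ℕ} {e : B → ℕ} (h : IsTreeDegrees (n + 1) d e)
    (hd : d none = 1) {b : B} (hb : 1 < e b) :
    IsTreeDegrees n (d ∘ some) (Function.update e b (e b - 1)) where
  pos_left w := h.pos_left (some w)
  pos_right b' := by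
    rcases eq_or_ne b' b with rfl | hne
    · rw [Function.update_self]
      exact Nat.sub_pos_of_lt hb
    · rw [Function.update_of_ne hne]
      exact h.pos_right b'
  sum_left := by
    have hsum := h.sum_left
    rw [Fintype.sum_option, hd, add_comm] at hsum
    exact Nat.add_right_cancel hsum
  sum_right := by
    have hsum := h.sum_right
    rw [← Finset.add_sum_erase _ _ (Finset.mem_univ b)] at hsum
    rw [Finset.sum_update_of_mem (Finset.mem_univ b), Finset.sdiff_singleton_eq_erase]
    omega
  card_add_card := by
    have hcard := h.card_add_card
    rw [Finite.card_option] at hcard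
    omega

open BMap

theorem card_hasDegrees_option {W B E : Type} [Fintype W] [Fintype B] [Finite E] [Nonempty W]
    {d : Option W → ℕ} {e : B → ℕ} (h : IsTreeDegrees (n + 1) d e) (hd : d none = 1)
    (hE : Nat.card E = n)
    (ih : ∀ (d : W → ℕ) (e : B → ℕ), IsTreeDegrees n d e →
      Nat.card {m : BMap W B E // m.HasDegrees d e} =
        n.factorial * (Nat.card W - 1).factorial * (Nat.card B - 1).factorial) :
    Nat.card {m : BMap (Option W) B (Option E) // m.HasDegrees d e} =
      (n + 1).factorial * (Nat.card (Option W) - 1).factorial * (Nat.card B - 1).factorial := by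
  classical
  have hterm : ∀ b, Nat.card {m : BMap W B E //
      m.HasDegrees (d ∘ some) (Function.update e b (e b - 1))} * (e b - 1) =
        n.factorial * (Nat.card W - 1).factorial * (Nat.card B - 1).factorial * (e b - 1) := by
    intro b
    rcases Nat.eq_zero_or_pos (e b - 1) with hb | hb
    · simp [hb]
    · rw [ih _ _ (h.removeLeaf hd (Nat.lt_of_sub_pos hb))]
  have hsum := h.sum_right_sub_one
  rw [Finite.card_option, Nat.add_right_cancel_iff] at hsum
  rw [card_hasDegrees_eq_mul e hd, card_hasDegrees_of_atW_none hd h.pos_right,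
    Finset.sum_congr rfl fun b _ => hterm b, ← Finset.mul_sum, hsum, hE, Finite.card_option,
    Nat.add_sub_cancel, Nat.factorial_succ, ← Nat.mul_factorial_pred (Nat.card_pos (α := W)).ne']
  ring

theorem card_hasDegrees_of_exists_eq_one (hn : n ≠ 0)
    (ih : ∀ (W B E : Type) [Fintype W] [Fintype B] [Finite E] (d : W → ℕ) (e : B → ℕ),
      IsTreeDegrees n d e → Nat.card E = n → Nat.card {m : BMap W B E // m.HasDegrees d e} =
        n.factorial * (Nat.card W - 1).factorial * (Nat.card B - 1).factorial)
    {W B E : Type} [Fintype W] [Fintype B] {d : W → ℕ} {e : B → ℕ}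
    (h : IsTreeDegrees (n + 1) d e) (hE : Nat.card E = n + 1) (hd : ∃ w, d w = 1) :
    Nat.card {m : BMap W B E // m.HasDegrees d e} =
      (n + 1).factorial * (Nat.card W - 1).factorial * (Nat.card B - 1).factorial := by
  classical
  obtain ⟨w₀, hw₀⟩ := hd
  obtain ⟨⟨i₀⟩, _⟩ := Nat.card_pos_iff.1 (n.succ_pos.trans_eq hE.symm)
  let f : Option {w // w ≠ w₀} ≃ W := Equiv.optionSubtypeNe w₀
  let g : Option {i // i ≠ i₀} ≃ E := Equiv.optionSubtypeNe i₀
  have hf : (d ∘ f) none = 1 := hw₀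
  have hdf := h.comp_equiv f
  have : Nonempty {w // w ≠ w₀} := by
    by_contra hempty
    rw [not_nonempty_iff] at hempty
    have hsum := hdf.sum_left
    rw [Fintype.sum_option, hf, Fintype.sum_empty] at hsum
    omega
  have hcard : Nat.card {i // i ≠ i₀} = n := by
    rw [← Nat.card_congr g, Finite.card_option] at hE
    exact Nat.add_right_cancel hE
  rw [← card_hasDegrees_comp f (.refl B) g, ← Nat.card_congr f]
  exact hdf.card_hasDegrees_option hf hcard fun d e h => ih _ _ _ d e h hcard

theorem card_hasDegrees_one {W B E : Type} [Fintype W] [Fintype B] {d : W → ℕ} {e : B → ℕ}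
    (h : IsTreeDegrees 1 d e) (hE : Nat.card E = 1) :
    Nat.card {m : BMap W B E // m.HasDegrees d e} =
      Nat.factorial 1 * (Nat.card W - 1).factorial * (Nat.card B - 1).factorial := by
  have hone : ∀ {V : Type} [Fintype V] {d : V → ℕ}, ∑ v, d v = 1 → Nat.card V ≠ 0 := by
    intro V _ d hd hV
    have := Finite.card_eq_zero_iff.1 hV
    simp at hd
  have hcard := h.card_add_card
  have hW : Nat.card W = 1 := by have := hone h.sum_left; have := hone h.sum_right; omega
  have hB : Nat.card B = 1 := by omega
  have huniq : ∀ {V : Type}, Nat.card V = 1 → Nonempty (Unique V) := fun hV =>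
    (unique_iff_subsingleton_and_nonempty _).2 (Nat.card_eq_one_iff_unique.1 hV)
  obtain ⟨⟨_⟩, ⟨_⟩, ⟨_⟩⟩ := huniq hW, huniq hB, huniq hE
  have hd : d = fun _ => 1 := by
    funext w
    rw [← h.sum_left, Fintype.sum_subsingleton _ w]
  have he : e = fun _ => 1 := by
    funext b
    rw [← h.sum_right, Fintype.sum_subsingleton _ b]
  rw [hd, he, card_hasDegrees_unique, hW, hB]
  rfl

theorem card_hasDegrees {W B E : Type} [Fintype W] [Fintype B] [Finite E] {d : W → ℕ} {e : B → ℕ}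
    (h : IsTreeDegrees n d e) (hE : Nat.card E = n) :
    Nat.card {m : BMap W B E // m.HasDegrees d e} =
      n.factorial * (Nat.card W - 1).factorial * (Nat.card B - 1).factorial := by
  induction n generalizing W B E with
  | zero => exact absurd rfl h.ne_zero
  | succ n ih =>
    rcases eq_or_ne n 0 with rfl | hn
    · exact h.card_hasDegrees_one hE
    · have ih' : ∀ (W B E : Type) [Fintype W] [Fintype B] [Finite E] (d : W → ℕ) (e : B → ℕ),
          IsTreeDegrees n d e → Nat.card E = n → _ := fun W B E _ _ _ d e h hE => ih h hE
      rcases h.exists_eq_one with hd | he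
      · exact card_hasDegrees_of_exists_eq_one hn ih' h hE hd
      · rw [card_hasDegrees_swap, card_hasDegrees_of_exists_eq_one hn ih' h.swap hE he,
          mul_right_comm]

end IsTreeDegrees

/-! ### Formal sums of monomials -/

section Finsum

variable {α β M : Type*} [AddCommMonoid M]

theorem finsum_fiberwise [Finite α] (g : α → β) (f : α → M) :
    ∑ᶠ a, f a = ∑ᶠ b, ∑ᶠ a : {a // g a = b}, f a := by
  classical
  have := Fintype.ofFinite α
  have hfibre (b) : ∑ᶠ a : {a // g a = b}, f a = ∑ a with g a = b, f a := by
    rw [finsum_eq_sum_of_fintype]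
    exact (Finset.sum_subtype _ (by simp) _).symm
  simp only [hfibre]
  rw [finsum_eq_sum_of_fintype, finsum_eq_sum_of_support_subset (s := Finset.univ.image g)]
  · exact (Finset.sum_fiberwise_of_maps_to
      (fun a _ => Finset.mem_image_of_mem g (Finset.mem_univ a)) f).symm
  · intro b hb
    obtain ⟨a, ha, -⟩ := Finset.exists_ne_zero_of_sum_ne_zero hb
    simp only [Finset.coe_image, Finset.coe_univ, Set.image_univ, Set.mem_range]
    exact ⟨a, (Finset.mem_filter.1 ha).2⟩

theorem finsum_const [Finite α] (c : M) : ∑ᶠ _ : α, c = Nat.card α • c := by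
  have := Fintype.ofFinite α
  rw [finsum_eq_sum_of_fintype, Finset.sum_const, Finset.card_univ, Nat.card_eq_fintype_card]

theorem finsum_sigma {β : α → Type*} [Finite α] [∀ a, Finite (β a)] (f : (Σ a, β a) → M) :
    ∑ᶠ s, f s = ∑ᶠ a, ∑ᶠ b : β a, f ⟨a, b⟩ := by
  have := Fintype.ofFinite α
  have := fun a => Fintype.ofFinite (β a)
  simp only [finsum_eq_sum_of_fintype, Fintype.sum_sigma]

theorem finsum_mul_finsum_eq_finsum_prod {R : Type*} [NonUnitalNonAssocSemiring R] [Finite α]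
    [Finite β] (f : α → R) (g : β → R) :
    (∑ᶠ a, f a) * ∑ᶠ b, g b = ∑ᶠ p : α × β, f p.1 * g p.2 := by
  have := Fintype.ofFinite α
  have := Fintype.ofFinite β
  simp only [finsum_eq_sum_of_fintype, Finset.sum_mul_sum, ← Fintype.sum_prod_type']

theorem finsum_nat_eq_add_finsum_pnat (f : ℕ → M) (hf : (Function.support f).Finite) :
    ∑ᶠ k, f k = f 0 + ∑ᶠ k : ℕ+, f k := by
  rw [← finsum_mem_univ, ← Set.union_compl_self {0}, finsum_mem_union' disjoint_compl_right
    (hf.subset Set.inter_subset_right) (hf.subset Set.inter_subset_right), finsum_mem_singleton,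
    ← finsum_set_coe_eq_finsum_mem]
  congr 1
  exact (finsum_eq_of_bijective (fun k : ℕ+ => (⟨k, k.ne_zero⟩ : ({0}ᶜ : Set ℕ)))
    ⟨fun _ _ h => PNat.coe_injective (congrArg (fun z : ({0}ᶜ : Set ℕ) => z.1) h), fun b =>
      ⟨⟨b.1, Nat.pos_of_ne_zero b.2⟩, rfl⟩⟩ fun _ => rfl).symm

end Finsum

section FormalSums

open MvPowerSeries
open Finset.HasAntidiagonal (antidiagonal mem_antidiagonal)

theorem coeff_ofCoeff (f : (Var →₀ ℕ) → ℚ) (d : Var →₀ ℕ) : coeff d (ofCoeff f) = f d := rfl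

variable {ι κ : Type} {wt : ι → Var →₀ ℕ} {wt' : κ → Var →₀ ℕ}

theorem coeff_genSeries (wt : ι → Var →₀ ℕ) (c : ι → ℚ) (d : Var →₀ ℕ) :
    coeff d (genSeries wt c) = ∑ᶠ i : {i : ι // wt i = d}, c i := rfl

theorem genSeries_fiberwise (hfin : ∀ d, Finite {i // wt i = d}) (c : ι → ℚ) (g : ι → κ)
    (hg : ∀ i, wt' (g i) = wt i) {c' : κ → ℚ} (hc : ∀ k, c' k = ∑ᶠ i : {i // g i = k}, c i) :
    genSeries wt c = genSeries wt' c' := by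
  ext d
  have := hfin d
  rw [coeff_genSeries, coeff_genSeries, finsum_fiberwise (β := {k // wt' k = d})
    (fun i => ⟨g i.1, by rw [hg, i.2]⟩)]
  refine finsum_congr fun k => ?_
  rw [hc]
  exact finsum_eq_of_bijective
    (fun a : {a : {i // wt i = d} // (⟨g a.1, _⟩ : {k // wt' k = d}) = k} =>
      (⟨a.1.1, congrArg Subtype.val a.2⟩ : {i // g i = k}))
    ⟨fun a b h => Subtype.ext (Subtype.ext (congrArg (fun z => z.1) h)),
      fun b => ⟨⟨⟨b.1, by rw [← hg, b.2, k.2]⟩, Subtype.ext b.2⟩, rfl⟩⟩ fun _ => rfl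

theorem genSeries_equiv {c : ι → ℚ} {c' : κ → ℚ} (g : ι ≃ κ) (hg : ∀ i, wt' (g i) = wt i)
    (hc : ∀ i, c' (g i) = c i) : genSeries wt c = genSeries wt' c' := by
  ext d
  exact finsum_eq_of_bijective _ (g.subtypeEquiv fun i => by rw [hg]).bijective fun i => (hc i).symm

theorem genSeries_quotient [r : Setoid ι] (hfin : ∀ d, Finite {i // wt i = d}) {c : ι → ℚ}
    (hwt : ∀ i j, i ≈ j → wt i = wt j) (hc : ∀ i j, i ≈ j → c i = c j) :
    genSeries wt c = genSeries (fun τ : Quotient r => wt τ.out)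
      fun τ => Nat.card {i // τ.out ≈ i} * c τ.out := by
  refine genSeries_fiberwise hfin c (fun i => ⟦i⟧) (fun i => hwt _ _ (Quotient.mk_out i))
    fun τ => ?_
  have hclass (i) : ⟦i⟧ = τ ↔ τ.out ≈ i := by
    conv_lhs => rw [← τ.out_eq, eq_comm, Quotient.eq]
  have := hfin (wt τ.out)
  have : Finite {i // ⟦i⟧ = τ} := Finite.of_injective
    (fun i => (⟨i.1, (hwt _ _ ((hclass _).1 i.2)).symm⟩ : {i // wt i = wt τ.out}))
    fun i j h => Subtype.ext (congrArg (fun z : {i // wt i = wt τ.out} => z.1) h)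
  rw [finsum_congr fun i : {i // ⟦i⟧ = τ} => (hc _ _ ((hclass _).1 i.2)).symm, finsum_const,
    nsmul_eq_mul, Nat.card_congr (Equiv.subtypeEquivRight hclass)]

theorem finite_add_weight (h : ∀ d, Finite {i // wt i = d}) (h' : ∀ d, Finite {k // wt' k = d})
    (d : Var →₀ ℕ) : Finite {p : ι × κ // wt p.1 + wt' p.2 = d} := by
  classical
  have hsub : {p : ι × κ | wt p.1 + wt' p.2 = d} ⊆ ⋃ q ∈ antidiagonal d,
      {i | wt i = q.1} ×ˢ {k | wt' k = q.2} := by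
    intro p hp
    simp only [Set.mem_iUnion]
    exact ⟨(wt p.1, wt' p.2), mem_antidiagonal.2 hp, rfl, rfl⟩
  refine (Set.Finite.subset (Set.Finite.biUnion (Finset.finite_toSet _) fun q _ => ?_)
    hsub).to_subtype
  exact Set.Finite.prod (Set.finite_coe_iff.1 (h q.1)) (Set.finite_coe_iff.1 (h' q.2))

theorem genSeries_mul (h : ∀ d, Finite {i // wt i = d}) (h' : ∀ d, Finite {k // wt' k = d})
    (c : ι → ℚ) (c' : κ → ℚ) : genSeries wt c * genSeries wt' c' =
      genSeries (fun p : ι × κ => wt p.1 + wt' p.2) fun p => c p.1 * c' p.2 := by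
  classical
  ext d
  have := finite_add_weight h h' d
  rw [coeff_mul, coeff_genSeries,
    finsum_fiberwise (fun p : {p : ι × κ // wt p.1 + wt' p.2 = d} => (wt p.1.1, wt' p.1.2)),
    finsum_eq_sum_of_support_subset (s := antidiagonal d)]
  · refine Finset.sum_congr rfl fun q hq => ?_
    have := h q.1
    have := h' q.2
    rw [coeff_genSeries, coeff_genSeries, finsum_mul_finsum_eq_finsum_prod]
    refine finsum_eq_of_bijective (fun p => ⟨⟨(p.1.1, p.2.1), ?_⟩, ?_⟩) ⟨?_, ?_⟩ fun _ => rfl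
    · rw [p.1.2, p.2.2]; exact mem_antidiagonal.1 hq
    · dsimp only; rw [p.1.2, p.2.2]
    · rintro ⟨⟨a, _⟩, ⟨b, _⟩⟩ ⟨⟨a', _⟩, ⟨b', _⟩⟩ hab
      simpa using hab
    · rintro ⟨⟨⟨a, b⟩, hd⟩, rfl⟩
      exact ⟨(⟨a, rfl⟩, ⟨b, rfl⟩), rfl⟩
  · intro q hq
    by_contra hqd
    have : IsEmpty {p : {p : ι × κ // wt p.1 + wt' p.2 = d} // (wt p.1.1, wt' p.1.2) = q} :=
      ⟨fun p => hqd (by rw [Finset.mem_coe, mem_antidiagonal, ← p.2]; exact p.1.2)⟩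
    exact hq (finsum_of_isEmpty _)

end FormalSums

section Rooting

open MvPowerSeries

/-- The number of corners of a vertex of degree `k`; an isolated vertex has one corner. -/
def cornerCount (k : ℕ) : ℕ := if k = 0 then 1 else k

theorem cornerCount_coe (k : ℕ+) : cornerCount k = k := if_neg k.ne_zero

/-- The monomial `v_{k+2} x` by which `diffOp v` replaces `v_k`. -/
noncomputable def cornerShift (v : ℕ → Var) (k : ℕ) : Var →₀ ℕ :=
  Finsupp.single (v (k + 2)) 1 + Finsupp.single Var.x 1

variable {v : ℕ → Var}

theorem finite_setOf_apply_ne_zero (hv : Function.Injective v) (d : Var →₀ ℕ) :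
    {k | d (v (k + 2)) ≠ 0}.Finite := by
  have hpre : {k | d (v (k + 2)) ≠ 0} = (fun k => v (k + 2)) ⁻¹' (d.support : Set Var) := by
    ext k; simp
  rw [hpre]
  exact (Finset.finite_toSet _).preimage fun a _ b _ h => by simpa using hv h

theorem apply_ne_zero_of_cornerShift_le {d : Var →₀ ℕ} {k : ℕ} (h : cornerShift v k ≤ d) :
    d (v (k + 2)) ≠ 0 := by
  have hk := h (v (k + 2))
  simp only [cornerShift, Finsupp.add_apply, Finsupp.single_eq_same] at hk
  omega

theorem coeff_X_mul_X_mul_pderiv (v : ℕ → Var) (F : MvPowerSeries Var ℚ) (d : Var →₀ ℕ) (k : ℕ) :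
    coeff d (X (v (k + 2)) * X Var.x * pderiv ℚ (v k) F) = if cornerShift v k ≤ d then
      coeff (d - cornerShift v k + Finsupp.single (v k) 1) F *
        ((d - cornerShift v k) (v k) + 1) else 0 := by
  rw [X_def, X_def, monomial_mul_monomial, one_mul, coeff_monomial_mul]
  simp only [coeff_pderiv, one_mul]
  rfl

theorem coeff_diffOp (hv : Function.Injective v) (F : MvPowerSeries Var ℚ) (d : Var →₀ ℕ) :
    coeff d (diffOp v F) = ∑ᶠ k, if cornerShift v k ≤ d then (cornerCount k : ℚ) *
      (coeff (d - cornerShift v k + Finsupp.single (v k) 1) F *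
        ((d - cornerShift v k) (v k) + 1)) else 0 := by
  have hcoeff (k : ℕ+) : coeff d (((k : ℕ) : MvPowerSeries Var ℚ) * X (v (k + 2)) * X Var.x *
      pderiv ℚ (v k) F) =
      (cornerCount k : ℚ) * coeff d (X (v (k + 2)) * X Var.x * pderiv ℚ (v k) F) := by
    rw [cornerCount_coe, mul_assoc, mul_assoc, ← mul_assoc (X _), ← nsmul_eq_mul,
      map_nsmul, nsmul_eq_mul]
  rw [finsum_nat_eq_add_finsum_pnat, diffOp, map_add, coeff_ofCoeff]
  · congr 1
    · rw [show X (v 2) = X (R := ℚ) (v (0 + 2)) from rfl, coeff_X_mul_X_mul_pderiv]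
      simp [cornerCount]
    · refine finsum_congr fun k => ?_
      rw [hcoeff, coeff_X_mul_X_mul_pderiv, mul_ite, mul_zero]
  · refine (finite_setOf_apply_ne_zero hv d).subset fun k hk => apply_ne_zero_of_cornerShift_le ?_
    by_contra hle
    exact hk (if_neg hle)

variable {ι : Type} {K : ι → Type} [∀ i, Finite (K i)] {wt : ι → Var →₀ ℕ}
  {deg : ∀ i, K i → ℕ} {wt' : (Σ i, K i) → Var →₀ ℕ}

theorem finite_rooted_weight (hfin : ∀ d, Finite {i // wt i = d}) (hv : Function.Injective v)
    (hwt : ∀ s, wt' s + Finsupp.single (v (deg s.1 s.2)) 1 = wt s.1 + cornerShift v (deg s.1 s.2))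
    (d : Var →₀ ℕ) : Finite {s // wt' s = d} := by
  have hsub : {s | wt' s = d} ⊆ ⋃ k ∈ {k | d (v (k + 2)) ≠ 0},
      ⋃ i ∈ {i | wt i = d + Finsupp.single (v k) 1 - cornerShift v k},
        Set.range (Sigma.mk i : K i → Σ i, K i) := by
    rintro ⟨i, κ⟩ (rfl : wt' ⟨i, κ⟩ = d)
    simp only [Set.mem_iUnion]
    have h := hwt ⟨i, κ⟩
    refine ⟨deg i κ, ?_, i, eq_tsub_of_add_eq h.symm, κ, rfl⟩
    have hdeg := DFunLike.congr_fun h (v (deg i κ + 2))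
    simp only [Finsupp.add_apply, cornerShift, Finsupp.single_eq_same] at hdeg
    rw [Finsupp.single_eq_of_ne (fun h => by simpa using hv h)] at hdeg
    exact (by omega : wt' ⟨i, κ⟩ (v (deg i κ + 2)) ≠ 0)
  exact (((finite_setOf_apply_ne_zero hv d).biUnion fun k _ =>
    Set.Finite.biUnion (Set.finite_coe_iff.1 (hfin _)) fun i _ => Set.finite_range _).subset
      hsub).to_subtype

theorem finsum_rooted (hfin : ∀ d, Finite {i // wt i = d})
    (hwt : ∀ s, wt' s + Finsupp.single (v (deg s.1 s.2)) 1 = wt s.1 + cornerShift v (deg s.1 s.2))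
    (hK : ∀ i k, Nat.card {κ : K i // deg i κ = k} = cornerCount k * wt i (v k)) (c : ι → ℚ)
    {k : ℕ} {d d₁ : Var →₀ ℕ} (hd : d + Finsupp.single (v k) 1 = d₁ + cornerShift v k) :
    ∑ᶠ s : {s : {s // wt' s = d} // deg s.1.1 s.1.2 = k}, c s.1.1.1 =
      cornerCount k * d₁ (v k) * coeff d₁ (genSeries wt c) := by
  have := hfin d₁
  have hiff : ∀ s, deg s.1 s.2 = k → (wt' s = d ↔ wt s.1 = d₁) := by
    rintro s rfl
    rw [← add_left_inj (Finsupp.single (v (deg s.1 s.2)) 1), hwt, hd, add_left_inj]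
  have hbij : ∑ᶠ s : {s : {s // wt' s = d} // deg s.1.1 s.1.2 = k}, c s.1.1.1 =
      ∑ᶠ s : Σ i : {i // wt i = d₁}, {κ : K i // deg i κ = k}, c s.1 := by
    refine finsum_eq_of_bijective
      (fun s => ⟨⟨s.1.1.1, (hiff _ s.2).1 s.1.2⟩, ⟨s.1.1.2, s.2⟩⟩) ⟨?_, ?_⟩ fun _ => rfl
    · rintro ⟨⟨⟨i, κ⟩, _⟩, _⟩ ⟨⟨⟨i', κ'⟩, _⟩, _⟩ h
      simp only [Sigma.mk.injEq, Subtype.mk.injEq] at h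
      obtain ⟨rfl, h⟩ := h
      obtain rfl := congrArg Subtype.val (eq_of_heq h)
      rfl
    · rintro ⟨⟨i, hi⟩, ⟨κ, hκ⟩⟩
      exact ⟨⟨⟨⟨i, κ⟩, (hiff ⟨i, κ⟩ hκ).2 hi⟩, hκ⟩, rfl⟩
  rw [hbij, finsum_sigma, coeff_genSeries, mul_finsum]
  refine finsum_congr fun i => ?_
  dsimp only
  rw [finsum_const, hK, i.2, nsmul_eq_mul, Nat.cast_mul]

/-- The elements of `K i` are the corners of `i` (at the vertices counted by `v`); marking one at a
vertex of degree `k` adds an edge and two to the degree of this vertex. -/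
theorem diffOp_genSeries (hfin : ∀ d, Finite {i // wt i = d}) (hv : Function.Injective v)
    (hwt : ∀ s, wt' s + Finsupp.single (v (deg s.1 s.2)) 1 = wt s.1 + cornerShift v (deg s.1 s.2))
    (hK : ∀ i k, Nat.card {κ : K i // deg i κ = k} = cornerCount k * wt i (v k)) (c : ι → ℚ) :
    diffOp v (genSeries wt c) = genSeries wt' fun s => c s.1 := by
  ext d
  have := finite_rooted_weight hfin hv hwt d
  rw [coeff_diffOp hv, coeff_genSeries,
    finsum_fiberwise fun s : {s // wt' s = d} => deg s.1.1 s.1.2]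
  refine finsum_congr fun k => ?_
  split_ifs with hk
  · rw [finsum_rooted hfin hwt hK c (d₁ := d - cornerShift v k + Finsupp.single (v k) 1)
      (by rw [add_right_comm, tsub_add_cancel_of_le hk]), mul_assoc, mul_comm (coeff _ _)]
    simp
  · have : IsEmpty {s : {s // wt' s = d} // deg s.1.1 s.1.2 = k} := ⟨by
      rintro ⟨⟨⟨i, κ⟩, rfl⟩, rfl⟩
      have : Nonempty {κ' : K i // deg i κ' = deg i κ} := ⟨⟨κ, rfl⟩⟩
      have hpos := Nat.card_pos (α := {κ' : K i // deg i κ' = deg i κ})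
      rw [hK] at hpos
      have hle : Finsupp.single (v (deg i κ)) 1 ≤ wt i :=
        Finsupp.single_le_iff.2 (Nat.pos_of_mul_pos_left hpos)
      have h := hwt ⟨i, κ⟩
      rw [← tsub_add_cancel_of_le hle, add_right_comm, add_left_inj] at h
      exact hk (le_add_self.trans_eq h.symm)⟩
    rw [finsum_of_isEmpty]

end Rooting

/-! ### Isomorphism classes and labelled trees -/

namespace BMap

variable {W B E W' B' E' : Type} {m : BMap W B E} {m' : BMap W' B' E'}

/-- The monomial of a map, with arbitrary variables for the degrees of the two colours, so that
the colours can be interchanged. -/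
noncomputable def colWeight (v₁ v₂ : ℕ → Var) [Fintype W] [Fintype B] (m : BMap W B E) :
    Var →₀ ℕ :=
  ∑ w, Finsupp.single (v₁ (m.degW w)) 1 + ∑ b, Finsupp.single (v₂ (m.degB b)) 1 +
    Finsupp.single Var.t (Nat.card W + Nat.card B) + Finsupp.single Var.x (Nat.card E)

theorem weight_eq_colWeight {p q n : ℕ} (m : BMap (Fin p) (Fin q) (Fin n)) :
    m.weight = m.colWeight Var.a Var.b := by
  simp [weight, colWeight]

theorem colWeight_swap (v₁ v₂ : ℕ → Var) [Fintype W] [Fintype B] (m : BMap W B E) :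
    m.swap.colWeight v₁ v₂ = m.colWeight v₂ v₁ := by
  rw [colWeight, colWeight, add_comm (∑ w, _), add_comm (Nat.card B)]
  rfl

theorem Iso.colWeight_eq (v₁ v₂ : ℕ → Var) [Fintype W] [Fintype B] [Fintype W'] [Fintype B']
    (φ : Iso m m') : m'.colWeight v₁ v₂ = m.colWeight v₁ v₂ := by
  unfold colWeight
  rw [← Equiv.sum_comp φ.onW, ← Equiv.sum_comp φ.onB, Nat.card_congr φ.onW, Nat.card_congr φ.onB,
    Nat.card_congr φ.onE]
  simp only [φ.degW_eq, φ.degB_eq]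

/-- The corners at the white vertices. -/
def Corner (m : BMap W B E) : Type := {p : W × Option E // IsCornerAt m.atW p.1 p.2}

instance [Finite W] [Finite E] (m : BMap W B E) : Finite m.Corner :=
  inferInstanceAs (Finite {p : W × Option E // IsCornerAt m.atW p.1 p.2})

theorem card_isCornerAt_atW [Finite E] (m : BMap W B E) (w : W) :
    Nat.card {c // IsCornerAt m.atW w c} = cornerCount (m.degW w) := by
  unfold cornerCount
  split_ifs with h
  · have hiso : ∀ e, m.atW e ≠ w := fun e he =>
      (Finite.card_eq_zero_iff.1 h).elim (⟨e, he⟩ : {e // m.atW e = w})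
    refine Nat.card_eq_one_iff_unique.2 ⟨⟨?_⟩, ⟨⟨none, isCornerAt_none.2 hiso⟩⟩⟩
    have hnone : ∀ c : {c // IsCornerAt m.atW w c}, c.1 = none
      | ⟨none, _⟩ => rfl
      | ⟨some i, hi⟩ => absurd (isCornerAt_some.1 hi) (hiso i)
    exact fun c c' => Subtype.ext ((hnone c).trans (hnone c').symm)
  · obtain ⟨e, he⟩ := (Nat.card_pos_iff.1 (Nat.pos_of_ne_zero h)).1
    refine (Nat.card_congr (Equiv.ofBijective
      (fun e : {e // m.atW e = w} => ⟨some e.1, isCornerAt_some.2 e.2⟩) ⟨?_, ?_⟩)).symm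
    · exact fun e e' h => Subtype.ext (Option.some_injective _ (congrArg Subtype.val h))
    · rintro ⟨_ | i, hi⟩
      · exact absurd he (isCornerAt_none.1 hi e)
      · exact ⟨⟨i, isCornerAt_some.1 hi⟩, rfl⟩

theorem card_corner_degW [Finite W] [Finite E] (m : BMap W B E) (k : ℕ) :
    Nat.card {κ : m.Corner // m.degW κ.1.1 = k} =
      cornerCount k * Nat.card {w // m.degW w = k} := by
  rw [mul_comm, ← card_sigma_of_card_eq (β := fun w : {w // m.degW w = k} =>
    {c // IsCornerAt m.atW w.1 c})]
  · exact Nat.card_congr ⟨fun κ => ⟨⟨κ.1.1.1, κ.2⟩, κ.1.1.2, κ.1.2⟩,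
      fun s => ⟨⟨(s.1.1, s.2.1), s.2.2⟩, s.1.2⟩, fun _ => rfl, fun _ => rfl⟩
  · rintro ⟨w, rfl⟩
    exact m.card_isCornerAt_atW w

theorem Iso.isCornerAt_atW (φ : Iso m m') {u : W} {c : Option E} (h : IsCornerAt m.atW u c) :
    IsCornerAt m'.atW (φ.onW u) (c.map φ.onE) := by
  cases c with
  | none =>
    refine isCornerAt_none.2 fun e he => isCornerAt_none.1 h (φ.onE.symm e) ?_
    rw [← φ.onW.apply_eq_iff_eq, φ.map_atW, Equiv.apply_symm_apply, he]
  | some i => exact isCornerAt_some.2 (by rw [← φ.map_atW, isCornerAt_some.1 h])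

theorem Conn.iso_eq_of_onE_eq [Nonempty E] (h : m.Conn) {φ ψ : Iso m m'}
    (hE : ∀ e, φ.onE e = ψ.onE e) : φ = ψ := by
  ext x
  · obtain ⟨e, rfl⟩ := h.atW_surjective x
    rw [φ.map_atW, ψ.map_atW, hE]
  · obtain ⟨e, rfl⟩ := h.swap.atW_surjective x
    exact (φ.map_atB e).trans ((congrArg _ (hE e)).trans (ψ.map_atB e).symm)
  · exact hE x

theorem Conn.iso_eq_of_corner (h : m.Conn) {φ ψ : Iso m m'} (κ : m.Corner)
    (hu : φ.onW κ.1.1 = ψ.onW κ.1.1) (hc : κ.1.2.map φ.onE = κ.1.2.map ψ.onE) : φ = ψ := by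
  obtain ⟨⟨u, c⟩, hκ⟩ := κ
  cases c with
  | none =>
    have huniq : ∀ x : W ⊕ B, x = .inl u := fun x =>
      h.2 (fun x => x = .inl u)
        (fun e => by simp [show m.atW e ≠ u from isCornerAt_none.1 hκ e]) (.inl u) x rfl
    have : IsEmpty B := ⟨fun b => by simpa using huniq (.inr b)⟩
    ext x
    · obtain rfl : x = u := by simpa using huniq (.inl x)
      exact hu
    · exact isEmptyElim x
    · exact isEmptyElim (m.atB x)
  | some i =>
    have : Nonempty E := ⟨i⟩
    exact h.iso_eq_of_onE_eq fun e => h.edge_induction (P := fun e => φ.onE e = ψ.onE e)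
      (fun e => by rw [φ.map_rotW, ψ.map_rotW, Equiv.apply_eq_iff_eq])
      (fun e => by rw [φ.map_rotB, ψ.map_rotB, Equiv.apply_eq_iff_eq]) (by simpa using hc)

end BMap

namespace PlaneTree

theorem isTree (S : PlaneTree) : S.map.IsTree :=
  BMap.isPlane_and_numFaces_eq_one_iff.1 ⟨S.isPlane, S.oneFace⟩

/-- The plane tree given by a labelled tree. -/
def ofIsTree {p q n : ℕ} (m : BMap (Fin p) (Fin q) (Fin n)) (h : m.IsTree) : PlaneTree :=
  ⟨p, q, n, m, (BMap.isPlane_and_numFaces_eq_one_iff.2 h).1,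
    (BMap.isPlane_and_numFaces_eq_one_iff.2 h).2⟩

/-- The number of triples of permutations of the labels of the white vertices, the black vertices
and the edges of a plane tree. -/
def labellings (S : PlaneTree) : ℕ := S.nW.factorial * S.nB.factorial * S.nE.factorial

/-- The plane tree with permuted labels. -/
def relabel (S : PlaneTree) (f : Equiv.Perm (Fin S.nW)) (g : Equiv.Perm (Fin S.nB))
    (h : Equiv.Perm (Fin S.nE)) : PlaneTree :=
  ofIsTree (S.map.relabel f g h) ((S.map.relabelIso f g h).isTree S.isTree)

theorem relabel_bijective (S : PlaneTree) : Function.Bijective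
    fun s : Equiv.Perm (Fin S.nW) × Equiv.Perm (Fin S.nB) × Equiv.Perm (Fin S.nE) =>
      (⟨S.relabel s.1 s.2.1 s.2.2, S.map.relabelIso s.1 s.2.1 s.2.2⟩ :
        Σ T : PlaneTree, S.map.Iso T.map) := by
  constructor
  · rintro ⟨f, g, h⟩ ⟨f', g', h'⟩ heq
    have hW := congrArg (fun (z : Σ T : PlaneTree, S.map.Iso T.map) i => (z.2.onW i : ℕ)) heq
    have hB := congrArg (fun (z : Σ T : PlaneTree, S.map.Iso T.map) i => (z.2.onB i : ℕ)) heq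
    have hE := congrArg (fun (z : Σ T : PlaneTree, S.map.Iso T.map) i => (z.2.onE i : ℕ)) heq
    obtain rfl : f = f' := Equiv.ext fun i => Fin.ext (congrFun hW i)
    obtain rfl : g = g' := Equiv.ext fun i => Fin.ext (congrFun hB i)
    obtain rfl : h = h' := Equiv.ext fun i => Fin.ext (congrFun hE i)
    rfl
  · obtain ⟨p, q, n, m, hm, hf⟩ := S
    rintro ⟨⟨p', q', n', m', hm', hf'⟩, φ⟩
    dsimp only at φ
    obtain rfl : p = p' := Fin.equiv_iff_eq.1 ⟨φ.onW⟩
    obtain rfl : q = q' := Fin.equiv_iff_eq.1 ⟨φ.onB⟩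
    obtain rfl : n = n' := Fin.equiv_iff_eq.1 ⟨φ.onE⟩
    have heq := φ.eq_relabel
    obtain ⟨f, g, h, _, _, _, _⟩ := φ
    dsimp only at heq
    subst heq
    exact ⟨(f, g, h), rfl⟩

theorem card_iso (S : PlaneTree) : Nat.card (Σ T : PlaneTree, S.map.Iso T.map) = S.labellings := by
  rw [← Nat.card_congr (Equiv.ofBijective _ S.relabel_bijective), labellings]
  simp [Fintype.card_perm, mul_assoc]

instance (S : PlaneTree) : Finite (Σ T : PlaneTree, S.map.Iso T.map) :=
  Finite.of_surjective _ S.relabel_bijective.2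

instance (S T : PlaneTree) : Finite (S.map.Iso T.map) :=
  Finite.of_injective (fun φ => (⟨T, φ⟩ : Σ T : PlaneTree, S.map.Iso T.map))
    fun φ ψ h => by simpa using h

instance (S : PlaneTree) : Finite {T : PlaneTree // S ≈ T} :=
  Finite.of_surjective (fun s : Σ T : PlaneTree, S.map.Iso T.map =>
    (⟨s.1, ⟨s.2⟩⟩ : {T : PlaneTree // S ≈ T})) fun ⟨T, ⟨φ⟩⟩ => ⟨⟨T, φ⟩, rfl⟩

theorem card_class_mul_card_aut (S : PlaneTree) :
    Nat.card {T : PlaneTree // S ≈ T} * Nat.card (S.map.Iso S.map) = S.labellings := by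
  rw [← S.card_iso, ← card_sigma_of_card_eq (β := fun T : {T : PlaneTree // S ≈ T} =>
    S.map.Iso T.1.map)]
  · exact Nat.card_congr ⟨fun s => ⟨s.1.1, s.2⟩, fun s => ⟨⟨s.1, ⟨s.2⟩⟩, s.2⟩, fun _ => rfl,
      fun _ => rfl⟩
  · rintro ⟨T, ⟨φ⟩⟩
    refine Nat.card_congr ⟨(·.trans φ.symm), (·.trans φ), fun ψ => ?_, fun ψ => ?_⟩ <;>
    ext <;> simp [BMap.Iso.trans, BMap.Iso.symm]

theorem labellings_eq {S T : PlaneTree} (h : S ≈ T) : S.labellings = T.labellings := by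
  obtain ⟨φ⟩ := h
  rw [labellings, labellings, Fin.equiv_iff_eq.1 ⟨φ.onW⟩, Fin.equiv_iff_eq.1 ⟨φ.onB⟩,
    Fin.equiv_iff_eq.1 ⟨φ.onE⟩]

theorem labellings_ne_zero (S : PlaneTree) : S.labellings ≠ 0 := by
  simp [labellings, Nat.factorial_ne_zero]

/-- Interchange of the colours. -/
def swapEquiv : PlaneTree ≃ PlaneTree where
  toFun S := ofIsTree S.map.swap S.isTree.swap
  invFun S := ofIsTree S.map.swap S.isTree.swap
  left_inv _ := rfl
  right_inv _ := rfl

theorem finite_colWeight_a_b (d : Var →₀ ℕ) :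
    Finite {S : PlaneTree // S.map.colWeight Var.a Var.b = d} := by
  simp only [← BMap.weight_eq_colWeight]
  exact finite_weight d

theorem finite_colWeight_b_a (d : Var →₀ ℕ) :
    Finite {S : PlaneTree // S.map.colWeight Var.b Var.a = d} :=
  have := finite_colWeight_a_b d
  Finite.of_equiv {S : PlaneTree // S.map.colWeight Var.a Var.b = d}
    (swapEquiv.subtypeEquiv fun S => by rw [← S.map.colWeight_swap]; exact Iff.rfl)

end PlaneTree

/-- The exponential generating function of labelled plane trees, with the variables `v₁` and `v₂`
for the degrees of the white and the black vertices. -/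
noncomputable def labelledTreeSeries (v₁ v₂ : ℕ → Var) : MvPowerSeries Var ℚ :=
  genSeries (fun S : PlaneTree => S.map.colWeight v₁ v₂) fun S => 1 / (S.labellings : ℚ)

theorem labelledTreeSeries_a_b : labelledTreeSeries Var.a Var.b = planeTreeSeries := by
  rw [labelledTreeSeries, genSeries_quotient PlaneTree.finite_colWeight_a_b
    (by rintro S T ⟨φ⟩; exact (φ.colWeight_eq _ _).symm)
    fun S T h => by rw [PlaneTree.labellings_eq h]]
  refine genSeries_equiv (Equiv.refl _) (fun τ => BMap.weight_eq_colWeight _) fun τ => ?_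
  have hcard := τ.out.card_class_mul_card_aut
  have hne := τ.out.labellings_ne_zero
  rw [← hcard] at hne ⊢
  have := Nat.cast_ne_zero (R := ℚ).2 (left_ne_zero_of_mul hne)
  rw [Equiv.refl_apply, Nat.cast_mul, mul_one_div, div_mul_cancel_left₀ this, one_div]

theorem labelledTreeSeries_b_a : labelledTreeSeries Var.b Var.a = planeTreeSeries := by
  rw [← labelledTreeSeries_a_b]
  refine genSeries_equiv PlaneTree.swapEquiv (fun S => S.map.colWeight_swap _ _) fun S => ?_
  change 1 / ((S.nB.factorial * S.nW.factorial * S.nE.factorial : ℕ) : ℚ) = 1 /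
    ((S.nW.factorial * S.nB.factorial * S.nE.factorial : ℕ) : ℚ)
  rw [mul_comm S.nB.factorial]

/-! ### Trees rooted at a white corner -/

/-- A plane tree with a chosen corner at a white vertex. -/
abbrev CornerTree : Type := Σ S : PlaneTree, S.map.Corner

namespace CornerTree

/-- Isomorphisms of rooted trees, i.e. isomorphisms of plane trees that preserve the root
corner. -/
def Iso (S T : CornerTree) : Type :=
  {φ : S.1.map.Iso T.1.map // φ.onW S.2.1.1 = T.2.1.1 ∧ S.2.1.2.map φ.onE = T.2.1.2}

instance isoSetoid : Setoid CornerTree where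
  r S T := Nonempty (Iso S T)
  iseqv := by
    refine ⟨fun S => ⟨BMap.Iso.refl _, rfl, by simp [BMap.Iso.refl]⟩, ?_, ?_⟩
    · rintro S T ⟨φ, hu, hc⟩
      refine ⟨φ.symm, by simp [BMap.Iso.symm, ← hu], ?_⟩
      rw [← hc]
      simp [BMap.Iso.symm]
    · rintro S T U ⟨φ, hu, hc⟩ ⟨ψ, hu', hc'⟩
      refine ⟨φ.trans ψ, by simp [BMap.Iso.trans, hu, hu'], ?_⟩
      rw [← hc', ← hc, Option.map_map]
      rfl

instance (S T : CornerTree) : Subsingleton (Iso S T) :=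
  ⟨fun φ ψ => Subtype.ext (S.1.isTree.1.iso_eq_of_corner S.2 (φ.2.1.trans ψ.2.1.symm)
    (φ.2.2.trans ψ.2.2.symm))⟩

/-- The isomorphisms from a rooted tree are those from the underlying tree: they carry the root
along. -/
def sigmaIsoEquiv (S : CornerTree) :
    (Σ T : PlaneTree, S.1.map.Iso T.map) ≃ Σ T : CornerTree, Iso S T where
  toFun s := ⟨⟨s.1, ⟨(s.2.onW S.2.1.1, S.2.1.2.map s.2.onE), s.2.isCornerAt_atW S.2.2⟩⟩,
    s.2, rfl, rfl⟩
  invFun s := ⟨s.1.1, s.2.1⟩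
  left_inv s := rfl
  right_inv := by
    rintro ⟨⟨T, ⟨⟨u, c⟩, h⟩⟩, ⟨φ, hu, hc⟩⟩
    change S.1.map.Iso T.map at φ
    change φ.onW S.2.1.1 = u at hu
    change S.2.1.2.map φ.onE = c at hc
    subst hu hc
    rfl

theorem card_class (S : CornerTree) : Nat.card {T : CornerTree // S ≈ T} = S.1.labellings := by
  rw [← S.1.card_iso, Nat.card_congr S.sigmaIsoEquiv]
  refine (Nat.card_congr (Equiv.ofBijective (fun s => ⟨s.1, ⟨s.2⟩⟩) ⟨?_, ?_⟩)).symm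
  · rintro ⟨T, φ⟩ ⟨T', φ'⟩ h
    obtain rfl : T = T' := congrArg Subtype.val h
    rw [Subsingleton.elim φ φ']
  · rintro ⟨T, ⟨φ⟩⟩
    exact ⟨⟨T, φ⟩, rfl⟩

/-- The monomial of a rooted tree, with the degree of the root raised by two and one additional
edge. -/
noncomputable def rootWeight (v₁ v₂ : ℕ → Var) (S : CornerTree) : Var →₀ ℕ :=
  ∑ w, Finsupp.single (v₁ (S.1.map.degW w + if S.2.1.1 = w then 2 else 0)) 1 +
    ∑ b, Finsupp.single (v₂ (S.1.map.degB b)) 1 +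
      Finsupp.single Var.t (S.1.nW + S.1.nB) + Finsupp.single Var.x (S.1.nE + 1)

theorem rootWeight_add (v₁ v₂ : ℕ → Var) (S : CornerTree) :
    S.rootWeight v₁ v₂ + Finsupp.single (v₁ (S.1.map.degW S.2.1.1)) 1 =
      S.1.map.colWeight v₁ v₂ + cornerShift v₁ (S.1.map.degW S.2.1.1) := by
  rw [rootWeight, BMap.colWeight, ← Finset.add_sum_erase Finset.univ _ (Finset.mem_univ S.2.1.1),
    ← Finset.add_sum_erase Finset.univ (fun w => Finsupp.single (v₁ (S.1.map.degW w)) 1)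
      (Finset.mem_univ S.2.1.1), if_pos rfl]
  rw [Finset.sum_congr rfl fun w hw => by
    rw [if_neg (Finset.ne_of_mem_erase hw).symm, add_zero], cornerShift, Finsupp.single_add Var.x]
  simp only [Nat.card_eq_fintype_card, Fintype.card_fin]
  abel

theorem rootWeight_eq (v₁ v₂ : ℕ → Var) {S T : CornerTree} (h : S ≈ T) :
    S.rootWeight v₁ v₂ = T.rootWeight v₁ v₂ := by
  obtain ⟨φ, hu, -⟩ := h
  rw [← add_left_inj (Finsupp.single (v₁ (S.1.map.degW S.2.1.1)) 1), rootWeight_add,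
    ← φ.degW_eq, hu, rootWeight_add, φ.colWeight_eq]

theorem finite_rootWeight {v₁ v₂ : ℕ → Var} (hv : Function.Injective v₁)
    (hfin : ∀ d, Finite {S : PlaneTree // S.map.colWeight v₁ v₂ = d}) (d : Var →₀ ℕ) :
    Finite {S : CornerTree // S.rootWeight v₁ v₂ = d} :=
  finite_rooted_weight (ι := PlaneTree) (K := fun S => S.map.Corner) hfin hv
    (deg := fun S κ => S.map.degW κ.1.1) (wt' := fun S => rootWeight v₁ v₂ S)
    (rootWeight_add v₁ v₂) d

end CornerTree

/-- The generating function of the isomorphism classes of rooted trees. -/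
noncomputable def rootedSeries (v₁ v₂ : ℕ → Var) : MvPowerSeries Var ℚ :=
  genSeries (fun τ : Quotient CornerTree.isoSetoid => τ.out.rootWeight v₁ v₂) fun _ => 1

/-- A rooted tree has no automorphisms, so the weights `1 / #Aut` disappear. -/
theorem diffOp_labelledTreeSeries {v₁ v₂ : ℕ → Var} (hv : Function.Injective v₁)
    (hfin : ∀ d, Finite {S : PlaneTree // S.map.colWeight v₁ v₂ = d})
    (h₁₂ : ∀ i j, v₂ i ≠ v₁ j) (ht : ∀ j, Var.t ≠ v₁ j) (hx : ∀ j, Var.x ≠ v₁ j) :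
    diffOp v₁ (labelledTreeSeries v₁ v₂) = rootedSeries v₁ v₂ := by
  rw [labelledTreeSeries, diffOp_genSeries (ι := PlaneTree) (K := fun S => S.map.Corner) hfin hv
    (deg := fun S κ => S.map.degW κ.1.1) (wt' := fun S => CornerTree.rootWeight v₁ v₂ S)
    (CornerTree.rootWeight_add v₁ v₂),
    genSeries_quotient (ι := CornerTree) (CornerTree.finite_rootWeight hv hfin)
      (fun S T => CornerTree.rootWeight_eq v₁ v₂)
      (by rintro S T ⟨φ, -⟩; rw [PlaneTree.labellings_eq ⟨φ⟩])]
  · refine genSeries_equiv (Equiv.refl _) (fun _ => rfl) fun τ => ?_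
    rw [CornerTree.card_class, mul_one_div_cancel (Nat.cast_ne_zero.2 τ.out.1.labellings_ne_zero)]
  · intro S k
    rw [BMap.card_corner_degW]
    congr 1
    classical
    rw [BMap.colWeight]
    simp only [Finsupp.add_apply, Finsupp.finsetSum_apply, Finsupp.single_apply, h₁₂, ht, hx,
      if_false, Finset.sum_const_zero, add_zero, hv.eq_iff]
    rw [Nat.card_eq_fintype_card, Fintype.card_subtype, Finset.card_filter]

/-! ### Degree sequences -/

section Words

variable {α : Type}

theorem finite_sum_single_eq (p : ℕ) (k : α →₀ ℕ) :
    Finite {f : Fin p → α // ∑ i, Finsupp.single (f i) 1 = k} := by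
  classical
  have hmem : ∀ f : Fin p → α, ∑ i, Finsupp.single (f i) 1 = k → ∀ i, f i ∈ k.support := by
    rintro f rfl i
    rw [Finsupp.mem_support_iff, Finsupp.finsetSum_apply]
    refine (Finset.sum_pos' (fun _ _ => Nat.zero_le _) ⟨i, Finset.mem_univ i, ?_⟩).ne'
    simp
  refine Finite.of_injective (β := Fin p → k.support) (fun f i => ⟨f.1 i, hmem f.1 f.2 i⟩) ?_
  intro f g h
  exact Subtype.ext (funext fun i => congrArg Subtype.val (congrFun h i))

theorem single_one_le_of_mem_support {k : α →₀ ℕ} {a : α} (ha : a ∈ k.support) :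
    Finsupp.single a 1 ≤ k :=
  Finsupp.single_le_iff.2 (Nat.one_le_iff_ne_zero.2 (Finsupp.mem_support_iff.1 ha))

theorem card_sum_single_succ (p : ℕ) (k : α →₀ ℕ) :
    Nat.card {f : Fin (p + 1) → α // ∑ i, Finsupp.single (f i) 1 = k} =
      ∑ a : k.support, Nat.card {f : Fin p → α //
        ∑ i, Finsupp.single (f i) 1 = k - Finsupp.single a.1 1} := by
  have := fun a : k.support => finite_sum_single_eq p (k - Finsupp.single a.1 1)
  rw [← Nat.card_sigma]
  have hcons : ∀ s : Σ a : k.support, {f : Fin p → α //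
      ∑ i, Finsupp.single (f i) 1 = k - Finsupp.single a.1 1},
      ∑ i, Finsupp.single ((Fin.cons s.1.1 s.2.1 : Fin (p + 1) → α) i) 1 = k := by
    rintro ⟨a, f, hf⟩
    rw [Fin.sum_univ_succ]
    simp only [Fin.cons_zero, Fin.cons_succ]
    rw [hf, add_tsub_cancel_of_le (single_one_le_of_mem_support a.2)]
  refine (Nat.card_congr (Equiv.ofBijective
    (fun s => ⟨Fin.cons s.1.1 s.2.1, hcons s⟩) ⟨?_, ?_⟩)).symm
  · rintro ⟨⟨a, ha⟩, ⟨f, hf⟩⟩ ⟨⟨a', ha'⟩, ⟨f', hf'⟩⟩ h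
    simp only [Subtype.mk.injEq, Fin.cons_inj] at h
    obtain ⟨rfl, rfl⟩ := h
    rfl
  · rintro ⟨f, hf⟩
    rw [Fin.sum_univ_succ] at hf
    refine ⟨⟨⟨f 0, ?_⟩, ⟨fun i => f i.succ, ?_⟩⟩, Subtype.ext (Fin.cons_self_tail f)⟩
    · rw [← hf, Finsupp.mem_support_iff, Finsupp.add_apply, Finsupp.single_eq_same]
      omega
    · exact (by rw [← hf, add_tsub_cancel_left] :
        ∑ i : Fin p, Finsupp.single (f i.succ) 1 = k - Finsupp.single (f 0) 1)

theorem degree_sub_single_add_one {k : α →₀ ℕ} {a : α} (ha : a ∈ k.support) :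
    (k - Finsupp.single a 1).degree + 1 = k.degree := by
  conv_rhs => rw [← tsub_add_cancel_of_le (single_one_le_of_mem_support ha)]
  rw [map_add, Finsupp.degree_single]

theorem prod_factorial_eq_mul_prod_factorial_sub_single {k : α →₀ ℕ} {a : α}
    (ha : a ∈ k.support) : (k.prod fun _ m => m.factorial) =
      k a * ((k - Finsupp.single a 1).prod fun _ m => m.factorial) := by
  classical
  rw [Finsupp.prod, ← Finset.mul_prod_erase _ _ ha,
    Finsupp.prod_of_support_subset (s := k.support) _
      (Finsupp.support_mono tsub_le_self) _ (by simp),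
    ← Finset.mul_prod_erase k.support _ ha, ← mul_assoc]
  congr 1
  · simp only [Finsupp.coe_tsub, Pi.sub_apply, Finsupp.single_eq_same]
    exact (Nat.mul_factorial_pred (Finsupp.mem_support_iff.1 ha)).symm
  · refine Finset.prod_congr rfl fun b hb => ?_
    simp [Finsupp.single_eq_of_ne (Finset.ne_of_mem_erase hb)]

theorem card_sum_single_mul_prod_factorial (p : ℕ) : ∀ k : α →₀ ℕ, k.degree = p →
    Nat.card {f : Fin p → α // ∑ i, Finsupp.single (f i) 1 = k} *
      (k.prod fun _ m => m.factorial) = p.factorial := by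
  induction p with
  | zero =>
    intro k hk
    obtain rfl : k = 0 := (Finsupp.degree_eq_zero_iff k).1 hk
    simp
  | succ p ih =>
    intro k hk
    have hterm : ∀ a : k.support, Nat.card {f : Fin p → α //
        ∑ i, Finsupp.single (f i) 1 = k - Finsupp.single a.1 1} *
          (k.prod fun _ m => m.factorial) = k a * p.factorial := fun a => by
      have hdeg := degree_sub_single_add_one a.2
      rw [prod_factorial_eq_mul_prod_factorial_sub_single a.2, mul_left_comm, ih _ (by omega)]
    rw [card_sum_single_succ, Finset.sum_mul, Finset.sum_congr rfl fun a _ => hterm a,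
      ← Finset.sum_mul, Nat.factorial_succ, ← hk, Finset.sum_coe_sort k.support fun a => k a,
      Finsupp.degree_apply]

theorem degree_sum_single {ι : Type} [Fintype ι] (f : ι → α) :
    (∑ i, Finsupp.single (f i) 1 : α →₀ ℕ).degree = Fintype.card ι := by
  rw [map_sum]
  simp

end Words

/-- The weighted sum `‖k‖ = ∑ i k_i` of a degree sequence. -/
noncomputable def seqNorm (k : ℕ+ →₀ ℕ) : ℕ := k.sum fun i m => m * (i : ℕ)

/-- The exponents of `v^k t^|k|`, that is, `seqWeight` without the variable counting edges. -/
noncomputable def seqWeightCore (v : ℕ → Var) (k : ℕ+ →₀ ℕ) : Var →₀ ℕ :=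
  k.sum fun i m => m • (Finsupp.single (v i) 1 + Finsupp.single Var.t 1)

/-- The coefficient `(|k| - 1)! / k!` of `A` and `B`. -/
noncomputable def seqCoeff (k : ℕ+ →₀ ℕ) : ℚ :=
  ((k.degree - 1).factorial : ℚ) / (k.prod fun _ m => (m.factorial : ℚ))

theorem seqWeight_eq (v : ℕ → Var) (z : Var) (k : ℕ+ →₀ ℕ) :
    seqWeight v z k = seqWeightCore v k + Finsupp.single z (seqNorm k) := by
  simp only [seqWeight, seqWeightCore, seqNorm, Finsupp.sum, Finsupp.single_finsetSum]
  rw [← Finset.sum_add_distrib]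
  refine Finset.sum_congr rfl fun i _ => ?_
  rw [smul_add, Finsupp.smul_single, smul_eq_mul]

theorem seqWeightCore_sum_single {ι : Type} [Fintype ι] (v : ℕ → Var) (f : ι → ℕ+) :
    seqWeightCore v (∑ i, Finsupp.single (f i) 1) =
      ∑ i, (Finsupp.single (v (f i)) 1 + Finsupp.single Var.t 1) := by
  unfold seqWeightCore
  rw [← Finsupp.sum_finsetSum_index (by simp) (by intros; rw [add_smul])]
  refine Finset.sum_congr rfl fun i _ => ?_
  rw [Finsupp.sum_single_index (by simp), one_smul]

theorem seqNorm_sum_single {ι : Type} [Fintype ι] (f : ι → ℕ+) :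
    seqNorm (∑ i, Finsupp.single (f i) 1) = ∑ i, (f i : ℕ) := by
  unfold seqNorm
  rw [← Finsupp.sum_finsetSum_index (by simp) (by intros; rw [add_mul])]
  refine Finset.sum_congr rfl fun i _ => ?_
  rw [Finsupp.sum_single_index (by simp), one_mul]

theorem seqWeightCore_apply_of_ne (v : ℕ → Var) (k : ℕ+ →₀ ℕ) {s : Var} (hs : ∀ i, s ≠ v i)
    (ht : s ≠ Var.t) : seqWeightCore v k s = 0 := by
  simp [seqWeightCore, Finsupp.sum, Finsupp.finsetSum_apply, Finsupp.single_eq_of_ne (hs _),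
    Finsupp.single_eq_of_ne ht]

theorem seqWeightCore_apply_t (v : ℕ → Var) (k : ℕ+ →₀ ℕ) (hv : ∀ i, Var.t ≠ v i) :
    seqWeightCore v k Var.t = k.degree := by
  simp [seqWeightCore, Finsupp.sum, Finsupp.finsetSum_apply, Finsupp.single_eq_of_ne (hv _),
    Finsupp.degree_apply]

theorem seqWeightCore_apply_self {v : ℕ → Var} (hv : Function.Injective v) (hvt : ∀ i, v i ≠ Var.t)
    (k : ℕ+ →₀ ℕ) (i : ℕ+) : seqWeightCore v k (v i) = k i := by
  classical
  simp only [seqWeightCore, Finsupp.sum, Finsupp.finsetSum_apply, Finsupp.smul_apply,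
    Finsupp.add_apply, Finsupp.single_eq_of_ne (hvt i), add_zero, smul_eq_mul]
  rw [Finset.sum_eq_single i]
  · simp
  · intro j _ hj
    rw [Finsupp.single_eq_of_ne fun h => hj (PNat.coe_injective (hv h)).symm, mul_zero]
  · intro hi
    simp [Finsupp.notMem_support_iff.1 hi]

theorem seqWeight_injective {v : ℕ → Var} (hv : Function.Injective v) (hvt : ∀ i, v i ≠ Var.t)
    {z : Var} (hvz : ∀ i, v i ≠ z) : Function.Injective (seqWeight v z) := by
  intro k l h
  ext i
  have := DFunLike.congr_fun h (v i)
  simpa [seqWeight_eq, seqWeightCore_apply_self hv hvt, Finsupp.single_eq_of_ne (hvz i)] using this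

theorem finite_setOf_eq_of_injective {α β : Type*} {f : α → β} (hf : Function.Injective f)
    (b : β) : Finite {a // f a = b} :=
  have : Subsingleton {a // f a = b} :=
    ⟨fun a a' => Subtype.ext (hf (a.2.trans a'.2.symm))⟩
  inferInstance

theorem finite_seqWeight {v : ℕ → Var} (hv : Function.Injective v) (hvt : ∀ i, v i ≠ Var.t)
    {z : Var} (hvz : ∀ i, v i ≠ z) (d : Var →₀ ℕ) :
    Finite {k : {k : ℕ+ →₀ ℕ // k ≠ 0} // seqWeight v z k = d} :=
  finite_setOf_eq_of_injective ((seqWeight_injective hv hvt hvz).comp Subtype.val_injective) d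

theorem Var.a_injective : Function.Injective Var.a := fun _ _ h => by injection h

theorem Var.b_injective : Function.Injective Var.b := fun _ _ h => by injection h

theorem finsum_subtype_eq_finsum_ite {α M : Type*} [AddCommMonoid M] (p : α → Prop)
    [DecidablePred p] (f : α → M) : ∑ᶠ a : {a // p a}, f a = ∑ᶠ a, if p a then f a else 0 := by
  rw [finsum_subtype_eq_finsum_cond]
  exact finsum_congr fun a => finsum_eq_if

theorem coeff_genSeries_eq_finsum_ite {ι : Type} (wt : ι → Var →₀ ℕ) (c : ι → ℚ) (d : Var →₀ ℕ)
    [DecidablePred fun i => wt i = d] :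
    MvPowerSeries.coeff d (genSeries wt c) = ∑ᶠ i, if wt i = d then c i else 0 := by
  rw [coeff_genSeries, finsum_subtype_eq_finsum_ite]

/-- A term of the product `A * B`: the sequences of multiplicities of the white and of the black
vertex degrees. -/
abbrev DegreePair : Type := {k : ℕ+ →₀ ℕ // k ≠ 0} × {k : ℕ+ →₀ ℕ // k ≠ 0}

namespace DegreePair

/-- The condition `deg x = deg y = deg t - 1` selecting the terms of `A * B` kept in `T`. -/
def IsAdmissible (p : DegreePair) : Prop :=
  seqNorm p.1 = seqNorm p.2 ∧ p.1.1.degree + p.2.1.degree = seqNorm p.1 + 1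

/-- The monomial of a term of `A * B` after setting `y = 1`. -/
noncomputable def weight (p : DegreePair) : Var →₀ ℕ :=
  seqWeight Var.a Var.x p.1 + seqWeightCore Var.b p.2

open Classical in
/-- The coefficient of a term of `A * B` in `T`. -/
noncomputable def coeff (p : DegreePair) : ℚ :=
  if p.IsAdmissible then seqCoeff p.1 * seqCoeff p.2 else 0

theorem weight_eq_iff (p : DegreePair) (d : Var →₀ ℕ) :
    p.weight = d ∧ p.IsAdmissible ↔ (d Var.y = 0 ∧ d Var.t = d Var.x + 1) ∧
      seqWeight Var.a Var.x p.1 + seqWeight Var.b Var.y p.2 =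
        d + Finsupp.single Var.y (d Var.x) := by
  have hx : p.weight Var.x = seqNorm p.1 := by
    simp [weight, seqWeight_eq, seqWeightCore_apply_of_ne]
  have hy : p.weight Var.y = 0 := by
    simp [weight, seqWeight_eq, seqWeightCore_apply_of_ne]
  have ht : p.weight Var.t = p.1.1.degree + p.2.1.degree := by
    simp [weight, seqWeight_eq, seqWeightCore_apply_t]
  have hsum : seqWeight Var.a Var.x p.1 + seqWeight Var.b Var.y p.2 =
      p.weight + Finsupp.single Var.y (seqNorm p.2) := by
    rw [weight, seqWeight_eq Var.b, add_assoc]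
  rw [hsum]
  constructor
  · rintro ⟨rfl, hnorm, hdeg⟩
    exact ⟨⟨hy, by rw [ht, hx, hdeg]⟩, by rw [hx, hnorm]⟩
  · rintro ⟨⟨hdy, hdt⟩, heq⟩
    have hnorm := DFunLike.congr_fun heq Var.y
    simp only [Finsupp.add_apply, Finsupp.single_eq_same, hy, hdy, zero_add] at hnorm
    rw [hnorm, add_left_inj] at heq
    subst heq
    rw [hx] at hdt hnorm
    rw [ht] at hdt
    exact ⟨rfl, hnorm.symm, hdt⟩

theorem weight_injective : Function.Injective weight := by
  rintro ⟨⟨k, hk⟩, ⟨l, hl⟩⟩ ⟨⟨k', hk'⟩, ⟨l', hl'⟩⟩ h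
  simp only [weight, seqWeight_eq] at h
  obtain rfl : k = k' := by
    ext i
    simpa [seqWeightCore_apply_self Var.a_injective, seqWeightCore_apply_of_ne Var.b]
      using DFunLike.congr_fun h (Var.a i)
  obtain rfl : l = l' := by
    ext i
    simpa [seqWeightCore_apply_self Var.b_injective, seqWeightCore_apply_of_ne Var.a]
      using DFunLike.congr_fun h (Var.b i)
  rfl

theorem coeff_genSeries_weight (d : Var →₀ ℕ)
    [Decidable (d Var.y = 0 ∧ d Var.t = d Var.x + 1)] :
    MvPowerSeries.coeff d (genSeries weight coeff) =
      if d Var.y = 0 ∧ d Var.t = d Var.x + 1 then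
        MvPowerSeries.coeff (d + Finsupp.single Var.y (d Var.x)) (seriesA * seriesB) else 0 := by
  classical
  rw [seriesA, seriesB, degreeSeries, degreeSeries,
    genSeries_mul (finite_seqWeight Var.a_injective (by simp) (by simp))
      (finite_seqWeight Var.b_injective (by simp) (by simp)),
    coeff_genSeries_eq_finsum_ite, coeff_genSeries_eq_finsum_ite]
  have hterm : ∀ p : DegreePair, (if p.weight = d then p.coeff else 0) =
      if p.weight = d ∧ p.IsAdmissible then seqCoeff p.1 * seqCoeff p.2 else 0 := fun p => by
    rw [coeff, ite_and]
  simp only [hterm, weight_eq_iff]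
  split_ifs with hd
  · exact finsum_congr fun p => by simp only [hd, true_and, and_self]; rfl
  · exact finsum_eq_zero_of_forall_eq_zero fun p => if_neg fun h => hd h.1

end DegreePair

/-- The monomials of `T`: those of the two one-vertex trees (white for `true`) and those of the
terms of `A * B`. -/
noncomputable def passportWeight : Bool ⊕ DegreePair → Var →₀ ℕ
  | .inl c => Finsupp.single (if c then Var.a 0 else Var.b 0) 1 + Finsupp.single Var.t 1
  | .inr p => p.weight

theorem finite_passportWeight (d : Var →₀ ℕ) : Finite {i // passportWeight i = d} :=
  have : Finite {p : DegreePair // passportWeight (.inr p) = d} :=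
    finite_setOf_eq_of_injective DegreePair.weight_injective d
  Finite.of_equiv ({c : Bool // passportWeight (.inl c) = d} ⊕
    {p : DegreePair // passportWeight (.inr p) = d})
    (Equiv.subtypeSum (p := fun i => passportWeight i = d)).symm

theorem genSeries_sum {α β : Type} {wt : α ⊕ β → Var →₀ ℕ} (hfin : ∀ d, Finite {i // wt i = d})
    (c : α ⊕ β → ℚ) : genSeries wt c =
      genSeries (fun a => wt (.inl a)) (fun a => c (.inl a)) +
        genSeries (fun b => wt (.inr b)) fun b => c (.inr b) := by
  ext d
  rw [map_add, coeff_genSeries, coeff_genSeries, coeff_genSeries]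
  have := hfin d
  have : Finite ({a // wt (.inl a) = d} ⊕ {b // wt (.inr b) = d}) :=
    Finite.of_equiv {i // wt i = d} Equiv.subtypeSum
  have : Finite {a // wt (.inl a) = d} := Finite.sum_left {b // wt (.inr b) = d}
  have : Finite {b // wt (.inr b) = d} := Finite.sum_right {a // wt (.inl a) = d}
  have := Fintype.ofFinite {a // wt (.inl a) = d}
  have := Fintype.ofFinite {b // wt (.inr b) = d}
  rw [← finsum_comp_equiv (Equiv.subtypeSum (p := fun i => wt i = d)).symm,
    finsum_eq_sum_of_fintype, Fintype.sum_sum_type, finsum_eq_sum_of_fintype,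
    finsum_eq_sum_of_fintype]
  rfl

theorem genSeries_bool (wt : Bool → Var →₀ ℕ) :
    genSeries wt (fun _ => 1) = MvPowerSeries.monomial (wt true) 1 +
      MvPowerSeries.monomial (wt false) 1 := by
  classical
  ext d
  rw [coeff_genSeries_eq_finsum_ite, finsum_eq_sum_of_fintype, Fintype.sum_bool,
    map_add, MvPowerSeries.coeff_monomial, MvPowerSeries.coeff_monomial]
  simp only [eq_comm]

theorem seriesT_eq_genSeries :
    seriesT = genSeries passportWeight (Sum.elim (fun _ => 1) DegreePair.coeff) := by
  rw [genSeries_sum finite_passportWeight]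
  simp only [Sum.elim_inl, Sum.elim_inr]
  rw [genSeries_bool, seriesT, add_assoc, add_comm]
  congr 1
  · simp [passportWeight, MvPowerSeries.X_def, MvPowerSeries.monomial_mul_monomial]
  · ext d
    exact (coeff_ofCoeff _ _).trans (DegreePair.coeff_genSeries_weight d).symm

/-! ### Counting trees by their degree sequences -/

namespace BMap

variable {W B E : Type} {m : BMap W B E}

/-- The degree sequence `(k_1, k_2, …)` of the white vertices. Meaningful only without isolated
vertices: these would be counted as vertices of degree `1`, by the convention of `Nat.toPNat'`. -/
noncomputable def seqW [Fintype W] (m : BMap W B E) : ℕ+ →₀ ℕ :=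
  ∑ w, Finsupp.single (m.degW w).toPNat' 1

theorem Conn.degW_pos [Finite E] [Nonempty E] (h : m.Conn) (w : W) : 0 < m.degW w := by
  obtain ⟨e, he⟩ := h.atW_surjective w
  have : Nonempty {e // m.atW e = w} := ⟨⟨e, he⟩⟩
  exact Nat.card_pos

theorem Conn.coe_toPNat'_degW [Finite E] [Nonempty E] (h : m.Conn) (w : W) :
    ((m.degW w).toPNat' : ℕ) = m.degW w := by
  rw [Nat.toPNat'_coe, if_pos (h.degW_pos w)]

theorem seqW_ne_zero [Fintype W] [Nonempty E] (m : BMap W B E) : m.seqW ≠ 0 := by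
  intro h
  have := congrArg Finsupp.degree h
  rw [seqW, degree_sum_single, map_zero, Fintype.card_eq_zero_iff] at this
  exact this.false (m.atW (Classical.arbitrary E))

theorem degree_seqW [Fintype W] (m : BMap W B E) : m.seqW.degree = Nat.card W := by
  rw [seqW, degree_sum_single, Nat.card_eq_fintype_card]

theorem Conn.seqNorm_seqW [Fintype W] [Finite E] [Nonempty E] (h : m.Conn) :
    seqNorm m.seqW = Nat.card E := by
  rw [seqW, seqNorm_sum_single, ← m.sum_degW]
  exact Finset.sum_congr rfl fun w _ => h.coe_toPNat'_degW w

theorem Conn.seqWeightCore_seqW [Fintype W] [Finite E] [Nonempty E] (h : m.Conn) (v : ℕ → Var) :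
    seqWeightCore v m.seqW =
      ∑ w, Finsupp.single (v (m.degW w)) 1 + Finsupp.single Var.t (Nat.card W) := by
  simp [seqW, seqWeightCore_sum_single, h.coe_toPNat'_degW, Finset.sum_add_distrib]

theorem Conn.colWeight_eq_seqWeight_add [Fintype W] [Fintype B] [Finite E] [Nonempty E]
    (h : m.Conn) (v₁ v₂ : ℕ → Var) :
    m.colWeight v₁ v₂ = seqWeight v₁ Var.x m.seqW + seqWeightCore v₂ m.swap.seqW := by
  rw [seqWeight_eq, h.seqNorm_seqW, h.seqWeightCore_seqW, h.swap.seqWeightCore_seqW, colWeight,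
    Finsupp.single_add]
  change _ = _ + (∑ b, Finsupp.single (v₂ (m.degB b)) 1 + _)
  abel

theorem HasDegrees.seqW_eq [Fintype W] {d : W → ℕ+} {e : B → ℕ}
    (h : m.HasDegrees (fun w => d w) e) : m.seqW = ∑ w, Finsupp.single (d w) 1 := by
  rw [seqW, h.2.1]
  simp

/-- The map without edges on `p` white and `q` black vertices. -/
def edgeless (p q : ℕ) : BMap (Fin p) (Fin q) (Fin 0) :=
  ⟨finZeroElim, finZeroElim, 1, 1, fun e => e.elim0, fun e => e.elim0⟩

theorem isTree_edgeless {p q : ℕ} (h : p + q = 1) : (edgeless p q).IsTree := by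
  have hcard : Fintype.card (Fin p ⊕ Fin q) = 1 := by simpa using h
  obtain ⟨x, hx⟩ := Fintype.card_eq_one_iff.1 hcard
  refine ⟨⟨⟨x⟩, fun P _ y z => ?_⟩, by simpa using h⟩
  rw [hx y, hx z]
  exact id

end BMap

namespace PlaneTree

open Classical in
/-- The passport of a tree: its colour if it has one vertex (`true` for white), and its degree
sequences otherwise. -/
noncomputable def passport (S : PlaneTree) : Bool ⊕ DegreePair :=
  if h : S.nE = 0 then .inl (decide (S.nW = 1)) else
    have := Fin.pos_iff_nonempty.1 (Nat.pos_of_ne_zero h)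
    .inr (⟨S.map.seqW, S.map.seqW_ne_zero⟩, ⟨S.map.swap.seqW, S.map.swap.seqW_ne_zero⟩)

theorem nW_add_nB (S : PlaneTree) : S.nW + S.nB = S.nE + 1 := by
  simpa only [Nat.card_eq_fintype_card, Fintype.card_fin] using S.isTree.2

theorem passport_eq_inl_iff (S : PlaneTree) (c : Bool) :
    S.passport = .inl c ↔ S.nE = 0 ∧ S.nW = c.toNat ∧ S.nB = (!c).toNat := by
  have hcard := S.nW_add_nB
  unfold passport
  split_ifs with h
  · rw [h] at hcard
    have : S.nW = 1 ∧ S.nB = 0 ∨ S.nW = 0 ∧ S.nB = 1 := by omega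
    rcases this with ⟨hW, hB⟩ | ⟨hW, hB⟩ <;> cases c <;> simp [h, hW, hB]
  · simp [h]

theorem passport_eq_inr_iff (S : PlaneTree) (p : DegreePair) :
    S.passport = .inr p ↔ S.nE ≠ 0 ∧ S.map.seqW = p.1 ∧ S.map.swap.seqW = p.2 := by
  unfold passport
  split_ifs with h
  · simp [h]
  · simp [h, Prod.ext_iff, Subtype.ext_iff]

theorem passportWeight_passport (S : PlaneTree) :
    passportWeight S.passport = S.map.colWeight Var.a Var.b := by
  rcases h : S.passport with c | p
  · obtain ⟨hE, hW, hB⟩ := (S.passport_eq_inl_iff c).1 h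
    have : IsEmpty (Fin S.nE) := by rw [hE]; infer_instance
    have hdegW : ∀ w, S.map.degW w = 0 := fun w => by simp [BMap.degW]
    have hdegB : ∀ b, S.map.degB b = 0 := fun b => by simp [BMap.degB]
    cases c <;> simp [passportWeight, BMap.colWeight, hdegW, hdegB, hE, hW, hB]
  · obtain ⟨hE, hW, hB⟩ := (S.passport_eq_inr_iff p).1 h
    have := Fin.pos_iff_nonempty.1 (Nat.pos_of_ne_zero hE)
    rw [passportWeight, DegreePair.weight, S.isTree.1.colWeight_eq_seqWeight_add, hW, hB]

theorem eq_edgeless {p q : ℕ} (h : p + q = 1) (S : PlaneTree) (hW : S.nW = p) (hB : S.nB = q)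
    (hE : S.nE = 0) : S = ofIsTree (BMap.edgeless p q) (BMap.isTree_edgeless h) := by
  obtain ⟨p', q', n', m, hplane, hface⟩ := S
  dsimp only at hW hB hE
  subst hW hB hE
  obtain rfl : m = BMap.edgeless p' q' := by ext e <;> exact e.elim0
  rfl

theorem finsum_passport_eq_inl (c : Bool) :
    ∑ᶠ S : {S : PlaneTree // S.passport = .inl c}, 1 / (S.1.labellings : ℚ) = 1 := by
  have hc : c.toNat + (!c).toNat = 1 := by cases c <;> rfl
  have : Unique {S : PlaneTree // S.passport = .inl c} :=
    { default := ⟨ofIsTree _ (BMap.isTree_edgeless hc),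
        (passport_eq_inl_iff _ _).2 ⟨rfl, rfl, rfl⟩⟩
      uniq := fun S => Subtype.ext <|
        have ⟨hE, hW, hB⟩ := (passport_eq_inl_iff _ _).1 S.2
        S.1.eq_edgeless hc hW hB hE }
  rw [finsum_unique]
  obtain ⟨hE, hW, hB⟩ := (passport_eq_inl_iff _ _).1
    (default : {S : PlaneTree // S.passport = .inl c}).2
  rw [labellings, hE, hW, hB]
  cases c <;> simp

theorem sizes_of_passport_eq {S : PlaneTree} {p : DegreePair} (h : S.passport = .inr p) :
    S.nW = p.1.1.degree ∧ S.nB = p.2.1.degree ∧ S.nE = seqNorm p.1 ∧ S.nE = seqNorm p.2 := by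
  obtain ⟨hE, hW, hB⟩ := (S.passport_eq_inr_iff p).1 h
  have := Fin.pos_iff_nonempty.1 (Nat.pos_of_ne_zero hE)
  simp [← hW, ← hB, BMap.degree_seqW, S.isTree.1.seqNorm_seqW, S.isTree.1.swap.seqNorm_seqW]

theorem isAdmissible_of_passport_eq {S : PlaneTree} {p : DegreePair}
    (h : S.passport = .inr p) : p.IsAdmissible := by
  obtain ⟨hW, hB, hE, hE'⟩ := sizes_of_passport_eq h
  have := S.nW_add_nB
  exact ⟨by omega, by omega⟩

end PlaneTree

namespace DegreePair

variable {p : DegreePair}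

theorem seqNorm_pos (p : DegreePair) : 0 < seqNorm p.1 := by
  obtain ⟨i, hi⟩ := Finsupp.support_nonempty_iff.2 p.1.2
  refine Finset.sum_pos' (fun _ _ => Nat.zero_le _) ⟨i, hi, ?_⟩
  exact Nat.mul_pos (Nat.pos_of_ne_zero (Finsupp.mem_support_iff.1 hi)) i.pos

theorem IsAdmissible.isTreeDegrees (hp : p.IsAdmissible)
    {f : Fin p.1.1.degree → ℕ+} (hf : ∑ i, Finsupp.single (f i) 1 = p.1.1)
    {g : Fin p.2.1.degree → ℕ+} (hg : ∑ i, Finsupp.single (g i) 1 = p.2.1) :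
    IsTreeDegrees (seqNorm p.1) (fun i => (f i : ℕ)) (fun i => (g i : ℕ)) where
  pos_left i := (f i).pos
  pos_right i := (g i).pos
  sum_left := (seqNorm_sum_single f).symm.trans (congrArg seqNorm hf)
  sum_right := ((seqNorm_sum_single g).symm.trans (congrArg seqNorm hg)).trans hp.1.symm
  card_add_card := by simpa using hp.2

end DegreePair

/-- Words in the positive integers in which each letter `i` occurs `k i` times: the possible
degree functions on `P` vertices with degree sequence `k`. -/
abbrev DegreeWord (P : ℕ) (k : ℕ+ →₀ ℕ) : Type :=
  {f : Fin P → ℕ+ // ∑ i, Finsupp.single (f i) 1 = k}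

theorem card_sigma_hasDegrees {P Q N : ℕ} (hN : N ≠ 0) (hV : P + Q = N + 1) (k l : ℕ+ →₀ ℕ) :
    Nat.card (Σ s : DegreeWord P k × DegreeWord Q l,
        {m : BMap (Fin P) (Fin Q) (Fin N) // m.HasDegrees (fun i => s.1.1 i) fun i => s.2.1 i}) =
      Nat.card {S : PlaneTree // (S.nW = P ∧ S.nB = Q ∧ S.nE = N) ∧
        S.map.seqW = k ∧ S.map.swap.seqW = l} := by
  have := Fin.pos_iff_nonempty.1 (Nat.pos_of_ne_zero hN)
  refine Nat.card_congr (Equiv.ofBijective (fun s =>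
    ⟨PlaneTree.ofIsTree s.2.1 ⟨s.2.2.1, by simpa using hV⟩, ⟨rfl, rfl, rfl⟩,
      s.2.2.seqW_eq.trans s.1.1.2,
      BMap.HasDegrees.seqW_eq ⟨s.2.2.1.swap, s.2.2.2.2, s.2.2.2.1⟩ |>.trans s.1.2.2⟩) ⟨?_, ?_⟩)
  · rintro ⟨⟨⟨f, hf⟩, ⟨g, hg⟩⟩, m, hm⟩ ⟨⟨⟨f', hf'⟩, ⟨g', hg'⟩⟩, m', hm'⟩ h
    have hmap := congrArg Subtype.val h
    simp only [PlaneTree.ofIsTree, PlaneTree.mk.injEq, heq_eq_eq, true_and] at hmap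
    subst hmap
    obtain rfl : f = f' :=
      funext fun i => PNat.coe_injective (congrFun (hm.2.1.symm.trans hm'.2.1) i)
    obtain rfl : g = g' :=
      funext fun i => PNat.coe_injective (congrFun (hm.2.2.symm.trans hm'.2.2) i)
    rfl
  · rintro ⟨S, ⟨hP, hQ, hE⟩, hk, hl⟩
    have hT := S.isTree
    obtain ⟨p', q', n', m, hplane, hface⟩ := S
    dsimp only at hP hQ hE hk hl hT
    subst hP hQ hE
    refine ⟨⟨⟨⟨_, hk⟩, ⟨_, hl⟩⟩, m, hT.1, ?_, ?_⟩, rfl⟩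
    · exact funext fun w => (hT.1.coe_toPNat'_degW w).symm
    · exact funext fun b => (hT.1.swap.coe_toPNat'_degW b).symm

namespace DegreePair

variable {p : DegreePair}

theorem card_passport_eq_inr (p : DegreePair) :
    Nat.card {S : PlaneTree // S.passport = .inr p} =
      Nat.card {S : PlaneTree // (S.nW = p.1.1.degree ∧ S.nB = p.2.1.degree ∧
        S.nE = seqNorm p.1) ∧ S.map.seqW = p.1 ∧ S.map.swap.seqW = p.2} := by
  refine Nat.card_congr (Equiv.subtypeEquivRight fun S => ⟨fun h => ?_, fun h => ?_⟩)
  · obtain ⟨hW, hB, hE, -⟩ := PlaneTree.sizes_of_passport_eq h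
    exact ⟨⟨hW, hB, hE⟩, ((S.passport_eq_inr_iff p).1 h).2⟩
  · exact (S.passport_eq_inr_iff p).2 ⟨by rw [h.1.2.2]; exact p.seqNorm_pos.ne', h.2⟩

theorem IsAdmissible.card_passport_mul (hp : p.IsAdmissible) :
    Nat.card {S : PlaneTree // S.passport = .inr p} *
      ((p.1.1.prod fun _ m => m.factorial) * (p.2.1.prod fun _ m => m.factorial)) =
    (p.1.1.degree - 1).factorial * (p.2.1.degree - 1).factorial *
      (p.1.1.degree.factorial * p.2.1.degree.factorial * (seqNorm p.1).factorial) := by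
  have := finite_sum_single_eq p.1.1.degree p.1.1
  have := finite_sum_single_eq p.2.1.degree p.2.1
  have hfiber : ∀ s : DegreeWord p.1.1.degree p.1.1 × DegreeWord p.2.1.degree p.2.1, _ :=
    fun s => (hp.isTreeDegrees s.1.2 s.2.2).card_hasDegrees (E := Fin (seqNorm p.1)) (by simp)
  rw [card_passport_eq_inr, ← card_sigma_hasDegrees p.seqNorm_pos.ne' hp.2,
    card_sigma_of_card_eq hfiber, Nat.card_prod,
    ← card_sum_single_mul_prod_factorial _ p.1.1 rfl,
    ← card_sum_single_mul_prod_factorial _ p.2.1 rfl]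
  simp only [Nat.card_eq_fintype_card, Fintype.card_fin]
  ring

theorem seqCoeff_mul_seqCoeff (k l : ℕ+ →₀ ℕ) : seqCoeff k * seqCoeff l =
    (((k.degree - 1).factorial * (l.degree - 1).factorial : ℕ) : ℚ) /
      (((k.prod fun _ m => m.factorial) * l.prod fun _ m => m.factorial : ℕ) : ℚ) := by
  rw [seqCoeff, seqCoeff, div_mul_div_comm]
  simp [Finsupp.prod]

theorem finsum_passport_eq_inr (p : DegreePair) :
    ∑ᶠ S : {S : PlaneTree // S.passport = .inr p}, 1 / (S.1.labellings : ℚ) = p.coeff := by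
  unfold coeff
  split_ifs with hp
  · have hlabel : ∀ S : {S : PlaneTree // S.passport = .inr p}, 1 / (S.1.labellings : ℚ) =
        1 / ((p.1.1.degree.factorial * p.2.1.degree.factorial * (seqNorm p.1).factorial : ℕ) : ℚ) :=
      fun S => by
        obtain ⟨hW, hB, hE, -⟩ := PlaneTree.sizes_of_passport_eq S.2
        rw [PlaneTree.labellings, hW, hB, hE]
    have hweight : ∀ S : PlaneTree, S.passport = .inr p →
        S.map.colWeight Var.a Var.b = p.weight := fun S h => by
      rw [← S.passportWeight_passport, h, passportWeight]
    have := PlaneTree.finite_colWeight_a_b p.weight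
    have := Finite.of_injective _ (Subtype.impEmbedding _ _ hweight).injective
    rw [finsum_congr hlabel, finsum_const, nsmul_eq_mul, mul_one_div, seqCoeff_mul_seqCoeff,
      div_eq_div_iff]
    · exact_mod_cast hp.card_passport_mul
    · simp [Nat.factorial_ne_zero]
    · simp [Finsupp.prod, Finset.prod_ne_zero_iff, Nat.factorial_ne_zero]
  · have : IsEmpty {S : PlaneTree // S.passport = .inr p} :=
      ⟨fun S => hp (PlaneTree.isAdmissible_of_passport_eq S.2)⟩
    exact finsum_of_isEmpty _

end DegreePair

theorem seriesT_eq_planeTreeSeries : seriesT = planeTreeSeries := by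
  rw [seriesT_eq_genSeries, ← labelledTreeSeries_a_b, labelledTreeSeries]
  refine (genSeries_fiberwise PlaneTree.finite_colWeight_a_b _ PlaneTree.passport
    PlaneTree.passportWeight_passport ?_).symm
  rintro (c | p)
  · exact (PlaneTree.finsum_passport_eq_inl c).symm
  · exact (DegreePair.finsum_passport_eq_inr p).symm

/-! ### Isomorphisms over an inserted edge and disjoint unions -/

section SidePreserving

variable {α β α' β' : Type*}

theorem exists_eq_optionCongr (h : Option α ≃ Option β) (h₀ : h none = none) :
    ∃ h', h = Equiv.optionCongr h' := by
  refine ⟨Equiv.removeNone h, Equiv.ext fun x => ?_⟩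
  cases x with
  | none => simpa using h₀
  | some a =>
    have ha : ∃ b, h (some a) = some b := by
      rw [← Option.ne_none_iff_exists', ← h₀]
      exact h.injective.ne (Option.some_ne_none a)
    rw [Equiv.optionCongr_apply, Option.map_some, Equiv.removeNone_some h ha]

theorem exists_eq_sumMap {f : α ⊕ β → α' ⊕ β'} (hf : ∀ x, (f x).isLeft = x.isLeft) :
    ∃ f₁ f₂, f = Sum.map f₁ f₂ := by
  choose f₁ hf₁ using fun a => Sum.isLeft_iff.1 (hf (.inl a))
  choose f₂ hf₂ using fun b => Sum.isRight_iff.1 (Sum.isLeft_eq_false.1 (hf (.inr b)))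
  exact ⟨f₁, f₂, funext fun x => by cases x <;> simp [hf₁, hf₂]⟩

theorem exists_eq_sumCongr (φ : α ⊕ β ≃ α' ⊕ β') (h : ∀ x, (φ x).isLeft = x.isLeft) :
    ∃ φ₁ φ₂, φ = Equiv.sumCongr φ₁ φ₂ := by
  obtain ⟨f₁, f₂, hf⟩ := exists_eq_sumMap h
  obtain ⟨g₁, g₂, hg⟩ := exists_eq_sumMap (f := φ.symm) fun x => by
    rw [← h, Equiv.apply_symm_apply]
  have hgf : ∀ x, Sum.map g₁ g₂ (Sum.map f₁ f₂ x) = x := fun x => by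
    rw [← hf, ← hg, φ.symm_apply_apply]
  have hfg : ∀ x, Sum.map f₁ f₂ (Sum.map g₁ g₂ x) = x := fun x => by
    rw [← hf, ← hg, φ.apply_symm_apply]
  exact ⟨⟨f₁, g₁, fun x => Sum.inl_injective (hgf (.inl x)),
      fun x => Sum.inl_injective (hfg (.inl x))⟩,
    ⟨f₂, g₂, fun x => Sum.inr_injective (hgf (.inr x)),
      fun x => Sum.inr_injective (hfg (.inr x))⟩, Equiv.ext (congrFun hf)⟩

end SidePreserving

namespace BMap

variable {W B E W' B' E' W₁ B₁ E₁ W₂ B₂ E₂ W₁' B₁' E₁' W₂' B₂' E₂' : Type}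

section InsertEdge

variable {m : BMap W B E} {m' : BMap W' B' E'} {u : W} {v : B} {c d : Option E} {u' : W'} {v' : B'}
  {c' d' : Option E'} {hu : IsCornerAt m.atW u c} {hv : IsCornerAt m.atB v d}
  {hu' : IsCornerAt m'.atW u' c'} {hv' : IsCornerAt m'.atB v' d'}

/-- The extension of an isomorphism over an inserted edge. -/
def Iso.insertEdge (φ : Iso m m') (h_u : φ.onW u = u') (h_v : φ.onB v = v')
    (h_c : c.map φ.onE = c') (h_d : d.map φ.onE = d') :
    Iso (m.insertEdge hu hv) (m'.insertEdge hu' hv') where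
  onW := φ.onW
  onB := φ.onB
  onE := Equiv.optionCongr φ.onE
  map_atW := Option.forall.2 ⟨h_u, φ.map_atW⟩
  map_atB := Option.forall.2 ⟨h_v, φ.map_atB⟩
  map_rotW := (insertNone_semiconj_iff φ.onE.injective).2 ⟨h_c, φ.map_rotW⟩
  map_rotB := (insertNone_semiconj_iff φ.onE.injective).2 ⟨h_d, φ.map_rotB⟩

theorem Iso.exists_of_insertEdge (φ : Iso (m.insertEdge hu hv) (m'.insertEdge hu' hv'))
    (hφ : φ.onE none = none) :
    ∃ ψ : Iso m m', ψ.onW u = u' ∧ ψ.onB v = v' ∧ c.map ψ.onE = c' ∧ d.map ψ.onE = d' := by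
  obtain ⟨f, g, h, hatW, hatB, hrotW, hrotB⟩ := φ
  obtain ⟨h, rfl⟩ := exists_eq_optionCongr h hφ
  obtain ⟨h_u, hatW⟩ := Option.forall.1 hatW
  obtain ⟨h_v, hatB⟩ := Option.forall.1 hatB
  obtain ⟨h_c, hrotW⟩ := (insertNone_semiconj_iff h.injective).1 hrotW
  obtain ⟨h_d, hrotB⟩ := (insertNone_semiconj_iff h.injective).1 hrotB
  exact ⟨⟨f, g, h, hatW, hatB, hrotW, hrotB⟩, h_u, h_v, h_c, h_d⟩

end InsertEdge

theorem exists_iso_option (m : BMap W B E) (e : E) :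
    ∃ (m' : BMap W B (Option {x // x ≠ e})) (φ : Iso m m'), φ.onE e = none := by
  classical
  exact ⟨_, m.relabelIso (Equiv.refl W) (Equiv.refl B) (Equiv.optionSubtypeNe e).symm,
    Equiv.optionSubtypeNe_symm_self e⟩

/-- The disjoint union of two maps. -/
def sum (m₁ : BMap W₁ B₁ E₁) (m₂ : BMap W₂ B₂ E₂) : BMap (W₁ ⊕ W₂) (B₁ ⊕ B₂) (E₁ ⊕ E₂) where
  atW := Sum.map m₁.atW m₂.atW
  atB := Sum.map m₁.atB m₂.atB
  rotW := Equiv.sumCongr m₁.rotW m₂.rotW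
  rotB := Equiv.sumCongr m₁.rotB m₂.rotB
  atW_eq_iff := by
    rintro (e | e) (e' | e')
    · simp [sameCycle_sumCongr_inl_inl, m₁.atW_eq_iff]
    · simp [not_sameCycle_sumCongr_inl_inr]
    · rw [Equiv.Perm.sameCycle_comm]
      simp [not_sameCycle_sumCongr_inl_inr]
    · simp [sameCycle_sumCongr_inr_inr, m₂.atW_eq_iff]
  atB_eq_iff := by
    rintro (e | e) (e' | e')
    · simp [sameCycle_sumCongr_inl_inl, m₁.atB_eq_iff]
    · simp [not_sameCycle_sumCongr_inl_inr]
    · rw [Equiv.Perm.sameCycle_comm]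
      simp [not_sameCycle_sumCongr_inl_inr]
    · simp [sameCycle_sumCongr_inr_inr, m₂.atB_eq_iff]

theorem isLeft_atW_sum (m₁ : BMap W₁ B₁ E₁) (m₂ : BMap W₂ B₂ E₂) (e : E₁ ⊕ E₂) :
    ((m₁.sum m₂).atW e).isLeft = e.isLeft := by
  cases e <;> rfl

theorem isLeft_atB_sum (m₁ : BMap W₁ B₁ E₁) (m₂ : BMap W₂ B₂ E₂) (e : E₁ ⊕ E₂) :
    ((m₁.sum m₂).atB e).isLeft = e.isLeft :=
  isLeft_atW_sum m₁.swap m₂.swap e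

theorem exists_eq_sum {m : BMap (W₁ ⊕ W₂) (B₁ ⊕ B₂) (E₁ ⊕ E₂)}
    (hW : ∀ e, (m.atW e).isLeft = e.isLeft) (hB : ∀ e, (m.atB e).isLeft = e.isLeft) :
    ∃ m₁ m₂, m = sum m₁ m₂ := by
  have hrotW : ∀ e, (m.rotW e).isLeft = e.isLeft := fun e => by rw [← hW, m.atW_rotW, hW]
  have hrotB : ∀ e, (m.rotB e).isLeft = e.isLeft := fun e => by rw [← hB, m.atB_rotB, hB]
  obtain ⟨atW, atB, rotW, rotB, hatW, hatB⟩ := m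
  obtain ⟨f₁, f₂, rfl⟩ := exists_eq_sumMap hW
  obtain ⟨g₁, g₂, rfl⟩ := exists_eq_sumMap hB
  obtain ⟨σ₁, σ₂, rfl⟩ := exists_eq_sumCongr rotW hrotW
  obtain ⟨τ₁, τ₂, rfl⟩ := exists_eq_sumCongr rotB hrotB
  refine ⟨⟨f₁, g₁, σ₁, τ₁, fun e e' => ?_, fun e e' => ?_⟩,
    ⟨f₂, g₂, σ₂, τ₂, fun e e' => ?_, fun e e' => ?_⟩, rfl⟩
  · simpa [sameCycle_sumCongr_inl_inl] using hatW (.inl e) (.inl e')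
  · simpa [sameCycle_sumCongr_inl_inl] using hatB (.inl e) (.inl e')
  · simpa [sameCycle_sumCongr_inr_inr] using hatW (.inr e) (.inr e')
  · simpa [sameCycle_sumCongr_inr_inr] using hatB (.inr e) (.inr e')

section Sum

variable {m₁ : BMap W₁ B₁ E₁} {m₂ : BMap W₂ B₂ E₂} {m₁' : BMap W₁' B₁' E₁'}
  {m₂' : BMap W₂' B₂' E₂'}

/-- The disjoint union of two isomorphisms. -/
def Iso.sum (φ₁ : Iso m₁ m₁') (φ₂ : Iso m₂ m₂') : Iso (m₁.sum m₂) (m₁'.sum m₂') where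
  onW := Equiv.sumCongr φ₁.onW φ₂.onW
  onB := Equiv.sumCongr φ₁.onB φ₂.onB
  onE := Equiv.sumCongr φ₁.onE φ₂.onE
  map_atW := Sum.forall.2 ⟨fun e => congrArg _ (φ₁.map_atW e), fun e => congrArg _ (φ₂.map_atW e)⟩
  map_atB := Sum.forall.2 ⟨fun e => congrArg _ (φ₁.map_atB e), fun e => congrArg _ (φ₂.map_atB e)⟩
  map_rotW :=
    Sum.forall.2 ⟨fun e => congrArg _ (φ₁.map_rotW e), fun e => congrArg _ (φ₂.map_rotW e)⟩
  map_rotB :=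
    Sum.forall.2 ⟨fun e => congrArg _ (φ₁.map_rotB e), fun e => congrArg _ (φ₂.map_rotB e)⟩

theorem Iso.exists_eq_sum {φ : Iso (m₁.sum m₂) (m₁'.sum m₂')}
    (hW : ∀ w, (φ.onW w).isLeft = w.isLeft) (hB : ∀ b, (φ.onB b).isLeft = b.isLeft) :
    ∃ φ₁ φ₂, φ = Iso.sum φ₁ φ₂ := by
  have hE : ∀ e, (φ.onE e).isLeft = e.isLeft := fun e => by
    rw [← isLeft_atW_sum m₁' m₂', ← φ.map_atW, hW, isLeft_atW_sum]
  obtain ⟨onW, onB, onE, hatW, hatB, hrotW, hrotB⟩ := φ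
  obtain ⟨f₁, f₂, rfl⟩ := exists_eq_sumCongr onW hW
  obtain ⟨g₁, g₂, rfl⟩ := exists_eq_sumCongr onB hB
  obtain ⟨h₁, h₂, rfl⟩ := exists_eq_sumCongr onE hE
  exact ⟨⟨f₁, g₁, h₁, fun e => Sum.inl_injective (hatW (.inl e)),
      fun e => Sum.inl_injective (hatB (.inl e)), fun e => Sum.inl_injective (hrotW (.inl e)),
      fun e => Sum.inl_injective (hrotB (.inl e))⟩,
    ⟨f₂, g₂, h₂, fun e => Sum.inr_injective (hatW (.inr e)),
      fun e => Sum.inr_injective (hatB (.inr e)), fun e => Sum.inr_injective (hrotW (.inr e)),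
      fun e => Sum.inr_injective (hrotB (.inr e))⟩, rfl⟩

theorem Iso.isLeft_eq_of_conn (φ : Iso (m₁.sum m₂) (m₁'.sum m₂')) (h₁ : m₁.Conn) (h₂ : m₂.Conn)
    {u : W₁} {u' : W₁'} (hu : φ.onW (.inl u) = .inl u') {v : B₂} {v' : B₂'}
    (hv : φ.onB (.inr v) = .inr v') :
    (∀ w, (φ.onW w).isLeft = w.isLeft) ∧ ∀ b, (φ.onB b).isLeft = b.isLeft := by
  have hside : ∀ e, (φ.onW ((m₁.sum m₂).atW e)).isLeft = (φ.onB ((m₁.sum m₂).atB e)).isLeft :=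
    fun e => by rw [φ.map_atW, φ.map_atB, isLeft_atW_sum, isLeft_atB_sum]
  have hleft := h₁.2 (Sum.elim (fun w => (φ.onW (.inl w)).isLeft = true)
    fun b => (φ.onB (.inl b)).isLeft = true) (fun e => (hside (.inl e)).congr_left) (.inl u)
  have hright := h₂.2 (Sum.elim (fun w => (φ.onW (.inr w)).isLeft = false)
    fun b => (φ.onB (.inr b)).isLeft = false) (fun e => (hside (.inr e)).congr_left) (.inr v)
  have hu' : (φ.onW (.inl u)).isLeft = true := by rw [hu, Sum.isLeft_inl]
  have hv' : (φ.onB (.inr v)).isLeft = false := by rw [hv, Sum.isLeft_inr]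
  exact ⟨Sum.forall.2 ⟨fun w => hleft (.inl w) hu', fun w => hright (.inl w) hv'⟩,
    Sum.forall.2 ⟨fun b => hleft (.inr b) hu', fun b => hright (.inr b) hv'⟩⟩

end Sum

end BMap

/-! ### Joining two maps by an edge -/

section Corners

variable {E₁ E₂ W₁ W₂ : Type*} {f₁ : E₁ → W₁} {f₂ : E₂ → W₂}

theorem isCornerAt_inl_iff {u : W₁} {c : Option E₁} :
    IsCornerAt (Sum.map f₁ f₂) (.inl u) (c.map .inl) ↔ IsCornerAt f₁ u c := by
  cases c <;> simp [isCornerAt_none, isCornerAt_some]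

theorem isCornerAt_inr_iff {u : W₂} {c : Option E₂} :
    IsCornerAt (Sum.map f₁ f₂) (.inr u) (c.map .inr) ↔ IsCornerAt f₂ u c := by
  cases c <;> simp [isCornerAt_none, isCornerAt_some]

theorem IsCornerAt.exists_eq_map_inl {u : W₁} {c : Option (E₁ ⊕ E₂)}
    (h : IsCornerAt (Sum.map f₁ f₂) (.inl u) c) : ∃ c₁ : Option E₁, c = c₁.map .inl := by
  rcases c with _ | e | e
  · exact ⟨none, rfl⟩
  · exact ⟨some e, rfl⟩
  · simp [isCornerAt_some] at h

theorem IsCornerAt.exists_eq_map_inr {u : W₂} {c : Option (E₁ ⊕ E₂)}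
    (h : IsCornerAt (Sum.map f₁ f₂) (.inr u) c) : ∃ c₂ : Option E₂, c = c₂.map .inr := by
  rcases c with _ | e | e
  · exact ⟨none, rfl⟩
  · simp [isCornerAt_some] at h
  · exact ⟨some e, rfl⟩

end Corners

namespace BMap

variable {W₁ B₁ E₁ W₂ B₂ E₂ W₁' B₁' E₁' W₂' B₂' E₂' : Type}
  {m₁ : BMap W₁ B₁ E₁} {m₂ : BMap W₂ B₂ E₂} {u : W₁} {c : Option E₁} {v : B₂} {d : Option E₂}
  {m₁' : BMap W₁' B₁' E₁'} {m₂' : BMap W₂' B₂' E₂'} {u' : W₁'} {c' : Option E₁'} {v' : B₂'}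
  {d' : Option E₂'}

/-- The map obtained by joining a white corner of `m₁` to a black corner of `m₂` by a new edge
`none`. -/
noncomputable def joinCorners (m₁ : BMap W₁ B₁ E₁) (m₂ : BMap W₂ B₂ E₂)
    (hu : IsCornerAt m₁.atW u c) (hv : IsCornerAt m₂.atB v d) :
    BMap (W₁ ⊕ W₂) (B₁ ⊕ B₂) (Option (E₁ ⊕ E₂)) :=
  (m₁.sum m₂).insertEdge (isCornerAt_inl_iff.2 hu) (isCornerAt_inr_iff.2 hv)

theorem conn_joinCorners_iff (hu : IsCornerAt m₁.atW u c) (hv : IsCornerAt m₂.atB v d) :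
    (joinCorners m₁ m₂ hu hv).Conn ↔ m₁.Conn ∧ m₂.Conn := by
  refine (conn_insertEdge_iff _ _).trans ⟨?_, ?_⟩
  · intro h
    refine ⟨⟨⟨.inl u⟩, fun P hP x y => ?_⟩, ⟨⟨.inr v⟩, fun P hP x y => ?_⟩⟩
    · have := h (Sum.elim (Sum.elim (fun w => P (.inl w)) fun _ => P (.inl u))
        (Sum.elim (fun b => P (.inr b)) fun _ => P (.inl u)))
        (Sum.forall.2 ⟨hP, fun _ => Iff.rfl⟩) Iff.rfl (x.map .inl .inl) (y.map .inl .inl)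
      cases x <;> cases y <;> exact this
    · have := h (Sum.elim (Sum.elim (fun _ => P (.inr v)) fun w => P (.inl w))
        (Sum.elim (fun _ => P (.inr v)) fun b => P (.inr b)))
        (Sum.forall.2 ⟨fun _ => Iff.rfl, hP⟩) Iff.rfl (x.map .inr .inr) (y.map .inr .inr)
      cases x <;> cases y <;> exact this
  · rintro ⟨h₁, h₂⟩ P hP huv
    have hP₁ := h₁.2 (fun x => P (x.map .inl .inl)) fun e => hP (.inl e)
    have hP₂ := h₂.2 (fun x => P (x.map .inr .inr)) fun e => hP (.inr e)
    have hPu : ∀ x, P x ↔ P (.inl (.inl u)) := by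
      rintro ((x | x) | (x | x))
      · exact ⟨hP₁ (.inl x) (.inl u), hP₁ (.inl u) (.inl x)⟩
      · exact .trans ⟨hP₂ (.inl x) (.inr v), hP₂ (.inr v) (.inl x)⟩ huv.symm
      · exact ⟨hP₁ (.inr x) (.inl u), hP₁ (.inl u) (.inr x)⟩
      · exact .trans ⟨hP₂ (.inr x) (.inr v), hP₂ (.inr v) (.inr x)⟩ huv.symm
    exact fun x y hx => (hPu y).2 ((hPu x).1 hx)

theorem isTree_joinCorners_iff [Finite W₁] [Finite B₁] [Finite E₁] [Finite W₂] [Finite B₂]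
    [Finite E₂] (hu : IsCornerAt m₁.atW u c) (hv : IsCornerAt m₂.atB v d) :
    (joinCorners m₁ m₂ hu hv).IsTree ↔ m₁.IsTree ∧ m₂.IsTree := by
  simp only [IsTree, conn_joinCorners_iff, Finite.card_option, Nat.card_sum]
  constructor
  · rintro ⟨⟨h₁, h₂⟩, hcard⟩
    have hle₁ := h₁.card_le
    have hle₂ := h₂.card_le
    exact ⟨⟨h₁, by omega⟩, ⟨h₂, by omega⟩⟩
  · rintro ⟨⟨h₁, hcard₁⟩, ⟨h₂, hcard₂⟩⟩
    exact ⟨⟨h₁, h₂⟩, by omega⟩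

variable {hu : IsCornerAt m₁.atW u c} {hv : IsCornerAt m₂.atB v d}
  {hu' : IsCornerAt m₁'.atW u' c'} {hv' : IsCornerAt m₂'.atB v' d'}

/-- The isomorphism of joined maps that consists of isomorphisms of the parts. -/
def Iso.joinCorners (φ₁ : Iso m₁ m₁') (φ₂ : Iso m₂ m₂')
    (h_u : φ₁.onW u = u') (h_c : c.map φ₁.onE = c') (h_v : φ₂.onB v = v')
    (h_d : d.map φ₂.onE = d') :
    Iso (BMap.joinCorners m₁ m₂ hu hv) (BMap.joinCorners m₁' m₂' hu' hv') :=
  (φ₁.sum φ₂).insertEdge (congrArg Sum.inl h_u) (congrArg Sum.inr h_v)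
    (by subst h_c; cases c <;> rfl) (by subst h_d; cases d <;> rfl)

theorem Iso.exists_of_joinCorners (h₁ : m₁.Conn) (h₂ : m₂.Conn)
    (φ : Iso (BMap.joinCorners m₁ m₂ hu hv) (BMap.joinCorners m₁' m₂' hu' hv'))
    (hφ : φ.onE none = none) :
    (∃ φ₁ : Iso m₁ m₁', φ₁.onW u = u' ∧ c.map φ₁.onE = c') ∧
      ∃ φ₂ : Iso m₂ m₂', φ₂.onB v = v' ∧ d.map φ₂.onE = d' := by
  obtain ⟨ψ, h_u, h_v, h_c, h_d⟩ := φ.exists_of_insertEdge hφ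
  obtain ⟨hW, hB⟩ := ψ.isLeft_eq_of_conn h₁ h₂ h_u h_v
  obtain ⟨φ₁, φ₂, rfl⟩ := Iso.exists_eq_sum hW hB
  refine ⟨⟨φ₁, Sum.inl_injective h_u, Option.map_injective Sum.inl_injective (.trans ?_ h_c)⟩,
    ⟨φ₂, Sum.inr_injective h_v, Option.map_injective Sum.inr_injective (.trans ?_ h_d)⟩⟩
  · cases c <;> rfl
  · cases d <;> rfl

end BMap

/-! ### Cutting a tree at an edge -/

theorem exists_equiv_sum_fin {α : Type*} [Finite α] (R : α → Prop) :
    ∃ (p q : ℕ) (f : α ≃ Fin p ⊕ Fin q), ∀ a, (f a).isLeft = true ↔ R a := by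
  classical
  refine ⟨_, _, (Equiv.sumCompl R).symm.trans (Equiv.sumCongr (Finite.equivFin {a // R a})
    (Finite.equivFin {a // ¬ R a})), fun a => ?_⟩
  by_cases h : R a
  · simp [Equiv.sumCompl_symm_apply_of_pos h, h]
  · simp [Equiv.sumCompl_symm_apply_of_neg h, h]

namespace BMap

variable {W B E : Type} [Finite W] [Finite B] [Finite E] {m : BMap W B E}

theorem exists_iso_sum {R : W ⊕ B → Prop} (hR : ∀ e, R (.inl (m.atW e)) ↔ R (.inr (m.atB e))) :
    ∃ (p₁ p₂ q₁ q₂ n₁ n₂ : ℕ) (m₁ : BMap (Fin p₁) (Fin q₁) (Fin n₁))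
      (m₂ : BMap (Fin p₂) (Fin q₂) (Fin n₂)) (φ : Iso m (m₁.sum m₂)),
      (∀ w, (φ.onW w).isLeft = true ↔ R (.inl w)) ∧
        ∀ b, (φ.onB b).isLeft = true ↔ R (.inr b) := by
  obtain ⟨p₁, p₂, f, hf⟩ := exists_equiv_sum_fin fun w => R (.inl w)
  obtain ⟨q₁, q₂, g, hg⟩ := exists_equiv_sum_fin fun b => R (.inr b)
  obtain ⟨n₁, n₂, h, hh⟩ := exists_equiv_sum_fin fun e => R (.inl (m.atW e))
  obtain ⟨m', φ, hφW, hφB, hφE⟩ : ∃ (m' : BMap (Fin p₁ ⊕ Fin p₂) (Fin q₁ ⊕ Fin q₂)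
      (Fin n₁ ⊕ Fin n₂)) (φ : Iso m m'), (∀ w, (φ.onW w).isLeft = true ↔ R (.inl w)) ∧
      (∀ b, (φ.onB b).isLeft = true ↔ R (.inr b)) ∧
      ∀ e, (φ.onE e).isLeft = true ↔ R (.inl (m.atW e)) :=
    ⟨_, m.relabelIso f g h, hf, hg, hh⟩
  obtain ⟨m₁, m₂, rfl⟩ : ∃ m₁ m₂, m' = BMap.sum m₁ m₂ := by
    refine exists_eq_sum ?_ ?_ <;> refine φ.onE.surjective.forall.2 fun e => ?_ <;>
      rw [Bool.eq_iff_iff, hφE]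
    · rw [← φ.map_atW, hφW]
    · rw [← φ.map_atB, hφB, hR]
  exact ⟨p₁, p₂, q₁, q₂, n₁, n₂, m₁, m₂, φ, hφW, hφB⟩

theorem IsTree.exists_separating {u : W} {c : Option E} {v : B} {d : Option E}
    {hu : IsCornerAt m.atW u c} {hv : IsCornerAt m.atB v d} (h : (m.insertEdge hu hv).IsTree) :
    ∃ R : W ⊕ B → Prop, (∀ e, R (.inl (m.atW e)) ↔ R (.inr (m.atB e))) ∧
      R (.inl u) ∧ ¬ R (.inr v) := by
  by_contra! hR
  have hconn : m.Conn := ⟨⟨.inl u⟩, fun P hP => (conn_insertEdge_iff hu hv).1 h.1 P hP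
    ⟨hR P hP, fun hPv => of_not_not fun hPu =>
      hR (fun x => ¬ P x) (fun e => not_congr (hP e)) hPu hPv⟩⟩
  have hle := hconn.card_le
  have hcard := h.2
  rw [Finite.card_option] at hcard
  omega

end BMap

/-- The map obtained by joining the root of `S` to the root of `T` by a new edge `none`, after the
colours of `T` have been interchanged. -/
noncomputable def CornerTree.join (S T : CornerTree) : BMap (Fin S.1.nW ⊕ Fin T.1.nB)
    (Fin S.1.nB ⊕ Fin T.1.nW) (Option (Fin S.1.nE ⊕ Fin T.1.nE)) :=
  S.1.map.joinCorners T.1.map.swap S.2.2 T.2.2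

theorem CornerTree.isTree_join (S T : CornerTree) : (S.join T).IsTree :=
  (BMap.isTree_joinCorners_iff _ _).2 ⟨S.1.isTree, T.1.isTree.swap⟩

namespace BMap

variable {W B E : Type} [Finite W] [Finite B] [Finite E]

theorem IsTree.exists_iso_join_of_option {m : BMap W B (Option E)} (hm : m.IsTree) :
    ∃ (S T : CornerTree) (φ : Iso m (S.join T)), φ.onE none = none := by
  obtain ⟨m, u, c, v, d, hu, hv, rfl⟩ := m.exists_eq_insertEdge
  obtain ⟨R, hR, hRu, hRv⟩ := hm.exists_separating
  obtain ⟨p₁, p₂, q₁, q₂, n₁, n₂, m₁, m₂, φ, hφW, hφB⟩ := exists_iso_sum hR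
  obtain ⟨u₁, hu₁⟩ := Sum.isLeft_iff.1 ((hφW u).2 hRu)
  obtain ⟨v₂, hv₂⟩ := Sum.isRight_iff.1
    (Sum.isLeft_eq_false.1 (Bool.eq_false_iff.2 (mt (hφB v).1 hRv)))
  have hφu : IsCornerAt (m₁.sum m₂).atW (.inl u₁) (c.map φ.onE) := hu₁ ▸ φ.isCornerAt_atW hu
  have hφv : IsCornerAt (m₁.sum m₂).atB (.inr v₂) (d.map φ.onE) := hv₂ ▸ φ.swap.isCornerAt_atW hv
  obtain ⟨c₁, hc₁⟩ := hφu.exists_eq_map_inl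
  obtain ⟨d₂, hd₂⟩ := hφv.exists_eq_map_inr
  have hc : IsCornerAt m₁.atW u₁ c₁ := isCornerAt_inl_iff.1 (hc₁ ▸ hφu)
  have hd : IsCornerAt m₂.atB v₂ d₂ := isCornerAt_inr_iff.1 (hd₂ ▸ hφv)
  let ψ : Iso (m.insertEdge hu hv) (m₁.joinCorners m₂ hc hd) := φ.insertEdge hu₁ hv₂ hc₁ hd₂
  obtain ⟨hm₁, hm₂⟩ := (isTree_joinCorners_iff hc hd).1 (ψ.isTree hm)
  exact ⟨⟨PlaneTree.ofIsTree m₁ hm₁, (u₁, c₁), hc⟩,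
    ⟨PlaneTree.ofIsTree m₂.swap hm₂.swap, (v₂, d₂), hd⟩, ψ, rfl⟩

theorem IsTree.exists_iso_join {m : BMap W B E} (hm : m.IsTree) (i : E) :
    ∃ (S T : CornerTree) (φ : Iso m (S.join T)), φ.onE i = none := by
  obtain ⟨m', φ, hφ⟩ := m.exists_iso_option i
  obtain ⟨S, T, ψ, hψ⟩ := (φ.isTree hm).exists_iso_join_of_option
  exact ⟨S, T, φ.trans ψ, (congrArg ψ.onE hφ).trans hψ⟩

end BMap

/-! ### Doubling an edge -/

namespace BMap

variable {W B E W' B' E' : Type} {m : BMap W B E} {m' : BMap W' B' E'}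

/-- The map in which the edge `i` is doubled: the new edge `none` and `i` bound a face of
perimeter 2, on which `none` is the edge that is passed from white to black. -/
noncomputable def doubleEdge (m : BMap W B E) (i : E) : BMap W B (Option E) :=
  m.insertEdge (u := m.atW i) (c := some (m.rotW i)) (v := m.atB i) (d := some i)
    (isCornerAt_some.2 (m.atW_rotW i)) (isCornerAt_some.2 rfl)

theorem facePerm_doubleEdge_none (m : BMap W B E) (i : E) :
    (m.doubleEdge i).facePerm none = none := by
  change insertNone (some (m.rotW i)) m.rotW (insertNone (some i) m.rotB none) = none
  rw [insertNone_apply_none, insertNone_apply_some, if_pos rfl]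

theorem facePerm_doubleEdge_some (m : BMap W B E) (i e : E) :
    (m.doubleEdge i).facePerm (some e) = some (m.facePerm e) := by
  change insertNone (some (m.rotW i)) m.rotW (insertNone (some i) m.rotB (some e)) =
    some (m.rotW (m.rotB e))
  by_cases he : m.rotB e = i
  · rw [insertNone_apply_some, if_pos (congrArg some he), insertNone_apply_none, he]
  · rw [insertNone_apply_some, if_neg (by simpa using he), insertNone_apply_some,
      if_neg (by simpa using he)]

theorem sameCycle_doubleEdge (i : E) {e e' : E} (h : m.facePerm.SameCycle e e') :
    (m.doubleEdge i).facePerm.SameCycle (some e) (some e') := by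
  rw [sameCycle_iff_forall] at h ⊢
  exact fun P hP => h (fun e => P (some e)) fun e => by rw [← facePerm_doubleEdge_some, hP]

theorem conn_doubleEdge_iff {i : E} : (m.doubleEdge i).Conn ↔ m.Conn := by
  refine (conn_insertEdge_iff _ _).trans ⟨fun h => ?_, fun h P hP _ => h.2 P hP⟩
  exact ⟨⟨.inl (m.atW i)⟩, fun P hP => h P hP (hP i)⟩

/-- The extension of an isomorphism over doubled edges. -/
def Iso.doubleEdge (φ : Iso m m') {i : E} {i' : E'} (h : φ.onE i = i') :
    Iso (BMap.doubleEdge m i) (BMap.doubleEdge m' i') :=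
  φ.insertEdge (by rw [φ.map_atW, h]) (by rw [φ.map_atB, h])
    (by rw [Option.map_some, φ.map_rotW, h]) (by rw [Option.map_some, h])

theorem Iso.exists_of_doubleEdge {i : E} {i' : E'}
    (φ : Iso (BMap.doubleEdge m i) (BMap.doubleEdge m' i')) (hφ : φ.onE none = none) :
    ∃ ψ : Iso m m', ψ.onE i = i' := by
  obtain ⟨ψ, -, -, -, h⟩ := φ.exists_of_insertEdge hφ
  exact ⟨ψ, by simpa using h⟩

theorem not_conn_insertEdge_none_none [Nonempty E] {u : W} {v : B}
    {hu : IsCornerAt m.atW u none} {hv : IsCornerAt m.atB v none} :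
    ¬ (m.insertEdge hu hv).Conn := by
  intro h
  obtain ⟨e⟩ := ‹Nonempty E›
  have hu' := isCornerAt_none.1 hu
  have hv' := isCornerAt_none.1 hv
  have := (conn_insertEdge_iff hu hv).1 h (fun x => x = .inl u ∨ x = .inr v)
    (fun e => by simp [hu' e, hv' e]) (by simp) (.inl u) (.inl (m.atW e)) (Or.inl rfl)
  simp [hu' e] at this

theorem Conn.exists_eq_doubleEdge [Nonempty E] {m : BMap W B (Option E)} (hm : m.Conn)
    (h : m.facePerm none = none) : ∃ (m' : BMap W B E) (i : E), m = m'.doubleEdge i := by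
  obtain ⟨m, u, c, v, d, hu, hv, rfl⟩ := m.exists_eq_insertEdge
  change insertNone c m.rotW (insertNone d m.rotB none) = none at h
  rw [insertNone_apply_none] at h
  cases d with
  | none =>
    obtain rfl : c = none := by rwa [insertNone_apply_none] at h
    exact absurd hm not_conn_insertEdge_none_none
  | some i =>
    obtain rfl : some (m.rotW i) = c := by
      by_contra hc
      simp [insertNone_apply_some, hc] at h
    obtain rfl : u = m.atW i := by rw [← isCornerAt_some.1 hu, m.atW_rotW]
    obtain rfl : m.atB i = v := isCornerAt_some.1 hv
    exact ⟨m, i, rfl⟩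

theorem Conn.exists_iso_doubleEdge (hm : m.Conn) {e : E} (he : m.facePerm e = e)
    (hne : ∃ e', e' ≠ e) : ∃ (m' : BMap W B {x // x ≠ e}) (i : {x // x ≠ e})
      (φ : Iso m (m'.doubleEdge i)), φ.onE e = none := by
  have : Nonempty {x // x ≠ e} := nonempty_subtype.2 hne
  obtain ⟨m₁, φ, hφ⟩ := m.exists_iso_option e
  obtain ⟨m', i, rfl⟩ := (φ.conn hm).exists_eq_doubleEdge (by
    rw [← hφ, ← φ.map_facePerm, he])
  exact ⟨m', i, φ, hφ⟩

end BMap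

/-! ### Gluing two rooted trees into a `2^1`-map -/

section Fibers

variable {α β γ δ : Type*} (f : α → γ) (g : β → δ)

theorem card_sumMap_fiber_inl (c : γ) :
    Nat.card {x // Sum.map f g x = .inl c} = Nat.card {x // f x = c} := by
  refine (Nat.card_congr (Equiv.ofBijective
    (fun x : {x // f x = c} => ⟨.inl x.1, congrArg Sum.inl x.2⟩) ⟨fun x y h => ?_, ?_⟩)).symm
  · exact Subtype.ext (Sum.inl_injective (congrArg Subtype.val h))
  · rintro ⟨x | x, h⟩
    · exact ⟨⟨x, Sum.inl_injective h⟩, rfl⟩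
    · simp at h

theorem card_sumMap_fiber_inr (d : δ) :
    Nat.card {x // Sum.map f g x = .inr d} = Nat.card {x // g x = d} := by
  rw [← card_sumMap_fiber_inl g f d]
  refine Nat.card_congr ((Equiv.sumComm α β).subtypeEquiv ?_)
  rintro (x | x) <;> simp

end Fibers

namespace BMap

section Degrees

variable {W₁ B₁ E₁ W₂ B₂ E₂ : Type} [Finite E₁] [Finite E₂] {m₁ : BMap W₁ B₁ E₁}
  {m₂ : BMap W₂ B₂ E₂} {u : W₁} {c : Option E₁} {v : B₂} {d : Option E₂}

theorem degW_doubleEdge_joinCorners [DecidableEq W₁] (hu : IsCornerAt m₁.atW u c)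
    (hv : IsCornerAt m₂.atB v d) (w : W₁ ⊕ W₂) :
    ((joinCorners m₁ m₂ hu hv).doubleEdge none).degW w =
      Sum.elim (fun w => m₁.degW w + if u = w then 2 else 0) m₂.degW w := by
  classical
  have hdeg : ((joinCorners m₁ m₂ hu hv).doubleEdge none).degW w =
      (m₁.sum m₂).degW w + (if .inl u = w then 1 else 0) + if .inl u = w then 1 else 0 :=
    (degW_insertEdge _ _ w).trans (congrArg (· + _) (degW_insertEdge _ _ w))
  rw [hdeg]
  rcases w with w | w
  · rw [show (m₁.sum m₂).degW (.inl w) = m₁.degW w from card_sumMap_fiber_inl _ _ w]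
    by_cases h : u = w <;> simp [h]
  · rw [show (m₁.sum m₂).degW (.inr w) = m₂.degW w from card_sumMap_fiber_inr _ _ w]
    simp

theorem degB_doubleEdge_joinCorners [DecidableEq B₂] (hu : IsCornerAt m₁.atW u c)
    (hv : IsCornerAt m₂.atB v d) (b : B₁ ⊕ B₂) :
    ((joinCorners m₁ m₂ hu hv).doubleEdge none).degB b =
      Sum.elim m₁.degB (fun b => m₂.degB b + if v = b then 2 else 0) b := by
  classical
  have hdeg : ((joinCorners m₁ m₂ hu hv).doubleEdge none).degB b =
      (m₁.sum m₂).degB b + (if .inr v = b then 1 else 0) + if .inr v = b then 1 else 0 :=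
    (degB_insertEdge _ _ b).trans (congrArg (· + _) (degB_insertEdge _ _ b))
  rw [hdeg]
  rcases b with b | b
  · rw [show (m₁.sum m₂).degB (.inl b) = m₁.degB b from card_sumMap_fiber_inl _ _ b]
    simp
  · rw [show (m₁.sum m₂).degB (.inr b) = m₂.degB b from card_sumMap_fiber_inr _ _ b]
    by_cases h : v = b <;> simp [h]

end Degrees

variable {W B E W' B' E' : Type} {m : BMap W B E} {m' : BMap W' B' E'} {e e' : E}

theorem Iso.faceOf_eq_iff (φ : Iso m m') (e e' : E) :
    m'.faceOf (φ.onE e) = m'.faceOf (φ.onE e') ↔ m.faceOf e = m.faceOf e' := by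
  rw [BMap.faceOf_eq_iff, BMap.faceOf_eq_iff, φ.sameCycle_facePerm]

theorem perimeter_faceOf_eq_two_iff : m.perimeter (m.faceOf e) = 2 ↔ m.facePerm e = e := by
  rw [perimeter, Nat.mul_eq_left two_ne_zero, Nat.card_eq_one_iff_unique]
  constructor
  · rintro ⟨hsub, -⟩
    have hface : m.faceOf (m.facePerm e) = m.faceOf e :=
      (m.faceOf_eq_iff _ _).2 (Equiv.Perm.sameCycle_apply_left.2 (.refl _ _))
    exact congrArg Subtype.val (hsub.elim ⟨_, hface⟩ ⟨e, rfl⟩)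
  · refine fun he => ⟨⟨fun x y => Subtype.ext ?_⟩, ⟨⟨e, rfl⟩⟩⟩
    exact (((m.faceOf_eq_iff _ _).1 x.2).eq_of_right he).trans
      (((m.faceOf_eq_iff _ _).1 y.2).eq_of_right he).symm

theorem faceOf_eq_faceOf_iff_eq (he : m.facePerm e = e) : m.faceOf e' = m.faceOf e ↔ e' = e :=
  ⟨fun h => ((m.faceOf_eq_iff _ _).1 h).eq_of_right he, congrArg _⟩

theorem card_face_eq_two (h : m.numFaces = 2) : Nat.card m.Face = 2 := by
  unfold numFaces at h
  split_ifs at h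
  · omega
  · exact h

theorem numFaces_eq_two (h : ∀ x, m.faceOf x = m.faceOf e' ↔ x ≠ e) : m.numFaces = 2 := by
  rw [numFaces, if_neg (not_isEmpty_iff.2 ⟨e⟩), Nat.card_eq_two_iff' (m.faceOf e')]
  refine ⟨m.faceOf e, fun he => (h e).1 he rfl, fun f hf => ?_⟩
  obtain ⟨x, rfl⟩ := m.faceOf_surjective f
  rw [Ne, h, not_not] at hf
  rw [hf]

theorem IsTree.faceOf_doubleEdge_eq_iff [Finite W] [Finite B] [Finite E] (hm : m.IsTree) (i : E)
    (x : Option E) :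
    (m.doubleEdge i).faceOf x = (m.doubleEdge i).faceOf (some i) ↔ x ≠ none := by
  cases x with
  | none =>
    rw [eq_comm, faceOf_eq_faceOf_iff_eq (m.facePerm_doubleEdge_none i)]
    simp
  | some x =>
    rw [faceOf_eq_iff]
    exact iff_of_true (sameCycle_doubleEdge i (hm.sameCycle_facePerm x i)) (Option.some_ne_none x)

end BMap

namespace TwoOneMap

/-- `e` is the edge that is passed from white to black on the boundary of the inner face. -/
def IsInner (U : TwoOneMap) (e : Fin U.nE) : Prop := ∀ x, U.map.faceOf x = U.outer ↔ x ≠ e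

theorem exists_isInner (U : TwoOneMap) :
    ∃ e, U.IsInner e ∧ U.map.facePerm e = e ∧ ∃ e', e' ≠ e := by
  obtain ⟨f, hf, huniq⟩ := (Nat.card_eq_two_iff' U.outer).1 (BMap.card_face_eq_two U.twoFaces)
  obtain ⟨e, rfl⟩ := U.map.faceOf_surjective f
  have hfix : U.map.facePerm e = e := BMap.perimeter_faceOf_eq_two_iff.1 (U.perimeter_eq _ hf)
  have he : U.IsInner e := fun x => not_iff_not.1 <| by
    rw [not_not, ← BMap.faceOf_eq_faceOf_iff_eq hfix]
    exact ⟨huniq _, fun hx => hx ▸ hf⟩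
  obtain ⟨e', he'⟩ := U.map.faceOf_surjective U.outer
  exact ⟨e, he, hfix, e', (he e').1 he'⟩

variable {W B E W' B' E' : Type}

theorem equiv_iff_exists_iso {U U' : TwoOneMap} {m : BMap W B E} {m' : BMap W' B' E'} {e : E}
    {e' : E'} {φ : m.Iso U.map} {φ' : m'.Iso U'.map} (he : U.IsInner (φ.onE e))
    (he' : U'.IsInner (φ'.onE e')) : U ≈ U' ↔ ∃ χ : m.Iso m', χ.onE e = e' := by
  constructor
  · rintro ⟨χ, hχ⟩
    refine ⟨φ.trans (χ.trans φ'.symm), φ'.onE.symm_apply_eq.2 ?_⟩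
    by_contra hne
    exact (he _).1 ((hχ _).2 ((he' _).2 hne)) rfl
  · rintro ⟨χ, rfl⟩
    refine ⟨φ.symm.trans (χ.trans φ'), fun x => ?_⟩
    rw [he, he']
    change x ≠ φ.onE e ↔ φ'.onE (χ.onE (φ.onE.symm x)) ≠ φ'.onE (χ.onE e)
    rw [φ'.onE.injective.ne_iff, χ.onE.injective.ne_iff, Ne, Ne, Equiv.symm_apply_eq]

/-- The `2^1`-map whose inner face is the one with the single edge `e` and whose infinite face is
the one of `e'`. -/
def ofFaces {p q n : ℕ} (m : BMap (Fin p) (Fin q) (Fin n)) (hm : m.Conn) (hcard : p + q = n)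
    {e e' : Fin n} (he : m.facePerm e = e) (h : ∀ x, m.faceOf x = m.faceOf e' ↔ x ≠ e) :
    TwoOneMap where
  nW := p
  nB := q
  nE := n
  map := m
  outer := m.faceOf e'
  isPlane := ⟨m.connected_graph_iff.2 hm, by simp [BMap.numFaces_eq_two h, hcard]⟩
  twoFaces := BMap.numFaces_eq_two h
  perimeter_eq f hf := by
    obtain ⟨x, rfl⟩ := m.faceOf_surjective f
    rw [Ne, h, not_not] at hf
    rw [hf, BMap.perimeter_faceOf_eq_two_iff, he]

theorem exists_iso_doubleEdge [Finite W] [Finite B] [Finite E] {m : BMap W B E} (hm : m.IsTree)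
    (i : E) : ∃ (U : TwoOneMap) (φ : (m.doubleEdge i).Iso U.map), U.IsInner (φ.onE none) := by
  let m' := (m.doubleEdge i).relabel (Finite.equivFin W) (Finite.equivFin B)
    (Finite.equivFin (Option E))
  let φ : (m.doubleEdge i).Iso m' := (m.doubleEdge i).relabelIso _ _ _
  have hfix : m'.facePerm (φ.onE none) = φ.onE none := by
    rw [← φ.map_facePerm, m.facePerm_doubleEdge_none]
  have hface : ∀ x, m'.faceOf x = m'.faceOf (φ.onE (some i)) ↔ x ≠ φ.onE none :=
    φ.onE.surjective.forall.2 fun x => by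
      rw [φ.faceOf_eq_iff, hm.faceOf_doubleEdge_eq_iff, φ.onE.injective.ne_iff]
  exact ⟨ofFaces m' (φ.conn (BMap.conn_doubleEdge_iff.2 hm.1))
    (hm.2.trans Finite.card_option.symm) hfix hface, φ, hface⟩

theorem exists_iso_join (U : TwoOneMap) : ∃ (S T : CornerTree)
    (φ : ((S.join T).doubleEdge none).Iso U.map), U.IsInner (φ.onE none) := by
  obtain ⟨e, he, hfix, hne⟩ := U.exists_isInner
  have hconn : U.map.Conn := U.map.connected_graph_iff.1 U.isPlane.1
  obtain ⟨m, i, φ, hφ⟩ := hconn.exists_iso_doubleEdge hfix hne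
  have hm : m.IsTree := by
    have hcard := U.isPlane.2
    rw [U.twoFaces, Nat.card_congr φ.onE, Finite.card_option] at hcard
    exact ⟨BMap.conn_doubleEdge_iff.1 (φ.conn hconn), by omega⟩
  obtain ⟨S, T, ψ, hψ⟩ := hm.exists_iso_join i
  refine ⟨S, T, (φ.trans (ψ.doubleEdge hψ)).symm, ?_⟩
  rwa [show (φ.trans (ψ.doubleEdge hψ)).symm.onE none = e from
    (Equiv.symm_apply_eq _).2 (congrArg (ψ.doubleEdge hψ).onE hφ).symm]

/-- The `2^1`-map obtained by joining the roots of two rooted trees by a doubled edge. -/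
noncomputable def glue (S T : CornerTree) : TwoOneMap :=
  (exists_iso_doubleEdge (S.isTree_join T) none).choose

/-- The isomorphism from the join with doubled joining edge to the glued map, in which the vertices
and edges are numbered. -/
noncomputable def glueIso (S T : CornerTree) : ((S.join T).doubleEdge none).Iso (glue S T).map :=
  (exists_iso_doubleEdge (S.isTree_join T) none).choose_spec.choose

theorem isInner_glue (S T : CornerTree) : (glue S T).IsInner ((glueIso S T).onE none) :=
  (exists_iso_doubleEdge (S.isTree_join T) none).choose_spec.choose_spec

theorem glue_equiv_glue_iff {S S' T T' : CornerTree} :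
    glue S T ≈ glue S' T' ↔ S ≈ S' ∧ T ≈ T' := by
  rw [equiv_iff_exists_iso (isInner_glue S T) (isInner_glue S' T')]
  constructor
  · rintro ⟨φ, hφ⟩
    obtain ⟨ψ, hψ⟩ := φ.exists_of_doubleEdge hφ
    obtain ⟨⟨χ₁, hχ₁⟩, ⟨χ₂, hχ₂⟩⟩ := ψ.exists_of_joinCorners S.1.isTree.1 T.1.isTree.1.swap hψ
    exact ⟨⟨χ₁, hχ₁⟩, ⟨χ₂.swap, hχ₂⟩⟩
  · rintro ⟨⟨χ₁, hu, hc⟩, ⟨χ₂, hv, hd⟩⟩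
    let ψ : (S.join T).Iso (S'.join T') := χ₁.joinCorners χ₂.swap hu hc hv hd
    exact ⟨ψ.doubleEdge rfl, rfl⟩

theorem exists_glue_equiv (U : TwoOneMap) : ∃ S T, glue S T ≈ U := by
  obtain ⟨S, T, φ, hφ⟩ := U.exists_iso_join
  exact ⟨S, T, (equiv_iff_exists_iso (isInner_glue S T) hφ).2 ⟨BMap.Iso.refl _, rfl⟩⟩

/-- Gluing, as a bijection from pairs of isomorphism classes of rooted trees to isomorphism classes
of `2^1`-maps. -/
noncomputable def glueEquiv : Quotient CornerTree.isoSetoid × Quotient CornerTree.isoSetoid ≃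
    Quotient TwoOneMap.isoSetoid :=
  Equiv.ofBijective (fun p => ⟦glue p.1.out p.2.out⟧) <| by
    constructor
    · rintro ⟨σ, τ⟩ ⟨σ', τ'⟩ h
      obtain ⟨hσ, hτ⟩ := glue_equiv_glue_iff.1 (Quotient.exact h)
      exact Prod.ext (Quotient.out_equiv_out.1 hσ) (Quotient.out_equiv_out.1 hτ)
    · refine Quotient.ind fun U => ?_
      obtain ⟨S, T, h⟩ := U.exists_glue_equiv
      exact ⟨(⟦S⟧, ⟦T⟧), Quotient.sound (Setoid.trans
        (glue_equiv_glue_iff.2 ⟨Quotient.mk_out S, Quotient.mk_out T⟩) h)⟩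

theorem weight_eq {U U' : TwoOneMap} (h : U ≈ U') : U.map.weight = U'.map.weight := by
  obtain ⟨φ, -⟩ := h
  rw [BMap.weight_eq_colWeight, BMap.weight_eq_colWeight, φ.colWeight_eq]

theorem weight_glue (S T : CornerTree) : (glue S T).map.weight =
    S.rootWeight Var.a Var.b + T.rootWeight Var.b Var.a := by
  have hW : ∀ w, ((S.join T).doubleEdge none).degW w =
      Sum.elim (fun w => S.1.map.degW w + if S.2.1.1 = w then 2 else 0) T.1.map.degB w :=
    BMap.degW_doubleEdge_joinCorners S.2.2 T.2.2
  have hB : ∀ b, ((S.join T).doubleEdge none).degB b =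
      Sum.elim S.1.map.degB (fun b => T.1.map.degW b + if T.2.1.1 = b then 2 else 0) b :=
    BMap.degB_doubleEdge_joinCorners S.2.2 T.2.2
  have hE : Nat.card (Option (Option (Fin S.1.nE ⊕ Fin T.1.nE))) =
      (S.1.nE + 1) + (T.1.nE + 1) := by
    simp only [Finite.card_option, Nat.card_sum, Nat.card_fin]
    omega
  have hV : Nat.card (Fin S.1.nW ⊕ Fin T.1.nB) + Nat.card (Fin S.1.nB ⊕ Fin T.1.nW) =
      (S.1.nW + S.1.nB) + (T.1.nW + T.1.nB) := by
    simp only [Nat.card_sum, Nat.card_fin]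
    omega
  rw [BMap.weight_eq_colWeight, (glueIso S T).colWeight_eq, BMap.colWeight, hE, hV,
    Finsupp.single_add (a := Var.t), Finsupp.single_add (a := Var.x), Fintype.sum_sum_type,
    Fintype.sum_sum_type, CornerTree.rootWeight, CornerTree.rootWeight]
  simp only [hW, hB, Sum.elim_inl, Sum.elim_inr]
  abel

end TwoOneMap

theorem CornerTree.finite_out_rootWeight {v₁ v₂ : ℕ → Var} (hv : Function.Injective v₁)
    (hfin : ∀ d, Finite {S : PlaneTree // S.map.colWeight v₁ v₂ = d}) (d : Var →₀ ℕ) :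
    Finite {τ : Quotient CornerTree.isoSetoid // τ.out.rootWeight v₁ v₂ = d} :=
  have := CornerTree.finite_rootWeight hv hfin d
  .of_injective (Subtype.map (q := fun S : CornerTree => S.rootWeight v₁ v₂ = d) Quotient.out
    fun _ h => h) (Subtype.map_injective _ Quotient.out_injective)

theorem twoOneSeries_eq_mul :
    twoOneSeries = rootedSeries Var.a Var.b * rootedSeries Var.b Var.a := by
  rw [rootedSeries, rootedSeries, genSeries_mul
    (CornerTree.finite_out_rootWeight Var.a_injective PlaneTree.finite_colWeight_a_b)
    (CornerTree.finite_out_rootWeight Var.b_injective PlaneTree.finite_colWeight_b_a)]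
  refine (genSeries_equiv TwoOneMap.glueEquiv (fun p => ?_) fun _ => (mul_one 1).symm).symm
  rw [← TwoOneMap.weight_glue]
  exact TwoOneMap.weight_eq (Quotient.mk_out (TwoOneMap.glue p.1.out p.2.out))

/-- The series `T` is the generating function of plane bipartite trees, and the generating function
of `2^1`-maps is `D_a(T) * D_b(T)`. -/
theorem theorem2p1 :
    seriesT = planeTreeSeries ∧ twoOneSeries = opDa seriesT * opDb seriesT := by
  refine ⟨seriesT_eq_planeTreeSeries, ?_⟩
  rw [twoOneSeries_eq_mul, opDa, opDb, seriesT_eq_planeTreeSeries]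
  congr 1
  · rw [← labelledTreeSeries_a_b, diffOp_labelledTreeSeries Var.a_injective
      PlaneTree.finite_colWeight_a_b (by simp) (by simp) (by simp)]
  · rw [← labelledTreeSeries_b_a, diffOp_labelledTreeSeries Var.b_injective
      PlaneTree.finite_colWeight_b_a (by simp) (by simp) (by simp)]
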